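/- Logarithms are to base $2$. A Label Cover instance $\mathcal L=(A,B,E,\Sigma,\{\pi_e\}_{e\in E})$ consists of a bipartite graph $(A,B,E)$, a finite alphabet $\Sigma$ and a projection $\pi_e:\Sigma\to\Sigma$ for every edge $e$. An assignment $\phi:A\cup B\to\Sigma$ satisfies the edge $(a,b)$ if $\pi_{(a,b)}(\phi(a))=\phi(b)$; $\mathrm{val}(\mathcal L)$ is the maximum over all assignments of the fraction of satisfied edges, and $\mathcal L$ is satisfiable if some assignment satisfies all edges. $\mathcal L$ is bi-regular if all vertices of $A$ have the same degree and all vertices of $B$ have the same degree. Put $n=|A|+|B|$ and $r=\sqrt n/\log n$. We assume throughout that $E\neq\emptyset$ and $|\Sigma|\ge 2$. Theorem. There are a polynomial $p$ and a randomized algorithm which is given a bi-regular Label Cover instance $\mathcal L$ and a parameter $\delta>0$ (of which it only needs the integer $\lceil 1/\delta\rceil$) and which outputs, explicitly, a finite ground set $\mathcal U$ and a concept class $\mathcal C$ of subsets of $\mathcal U$, such that the following holds for every fixed $\delta>0$ and every fixed bound on $|\Sigma|$, for all sufficiently large $n$. (Size) The algorithm always runs in time at most $|\Sigma|^{|E|\,p(1/\delta)/r}$,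 and $|\mathcal C|,|\mathcal U|\le|\Sigma|^{|E|\,p(1/\delta)/r}$. (Completeness) If $\mathcal L$ is satisfiable, then the VC dimension of $\mathcal C$ is (always) at least $2r$. (Soundness) If $\mathrm{val}(\mathcal L)\le\delta^2/100$, then with high probability, namely with probability at least $1-1/n$ over the coin tosses of the algorithm, the VC dimension of $\mathcal C$ is at most $(1+\delta)r$. Moreover, there is an absolute constant $n_0$ such that the same three properties hold for all $n\ge n_0$ even when $\delta$ and $|\Sigma|$ are not constants, as long as $\delta\ge\log(1000\,n\log|\Sigma|)/r$. -/

import Mathlib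

open MeasureTheory
open scoped ENNReal

/-! ### Label Cover -/

/-- A Label Cover instance: a bipartite graph with sides `Fin a` and `Fin b` and edge set `E`,
the alphabet `Fin k`, and for each edge `e` a projection `proj e` of the alphabet to itself
(the values of `proj` outside `E` are never used). -/
structure LabelCover where
  a : ℕ
  b : ℕ
  k : ℕ
  E : Finset (Fin a × Fin b)
  proj : Fin a × Fin b → Fin k → Fin k

namespace LabelCover

/-- Number of vertices. -/
def n (L : LabelCover) : ℕ := L.a + L.b

/-- `r = √n / log n`, logarithm to base two. -/
noncomputable def r (L : LabelCover) : ℝ := √(L.n : ℝ) / Real.logb 2 (L.n : ℝ)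

/-- An assignment labels all the vertices on both sides. -/
abbrev Assignment (L : LabelCover) : Type := Fin L.a ⊕ Fin L.b → Fin L.k

/-- The assignment `φ` satisfies the edge `e`. -/
def SatisfiesEdge (L : LabelCover) (φ : L.Assignment) (e : Fin L.a × Fin L.b) : Prop :=
  L.proj e (φ (Sum.inl e.1)) = φ (Sum.inr e.2)

open Classical in
/-- The value of an assignment: the fraction of satisfied edges. -/
noncomputable def valOf (L : LabelCover) (φ : L.Assignment) : ℝ :=
  ((L.E.filter fun e => L.SatisfiesEdge φ e).card : ℝ) / (L.E.card : ℝ)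

/-- The value of the instance: the maximum value of an assignment. -/
noncomputable def val (L : LabelCover) : ℝ := ⨆ φ : L.Assignment, L.valOf φ

/-- Some assignment satisfies all the edges. -/
def Satisfiable (L : LabelCover) : Prop :=
  ∃ φ : L.Assignment, ∀ e ∈ L.E, L.SatisfiesEdge φ e

/-- All vertices on the same side have the same degree. -/
def BiRegular (L : LabelCover) : Prop :=
  ∃ dA dB : ℕ,
    (∀ i : Fin L.a, (L.E.filter fun e => e.1 = i).card = dA) ∧
    (∀ j : Fin L.b, (L.E.filter fun e => e.2 = j).card = dB)

end LabelCover

/-! ### Finite concept classes -/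

/-- A concept class over the ground set `Fin u`. Shattering and the VC dimension are Mathlib's
`Finset.Shatters` and `Finset.vcDim`. -/
structure ConceptClass where
  u : ℕ
  concepts : Finset (Finset (Fin u))

/-! ### Randomized programs with a step count

The machine model is a WHILE language with coin tosses. Data are finite binary trees, every
primitive operation takes one step, and a value is built only by consing values already computed,
so that each step is a constant number of pointer operations. -/

/-- Binary trees, the data of the programs. -/
inductive Datum where
  | nil : Datum
  | cons : Datum → Datum → Datum

namespace Datum

/-- Left subtree (`nil` has the left subtree `nil`). -/
def hd : Datum → Datum
  | nil => nil
  | cons x _ => x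

/-- Right subtree (`nil` has the right subtree `nil`). -/
def tl : Datum → Datum
  | nil => nil
  | cons _ y => y

/-- `false` is `nil`, and `true` is a non-`nil` tree. -/
def ofBool : Bool → Datum
  | false => nil
  | true => cons nil nil

/-- A list, as a right comb. -/
def ofList : List Datum → Datum
  | [] => nil
  | x :: l => cons x (ofList l)

/-- A natural number in unary. -/
def ofNat : ℕ → Datum
  | 0 => nil
  | m + 1 => cons nil (ofNat m)

end Datum

/-- Programs. A program turns one datum into another. -/
inductive Prog where
  /-- return the input -/
  | id : Prog
  /-- return `nil` -/
  | nil : Prog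
  /-- return the left subtree of the input -/
  | hd : Prog
  /-- return the right subtree of the input -/
  | tl : Prog
  /-- run both programs on the input, and join the two results by `cons` -/
  | pair : Prog → Prog → Prog
  /-- run the first program, then the second one on its result -/
  | comp : Prog → Prog → Prog
  /-- `ite c f g`: run `c` on the input; run `f` on the input if the result is not `nil`,
  and `g` on the input otherwise -/
  | ite : Prog → Prog → Prog → Prog
  /-- `loop c f`: as long as `c` does not return `nil` on the current datum, replace that
  datum by the result of `f` on it -/
  | loop : Prog → Prog → Prog
  /-- return the outcome of a fresh coin toss -/
  | coin : Prog

/-- `Run ω p x i y j t`: when `ω` is the sequence of coin outcomes, of which the first `i` have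
been used, the program `p` on input `x` halts after `t` steps with result `y`, and then the first
`j` coins have been used. -/
inductive Run (ω : ℕ → Bool) : Prog → Datum → ℕ → Datum → ℕ → ℕ → Prop where
  | id (x : Datum) (i : ℕ) : Run ω .id x i x i 1
  | nil (x : Datum) (i : ℕ) : Run ω .nil x i .nil i 1
  | hd (x : Datum) (i : ℕ) : Run ω .hd x i x.hd i 1
  | tl (x : Datum) (i : ℕ) : Run ω .tl x i x.tl i 1
  | pair {f g : Prog} {x y z : Datum} {i j l s t : ℕ} :
      Run ω f x i y j s → Run ω g x j z l t →
      Run ω (.pair f g) x i (.cons y z) l (s + t + 1)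
  | comp {f g : Prog} {x y z : Datum} {i j l s t : ℕ} :
      Run ω f x i y j s → Run ω g y j z l t →
      Run ω (.comp f g) x i z l (s + t + 1)
  | ite_true {c f g : Prog} {x v w y : Datum} {i j l s t : ℕ} :
      Run ω c x i (.cons v w) j s → Run ω f x j y l t →
      Run ω (.ite c f g) x i y l (s + t + 1)
  | ite_false {c f g : Prog} {x y : Datum} {i j l s t : ℕ} :
      Run ω c x i .nil j s → Run ω g x j y l t →
      Run ω (.ite c f g) x i y l (s + t + 1)
  | loop_stop {c f : Prog} {x : Datum} {i j s : ℕ} :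
      Run ω c x i .nil j s → Run ω (.loop c f) x i x j (s + 1)
  | loop_step {c f : Prog} {x v w y z : Datum} {i j l m s t q : ℕ} :
      Run ω c x i (.cons v w) j s → Run ω f x j y l t → Run ω (.loop c f) y l z m q →
      Run ω (.loop c f) x i z m (s + t + q + 1)
  | coin (x : Datum) (i : ℕ) : Run ω .coin x i (Datum.ofBool (ω i)) (i + 1) 1

/-- The law of a sequence of independent fair coin tosses. -/
noncomputable def coinMeasure : Measure (ℕ → Bool) :=
  Measure.infinitePi fun _ : ℕ => (PMF.uniformOfFintype Bool).toMeasure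

/-! ### Encodings -/

/-- The input of a reduction: the integer `q`, the sizes of the two sides and of the alphabet, and
the list of the edges in lexicographic order, each one with the table of its projection. -/
def LabelCover.encode (L : LabelCover) (q : ℕ) : Datum :=
  Datum.ofList
    [Datum.ofNat q, Datum.ofNat L.a, Datum.ofNat L.b, Datum.ofNat L.k,
      Datum.ofList ((((List.finRange L.a).product (List.finRange L.b)).filter
        fun e => decide (e ∈ L.E)).map fun e =>
          Datum.ofList [Datum.ofNat e.1.val, Datum.ofNat e.2.val,
            Datum.ofList ((List.finRange L.k).map fun s => Datum.ofNat (L.proj e s).val)])]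

/-- `y` is an explicit description of the concept class `K`: the size of the ground set, and a
binary matrix, the rows of which are the indicator vectors of the concepts (in some order,
repetitions allowed). -/
def Datum.Describes (y : Datum) (K : ConceptClass) : Prop :=
  ∃ rows : List (Finset (Fin K.u)), rows.toFinset = K.concepts ∧
    y = Datum.cons (Datum.ofNat K.u)
      (Datum.ofList (rows.map fun S =>
        Datum.ofList ((List.finRange K.u).map fun i => Datum.ofBool (decide (i ∈ S)))))

/-- On input `x` with coin outcomes `ω`, the program `R` halts within `B` steps and outputs an
explicit description of `K`. -/
def Prog.OutputsWithin (R : Prog) (x : Datum) (ω : ℕ → Bool) (K : ConceptClass) (B : ℝ) : Prop :=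
  ∃ (y : Datum) (j t : ℕ), Run ω R x 0 y j t ∧ y.Describes K ∧ (t : ℝ) ≤ B

/-! ### The guarantees of the reduction -/

/-- The bound `|Σ| ^ (|E| * P(1/δ) / r)`. -/
noncomputable def sizeBound (P : Polynomial ℝ) (δ : ℝ) (L : LabelCover) : ℝ :=
  (L.k : ℝ) ^ ((L.E.card : ℝ) * P.eval (1 / δ) / L.r)

/-- Size, completeness and soundness of the randomized reduction `R` on the instance `L` with
parameter `δ`, which the program receives as the integer `⌈1/δ⌉`. Here `K ω` is the concept class
that is output when the coin outcomes are `ω`. -/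
def ReductionGuarantee (P : Polynomial ℝ) (R : Prog) (δ : ℝ) (L : LabelCover) : Prop :=
  ∃ K : (ℕ → Bool) → ConceptClass,
    (∀ ω, R.OutputsWithin (L.encode ⌈1 / δ⌉₊) ω (K ω) (sizeBound P δ L) ∧
      ((K ω).concepts.card : ℝ) ≤ sizeBound P δ L ∧ ((K ω).u : ℝ) ≤ sizeBound P δ L) ∧
    (L.Satisfiable → ∀ ω, 2 * L.r ≤ ((K ω).concepts.vcDim : ℝ)) ∧
    (L.val ≤ δ ^ 2 / 100 →
      coinMeasure {ω | ¬ (((K ω).concepts.vcDim : ℝ) ≤ (1 + δ) * L.r)} ≤ 1 / (L.n : ℝ≥0∞))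

/-! Let R (`parts`) be an integer with r ≤ R < r + 2, and distribute the left vertices over R parts.
The ground set consists of R test selection elements and of all labellings of each part. A concept
is given by a set of selection elements, encoded by a number p < 2^R, by a set of parts, and by one
label for each of the `rounds` random tests attached to p. A test is a random pair of edges with a
common right end, and its label claims to be the label of that end. A labelling of a chosen part
belongs to the concept if it projects to the claimed labels in all tests that touch it.

Completeness (`two_parts_le_vcDim`): the selection elements and the R restrictions of a satisfying
assignment are shattered, because the assignment answers every test. Hence the dimension is at least
2R.

Soundness: let S be shattered with |S| ≥ R + T, let P be the set of parts that occur in S, and fix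
one element of S in each of them. For every subset B of the remaining elements some concept
contains, within S, exactly the fixed elements and B. The fixed elements determine the labels of all
tests that touch P, so B is determined by the selection number p (`exists_passed_of_shatters`). The
fixed labelling therefore passes the tests of 2^(|S|-|P|) selections. Since there are only 2^R
selections, |P| ≥ T, so that the labelling covers a share T/(2R) of the left vertices; since |P| ≤
R, at least N = 2^T selections are passed. By Cauchy-Schwarz a labelling of a set of density ρ
violates a share ρ² - val of all pairs (`badPairs_density`), hence it passes the tests of one
selection with probability at most 2^(-4R). The union bound over all labellings and all sets of N
selections (`coinMeasure_exists_avoid_le`) succeeds once N ≥ 250 n log|Σ|, and this is what the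
condition on δ ensures.

Size: the exponential quantities are 2^√n, 2^R, |Σ|^(n/R) and |Σ|^rounds. They are powers of the
claimed size because n ≤ 2|E| and n/r = r log² n (`expWeight_add_esize_le`). The program is obtained
from closure properties of `Feasible`, the main one being `Feasible.foldl`; all coins are tossed
before the concept class is computed (`exists_reduction`). -/

/-! ### Encodings and polynomially bounded quantities -/

/-- Number of nodes of a tree. -/
def Datum.size : Datum → ℕ
  | nil => 1
  | cons x y => x.size + y.size + 1

theorem Datum.one_le_size (d : Datum) : 1 ≤ d.size := by
  cases d <;> simp [Datum.size]

/-- Types whose elements are represented by trees. -/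
class Enc (α : Type) where
  /-- The tree that represents an element. -/
  enc : α → Datum

open Enc (enc)

instance : Enc Unit := ⟨fun _ => .nil⟩
instance : Enc ℕ := ⟨Datum.ofNat⟩
instance : Enc Bool := ⟨Datum.ofBool⟩
instance {α β : Type} [Enc α] [Enc β] : Enc (α × β) := ⟨fun p => .cons (enc p.1) (enc p.2)⟩
instance {α : Type} [Enc α] : Enc (List α) := ⟨fun l => .ofList (l.map enc)⟩

/-- Size of the representation. -/
def esize {α : Type} [Enc α] (x : α) : ℕ := (enc x).size

section EncLemmas

variable {α β : Type} [Enc α] [Enc β]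

theorem one_le_esize (x : α) : 1 ≤ esize x := Datum.one_le_size _

theorem enc_pair (x : α) (y : β) : enc (x, y) = .cons (enc x) (enc y) := rfl

theorem enc_cons (x : α) (l : List α) : enc (x :: l) = .cons (enc x) (enc l) := rfl

theorem esize_pair (x : α) (y : β) : esize (x, y) = esize x + esize y + 1 := rfl

theorem esize_nil : esize ([] : List α) = 1 := rfl

theorem esize_cons (x : α) (l : List α) : esize (x :: l) = esize x + esize l + 1 := rfl

theorem esize_nat (n : ℕ) : esize n = 2 * n + 1 := by
  induction n with
  | zero => rfl
  | succ n ih =>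
    have : esize (n + 1) = 1 + esize n + 1 := rfl
    omega

theorem esize_bool (b : Bool) : esize b ≤ 3 := by
  cases b <;> decide

theorem esize_list (l : List α) : esize l = (l.map fun x => esize x + 1).sum + 1 := by
  induction l with
  | nil => rfl
  | cons x l ih => simp only [esize_cons, ih, List.map_cons, List.sum_cons]; omega

theorem length_le_esize (l : List α) : l.length + 1 ≤ esize l := by
  induction l with
  | nil => simp [esize_nil]
  | cons x l ih => simp only [esize_cons, List.length_cons]; omega

theorem esize_le_of_mem {x : α} {l : List α} (h : x ∈ l) : esize x ≤ esize l := by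
  induction l with
  | nil => simp at h
  | cons y l ih =>
    rw [esize_cons]
    rcases List.mem_cons.1 h with rfl | h
    · omega
    · have := ih h; omega

theorem esize_list_le {l : List α} {N B : ℕ} (hN : l.length ≤ N) (hB : ∀ x ∈ l, esize x ≤ B) :
    esize l ≤ N * (B + 1) + 1 := by
  have h : ∀ l : List α, (∀ x ∈ l, esize x ≤ B) → esize l ≤ l.length * (B + 1) + 1 := by
    intro l
    induction l with
    | nil => intro _; simp [esize_nil]
    | cons y l ih =>
      intro h
      have h1 := ih fun x hx => h x (List.mem_cons_of_mem _ hx)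
      have h2 := h y List.mem_cons_self
      rw [esize_cons, List.length_cons, Nat.succ_mul]
      omega
  exact (h l hB).trans (by gcongr)

theorem esize_append (l l' : List α) : esize (l ++ l') + 1 = esize l + esize l' := by
  induction l with
  | nil => simp [esize_nil]; omega
  | cons y l ih => simp only [List.cons_append, esize_cons]; omega

/-- Unary numbers and lists of units are the same trees, so that arithmetic reduces to list
programs. -/
theorem enc_replicate (n : ℕ) : enc (List.replicate n ()) = enc n := by
  induction n with
  | zero => rfl
  | succ n ih => rw [List.replicate_succ, enc_cons, ih]; rfl

end EncLemmas

/-- `g` is bounded by a power of `W`. -/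
def PolyBdd {α : Type} (W g : α → ℕ) : Prop := ∃ c : ℕ, ∀ x, g x ≤ W x ^ c

namespace PolyBdd

variable {α β : Type} {W g h : α → ℕ}

theorem mono (hg : PolyBdd W g) (hh : ∀ x, h x ≤ g x) : PolyBdd W h := by
  obtain ⟨c, hc⟩ := hg
  exact ⟨c, fun x => (hh x).trans (hc x)⟩

theorem self : PolyBdd W W := ⟨1, fun x => by simp⟩

/-- The constant serves as its own exponent, by `c < 2 ^ c`; this is why `weight` is made at least
two. -/
theorem const (hW : ∀ x, 2 ≤ W x) (c : ℕ) : PolyBdd W fun _ => c :=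
  ⟨c, fun x => (Nat.lt_two_pow_self).le.trans (Nat.pow_le_pow_left (hW x) c)⟩

theorem mul (hg : PolyBdd W g) (hh : PolyBdd W h) : PolyBdd W fun x => g x * h x := by
  obtain ⟨c, hc⟩ := hg
  obtain ⟨d, hd⟩ := hh
  exact ⟨c + d, fun x => by rw [pow_add]; exact Nat.mul_le_mul (hc x) (hd x)⟩

theorem add (hW : ∀ x, 2 ≤ W x) (hg : PolyBdd W g) (hh : PolyBdd W h) :
    PolyBdd W fun x => g x + h x := by
  obtain ⟨c, hc⟩ := hg
  obtain ⟨d, hd⟩ := hh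
  refine ⟨c + d + 1, fun x => ?_⟩
  have h1 : 1 ≤ W x := by have := hW x; omega
  calc g x + h x ≤ W x ^ c + W x ^ d := Nat.add_le_add (hc x) (hd x)
    _ ≤ W x ^ (c + d) + W x ^ (c + d) := by
        gcongr <;> first | exact h1 | omega
    _ = 2 * W x ^ (c + d) := by ring
    _ ≤ W x * W x ^ (c + d) := by gcongr; exact hW x
    _ = W x ^ (c + d + 1) := by ring

theorem comp {V k : β → ℕ} {f : α → β} (hk : PolyBdd V k) (hV : PolyBdd W fun x => V (f x)) :
    PolyBdd W fun x => k (f x) := by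
  obtain ⟨c, hc⟩ := hk
  obtain ⟨d, hd⟩ := hV
  exact ⟨d * c, fun x => (hc _).trans (by rw [pow_mul]; exact Nat.pow_le_pow_left (hd x) c)⟩

end PolyBdd

/-! ### Feasible functions -/

/-- The quantity in which the running time is polynomially bounded: `w` plus the input size. -/
def weight {α : Type} [Enc α] (w : α → ℕ) (x : α) : ℕ := w x + esize x + 1

theorem two_le_weight {α : Type} [Enc α] (w : α → ℕ) (x : α) : 2 ≤ weight w x := by
  have := one_le_esize x; unfold weight; omega

/-- `f` is computed by a program without coins, in time and with output size polynomial in the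
input size plus `w`. -/
def Feasible {α β : Type} [Enc α] [Enc β] (w : α → ℕ) (f : α → β) : Prop :=
  PolyBdd (weight w) (fun x => esize (f x)) ∧
  ∃ (p : Prog) (T : α → ℕ), PolyBdd (weight w) T ∧
    ∀ x ω i, ∃ t ≤ T x, Run ω p (enc x) i (enc (f x)) i t

namespace Feasible

variable {α β γ δ σ : Type} [Enc α] [Enc β] [Enc γ] [Enc δ] [Enc σ] {w : α → ℕ}

theorem size {f : α → β} (hf : Feasible w f) : PolyBdd (weight w) fun x => esize (f x) := hf.1

theorem bddConst (w : α → ℕ) (c : ℕ) : PolyBdd (weight w) fun _ => c :=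
  PolyBdd.const (two_le_weight w) c

theorem bddAdd {g h : α → ℕ} (hg : PolyBdd (weight w) g) (hh : PolyBdd (weight w) h) :
    PolyBdd (weight w) fun x => g x + h x := PolyBdd.add (two_le_weight w) hg hh

theorem bddSelf (w : α → ℕ) : PolyBdd (weight w) fun x => esize x :=
  PolyBdd.self.mono fun x => by unfold weight; omega

theorem bddWeight (w : α → ℕ) : PolyBdd (weight w) w :=
  PolyBdd.self.mono fun x => by unfold weight; omega

theorem congr {f g : α → β} (hf : Feasible w f) (h : ∀ x, f x = g x) : Feasible w g := by
  have : f = g := funext h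
  exact this ▸ hf

/-- A program sees only trees, so types with equal representations can be exchanged: a pair becomes
a list cell, a list of units becomes a number. -/
theorem congrEnc {f : α → β} {g : α → γ} (hf : Feasible w f) (h : ∀ x, enc (f x) = enc (g x)) :
    Feasible w g := by
  obtain ⟨hs, p, T, hT, hr⟩ := hf
  refine ⟨hs.mono fun _ => ?_, p, T, hT, fun x ω i => ?_⟩
  · rw [esize, esize, h]
  · rw [← h]; exact hr x ω i

/-- `hv` expresses the auxiliary weight of the outer function in terms of the original input;
polynomials are closed under composition. -/
theorem comp {v : β → ℕ} {g : β → γ} {f : α → β} (hg : Feasible v g) (hf : Feasible w f)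
    (hv : PolyBdd (weight w) fun x => v (f x)) : Feasible w fun x => g (f x) := by
  obtain ⟨hs, p, T, hT, hr⟩ := hf
  obtain ⟨hs', p', T', hT', hr'⟩ := hg
  have hV : PolyBdd (weight w) fun x => weight v (f x) :=
    bddAdd (bddAdd hv hs) (bddConst w 1)
  refine ⟨hs'.comp hV, .comp p p', fun x => T x + T' (f x) + 1,
    bddAdd (bddAdd hT (hT'.comp hV)) (bddConst w 1), fun x ω i => ?_⟩
  obtain ⟨t, ht, h1⟩ := hr x ω i
  obtain ⟨t', ht', h2⟩ := hr' (f x) ω i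
  exact ⟨_, by dsimp only; omega, .comp h1 h2⟩

theorem id (w : α → ℕ) : Feasible w fun x => x :=
  ⟨bddSelf w, .id, fun _ => 1, bddConst w 1, fun _ _ _ => ⟨1, le_rfl, .id _ _⟩⟩

/-- A function which a program without loops computes node by node. -/
theorem ofProg {f : α → β} (p : Prog) (T : ℕ)
    (hs : PolyBdd (weight w) fun x => esize (f x))
    (h : ∀ x ω i, ∃ t ≤ T, Run ω p (enc x) i (enc (f x)) i t) : Feasible w f :=
  ⟨hs, p, fun _ => T, bddConst w T, h⟩

theorem pair {f : α → β} {g : α → γ} (hf : Feasible w f) (hg : Feasible w g) :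
    Feasible w fun x => (f x, g x) := by
  obtain ⟨hs, p, T, hT, hr⟩ := hf
  obtain ⟨hs', p', T', hT', hr'⟩ := hg
  refine ⟨bddAdd (bddAdd hs hs') (bddConst w 1), .pair p p', fun x => T x + T' x + 1,
    bddAdd (bddAdd hT hT') (bddConst w 1), fun x ω i => ?_⟩
  obtain ⟨t, ht, h1⟩ := hr x ω i
  obtain ⟨t', ht', h2⟩ := hr' x ω i
  exact ⟨_, by dsimp only; omega, .pair h1 h2⟩

theorem fst {f : α → β × γ} (hf : Feasible w f) : Feasible w fun x => (f x).1 := by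
  refine comp (v := fun _ => 0) (g := Prod.fst) ?_ hf (bddConst w 0)
  refine ofProg .hd 1 ((bddSelf _).mono fun x => ?_) fun x ω i => ⟨1, le_rfl, .hd _ _⟩
  have := esize_pair x.1 x.2; rw [Prod.mk.eta] at this; omega

theorem snd {f : α → β × γ} (hf : Feasible w f) : Feasible w fun x => (f x).2 := by
  refine comp (v := fun _ => 0) (g := Prod.snd) ?_ hf (bddConst w 0)
  refine ofProg .tl 1 ((bddSelf _).mono fun x => ?_) fun x ω i => ⟨1, le_rfl, .tl _ _⟩
  have := esize_pair x.1 x.2; rw [Prod.mk.eta] at this; omega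

/-- A function of the first component of the context. -/
theorem weaken {f : α → β} (hf : Feasible w f) :
    Feasible (fun p : α × γ => w p.1) fun p => f p.1 :=
  comp hf (fst (id _)) (bddWeight _)

theorem cond {b : α → Bool} {f g : α → β} (hb : Feasible w b) (hf : Feasible w f)
    (hg : Feasible w g) : Feasible w fun x => if b x then f x else g x := by
  obtain ⟨hs₀, p₀, T₀, hT₀, hr₀⟩ := hb
  obtain ⟨hs, p, T, hT, hr⟩ := hf
  obtain ⟨hs', p', T', hT', hr'⟩ := hg
  refine ⟨(bddAdd hs hs').mono fun x => by dsimp only; split <;> omega, .ite p₀ p p',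
    fun x => T₀ x + (T x + T' x) + 1,
    bddAdd (bddAdd hT₀ (bddAdd hT hT')) (bddConst w 1), fun x ω i => ?_⟩
  obtain ⟨t₀, ht₀, h0⟩ := hr₀ x ω i
  obtain ⟨t, ht, h1⟩ := hr x ω i
  obtain ⟨t', ht', h2⟩ := hr' x ω i
  cases hbx : b x with
  | true =>
    rw [hbx] at h0
    refine ⟨_, ?_, .ite_true h0 (by simpa only [hbx, if_true, Bool.false_eq_true, if_false] using h1)⟩
    dsimp only; omega
  | false =>
    rw [hbx] at h0
    refine ⟨_, ?_, .ite_false h0 (by simpa only [hbx, if_true, Bool.false_eq_true, if_false] using h2)⟩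
    dsimp only; omega

theorem nilConst : Feasible w fun _ => ([] : List β) :=
  ofProg .nil 1 (bddConst w 1) fun _ _ _ => ⟨1, le_rfl, .nil _ _⟩

theorem unitConst : Feasible w fun _ => () :=
  ofProg .nil 1 (bddConst w 1) fun _ _ _ => ⟨1, le_rfl, .nil _ _⟩

theorem cons {f : α → β} {l : α → List β} (hf : Feasible w f) (hl : Feasible w l) :
    Feasible w fun x => f x :: l x :=
  congrEnc (pair hf hl) fun _ => rfl

theorem zeroConst : Feasible w fun _ => 0 := congrEnc nilConst (f := fun _ => ([] : List Unit)) fun _ => rfl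

theorem succ {f : α → ℕ} (hf : Feasible w f) : Feasible w fun x => f x + 1 :=
  congrEnc (pair unitConst hf) fun _ => rfl

theorem natConst (n : ℕ) : Feasible w fun _ => n := by
  induction n with
  | zero => exact zeroConst
  | succ n ih => exact succ ih

theorem falseConst : Feasible w fun _ => false := congrEnc zeroConst fun _ => rfl

theorem trueConst : Feasible w fun _ => true :=
  congrEnc (natConst 1) fun _ => rfl

theorem tail {l : α → List β} (hl : Feasible w l) : Feasible w fun x => (l x).tail := by
  refine comp (v := fun _ => 0) (g := List.tail) ?_ hl (bddConst w 0)
  refine ofProg .tl 1 ((bddSelf _).mono fun x => ?_) fun x ω i => ⟨1, le_rfl, ?_⟩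
  · cases x with
    | nil => exact le_rfl
    | cons y l => rw [esize_cons, List.tail_cons]; omega
  · have : enc x.tail = (enc x).tl := by cases x <;> rfl
    rw [this]; exact .tl _ _

/-- First entry of a list, where the default is represented by `nil`. -/
theorem headD {l : α → List β} {d : β} (hd : enc d = .nil) (hl : Feasible w l) :
    Feasible w fun x => (l x).headD d := by
  refine comp (v := fun _ => 0) (g := fun l => List.headD l d) ?_ hl (bddConst w 0)
  refine ofProg .hd 1 ((bddSelf _).mono fun x => ?_) fun x ω i => ⟨1, le_rfl, ?_⟩
  · cases x with
    | nil => rw [List.headD_nil, esize, hd]; exact Datum.one_le_size _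
    | cons y l => rw [esize_cons, List.headD_cons]; omega
  · have : enc (x.headD d) = (enc x).hd := by
      cases x with
      | nil => exact hd
      | cons => rfl
    rw [this]; exact .hd _ _

theorem takeOne {l : α → List β} (hl : Feasible w l) : Feasible w fun x => (l x).take 1 := by
  refine comp (v := fun _ => 0) (g := fun l => List.take 1 l) ?_ hl (bddConst w 0)
  refine ofProg (.ite .id (.pair .hd .nil) .nil) 5 ((bddSelf _).mono fun x => ?_) fun x ω i => ?_
  · cases x with
    | nil => exact le_rfl
    | cons y l =>
      have : List.take 1 (y :: l) = [y] := rfl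
      have := one_le_esize l
      rw [‹List.take 1 (y :: l) = [y]›, esize_cons, esize_cons, esize_nil]; omega
  · cases x with
    | nil => exact ⟨3, by omega, .ite_false (.id _ _) (.nil _ _)⟩
    | cons y l => exact ⟨5, by omega, .ite_true (.id _ _) (.pair (.hd _ _) (.nil _ _))⟩

theorem isNil {l : α → List β} (hl : Feasible w l) : Feasible w fun x => (l x).isEmpty := by
  refine comp (v := fun _ => 0) (g := List.isEmpty) ?_ hl (bddConst w 0)
  refine ofProg (.ite .id .nil (.pair .nil .nil)) 5
    ((bddConst _ 3).mono fun x => esize_bool _) fun x ω i => ?_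
  cases x with
  | nil => exact ⟨5, by omega, .ite_false (.id _ _) (.pair (.nil _ _) (.nil _ _))⟩
  | cons y l => exact ⟨3, by omega, .ite_true (.id _ _) (.nil _ _)⟩

/-- The loop carries the triple (context, state, remaining list) and stops when the list is `nil`.
The time bound `τ` is required only for states that occur, that is, after prefixes of the list. -/
theorem foldl_loop {step : α → σ → β → σ} {p : Prog} {T : α × σ × β → ℕ}
    (hp : ∀ x ω i, ∃ t ≤ T x, Run ω p (enc x) i (enc (step x.1 x.2.1 x.2.2)) i t)
    (x : α) {τ : ℕ} (l : List β) (s : σ)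
    (hτ : ∀ l' b, (l' ++ [b]) <+: l → T (x, l'.foldl (step x) s, b) ≤ τ) (ω : ℕ → Bool) (i : ℕ) :
    ∃ t ≤ l.length * (τ + 30) + 4, Run ω
      (.loop (.comp .tl .tl)
        (.pair .hd (.pair (.comp (.pair .hd (.pair (.comp .tl .hd) (.comp .tl (.comp .tl .hd)))) p)
          (.comp .tl (.comp .tl .tl)))))
      (enc (x, s, l)) i (enc (x, l.foldl (step x) s, ([] : List β))) i t := by
  induction l generalizing s with
  | nil => exact ⟨4, by omega, Run.loop_stop (.comp (.tl _ _) (.tl _ _))⟩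
  | cons b l ih =>
    obtain ⟨t, ht, h1⟩ := hp (x, s, b) ω i
    obtain ⟨t', ht', h2⟩ := ih (step x s b) fun l' b' h => by
      have := hτ (b :: l') b' (by simpa using h)
      simpa using this
    have h0 := hτ [] b (by simp)
    refine ⟨_, ?_, .loop_step (.comp (.tl _ _) (.tl _ _))
      (.pair (.hd _ _) (.pair (.comp (.pair (.hd _ _) (.pair (.comp (.tl _ _) (.hd _ _))
        (.comp (.tl _ _) (.comp (.tl _ _) (.hd _ _))))) h1)
        (.comp (.tl _ _) (.comp (.tl _ _) (.tl _ _))))) h2⟩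
    simp only [List.foldl_nil] at h0
    rw [List.length_cons, Nat.succ_mul]
    omega

/-- A polynomial-time step does not suffice, since a state that doubles in each step becomes
exponential; hence the bound `B` for all intermediate states. All coin-free loops are instances of
this one. -/
theorem foldl {l : α → List β} {s : α → σ} {step : α → σ → β → σ} {B : α → ℕ}
    (hl : Feasible w l) (h0 : Feasible w s)
    (hstep : Feasible (fun p : α × σ × β => w p.1) fun p => step p.1 p.2.1 p.2.2)
    (hB : PolyBdd (weight w) B)
    (hb : ∀ x l', l' <+: l x → esize (l'.foldl (step x) (s x)) ≤ B x) :
    Feasible w fun x => (l x).foldl (step x) (s x) := by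
  obtain ⟨hls, pl, Tl, hTl, hrl⟩ := hl
  obtain ⟨h0s, p0, T0, hT0, hr0⟩ := h0
  obtain ⟨-, p, T, ⟨c, hc⟩, hr⟩ := hstep
  -- The input of a step is (context, state, entry); the state is bounded by `B` and the entry by
  -- the size of the whole list.
  have hτ : PolyBdd (weight w) fun x => (weight w x + B x + esize (l x) + 3) ^ c := by
    refine PolyBdd.comp (V := fun n : ℕ => n + 2) (k := fun n => n ^ c)
      (f := fun x => weight w x + B x + esize (l x) + 3) ⟨c, fun n => ?_⟩ ?_
    · exact Nat.pow_le_pow_left (Nat.le_add_right _ _) c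
    · exact bddAdd (bddAdd (bddAdd (bddAdd PolyBdd.self hB) hls) (bddConst w 3)) (bddConst w 2)
  refine ⟨hB.mono fun x => hb x _ List.prefix_rfl,
    .comp (.comp (.pair .id (.pair p0 pl)) (.loop (.comp .tl .tl)
        (.pair .hd (.pair (.comp (.pair .hd (.pair (.comp .tl .hd) (.comp .tl (.comp .tl .hd)))) p)
          (.comp .tl (.comp .tl .tl)))))) (.comp .tl .hd),
    fun x => T0 x + Tl x + (esize (l x) * ((weight w x + B x + esize (l x) + 3) ^ c + 30) + 4) + 30,
    ?_, fun x ω i => ?_⟩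
  · exact bddAdd (bddAdd (bddAdd hT0 hTl) (bddAdd (hls.mul (bddAdd hτ (bddConst w 30)))
      (bddConst w 4))) (bddConst w 30)
  · obtain ⟨tl, htl, h1⟩ := hrl x ω i
    obtain ⟨t0, ht0, h2⟩ := hr0 x ω i
    obtain ⟨t, ht, h3⟩ := foldl_loop (step := step) hr x (l x) (s x)
      (τ := (weight w x + B x + esize (l x) + 3) ^ c) (fun l' b h => by
        refine (hc _).trans (Nat.pow_le_pow_left ?_ c)
        have hbm : b ∈ l x := h.subset (by simp)
        have h4 := esize_le_of_mem hbm
        have h5 := hb x l' ((List.prefix_append l' [b]).trans h)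
        simp only [weight, esize_pair]
        omega) ω i
    refine ⟨_, ?_, .comp (.comp (.pair (.id _ _) (.pair h2 h1)) h3)
      (.comp (.tl _ _) (.hd _ _))⟩
    have h6 : (l x).length ≤ esize (l x) := by have := length_le_esize (l x); omega
    have h7 := Nat.mul_le_mul_right ((weight w x + B x + esize (l x) + 3) ^ c + 30) h6
    dsimp only
    omega

end Feasible

/-! ### A library of feasible functions -/

namespace Feasible

variable {α β γ δ σ : Type} [Enc α] [Enc β] [Enc γ] [Enc δ] [Enc σ] {w : α → ℕ}

theorem bddNat {f : α → ℕ} (hf : Feasible w f) : PolyBdd (weight w) f :=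
  hf.size.mono fun x => by rw [esize_nat]; omega

theorem bddLength {f : α → List β} (hf : Feasible w f) :
    PolyBdd (weight w) fun x => (f x).length :=
  hf.size.mono fun x => by have := length_le_esize (f x); omega

theorem units {f : α → ℕ} (hf : Feasible w f) : Feasible w fun x => List.replicate (f x) () :=
  congrEnc hf fun _ => (enc_replicate _).symm

theorem ofUnits {f : α → List Unit} (hf : Feasible w f) : Feasible w fun x => (f x).length := by
  refine congrEnc hf fun x => ?_
  rw [← enc_replicate]
  congr 1
  exact List.eq_replicate_of_mem fun _ _ => rfl

theorem iterate {n : α → ℕ} {s : α → σ} {step : α → σ → σ} {B : α → ℕ}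
    (hn : Feasible w n) (h0 : Feasible w s)
    (hstep : Feasible (fun p : α × σ => w p.1) fun p => step p.1 p.2)
    (hB : PolyBdd (weight w) B)
    (hb : ∀ x m, m ≤ n x → esize ((step x)^[m] (s x)) ≤ B x) :
    Feasible w fun x => (step x)^[n x] (s x) := by
  have key : ∀ x (l : List Unit) a, l.foldl (fun y _ => step x y) a = (step x)^[l.length] a := by
    intro x l
    induction l with
    | nil => intro a; rfl
    | cons _ l ih => intro a; simp [ih]
  refine congr (f := fun x => (List.replicate (n x) ()).foldl (fun y _ => step x y) (s x))
    (foldl (B := B) hn.units h0 ?_ hB fun x l' hl' => ?_) fun x => by rw [key]; simp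
  · exact comp (f := fun p : α × σ × Unit => (p.1, p.2.1)) hstep
      (pair (fst (id _)) (fst (snd (id _)))) (bddWeight _)
  · rw [key]
    exact hb x _ (by simpa using hl'.length_le)

theorem add {f g : α → ℕ} (hf : Feasible w f) (hg : Feasible w g) :
    Feasible w fun x => f x + g x := by
  refine congr (f := fun x => (fun y => y + 1)^[g x] (f x))
    (iterate (B := fun x => 2 * (f x + g x) + 1) hg hf (succ (snd (id _))) ?_ fun x m hm => ?_)
    fun x => by simp
  · exact bddAdd ((bddConst w 2).mul (bddAdd hf.bddNat hg.bddNat)) (bddConst w 1)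
  · simp [esize_nat]; omega

theorem pred {f : α → ℕ} (hf : Feasible w f) : Feasible w fun x => f x - 1 :=
  congr (ofUnits (tail hf.units)) fun x => by simp

theorem sub {f g : α → ℕ} (hf : Feasible w f) (hg : Feasible w g) :
    Feasible w fun x => f x - g x := by
  have key : ∀ m a : ℕ, (fun y => y - 1)^[m] a = a - m := by
    intro m
    induction m with
    | zero => intro a; rfl
    | succ m ih => intro a; rw [Function.iterate_succ_apply, ih]; omega
  refine congr (f := fun x => (fun y => y - 1)^[g x] (f x))
    (iterate (B := fun x => 2 * f x + 1) hg hf (pred (snd (id _))) ?_ fun x m hm => ?_)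
    fun x => key _ _
  · exact bddAdd ((bddConst w 2).mul hf.bddNat) (bddConst w 1)
  · rw [key, esize_nat]; omega

theorem mul {f g : α → ℕ} (hf : Feasible w f) (hg : Feasible w g) :
    Feasible w fun x => f x * g x := by
  have key : ∀ m a : ℕ, (fun y => y + a)^[m] 0 = a * m := by
    intro m a
    induction m with
    | zero => rfl
    | succ m ih => rw [Function.iterate_succ_apply', ih]; ring
  refine congr (f := fun x => (fun y => y + f x)^[g x] 0)
    (iterate (step := fun x y => y + f x) (s := fun _ => 0) (B := fun x => 2 * (f x * g x) + 1)
      hg zeroConst (add (snd (id _)) hf.weaken) ?_ fun x m hm => ?_) fun x => key _ _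
  · exact bddAdd ((bddConst w 2).mul (hf.bddNat.mul hg.bddNat)) (bddConst w 1)
  · rw [key, esize_nat]
    have := Nat.mul_le_mul_left (f x) hm
    omega

/-- Numbers are unary, so a power takes as much space as its value; `hp` has to bound that value. -/
theorem pow {f g : α → ℕ} (hf : Feasible w f) (hg : Feasible w g)
    (hp : PolyBdd (weight w) fun x => f x ^ g x) : Feasible w fun x => f x ^ g x := by
  have key : ∀ m a : ℕ, (fun y => y * a)^[m] 1 = a ^ m := by
    intro m a
    induction m with
    | zero => rfl
    | succ m ih => rw [Function.iterate_succ_apply', ih]; ring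
  refine congr (f := fun x => (fun y => y * f x)^[g x] 1)
    (iterate (step := fun x y => y * f x) (s := fun _ => 1)
      (B := fun x => 2 * (f x ^ g x + 1) + 1)
      hg (natConst 1) (mul (snd (id _)) hf.weaken) ?_ fun x m hm => ?_) fun x => key _ _
  · exact bddAdd ((bddConst w 2).mul (bddAdd hp (bddConst w 1))) (bddConst w 1)
  · rw [key, esize_nat]
    -- The summand one covers base zero, where the initial value `0 ^ 0 = 1` may exceed the final
    -- power.
    have : f x ^ m ≤ f x ^ g x + 1 := by
      rcases Nat.eq_zero_or_pos (f x) with h | h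
      · rw [h]; exact (zero_pow_le_one m).trans (Nat.le_add_left _ _)
      · exact (Nat.pow_le_pow_right h hm).trans (by omega)
    omega

theorem isZero {f : α → ℕ} (hf : Feasible w f) : Feasible w fun x => decide (f x = 0) :=
  congr (isNil hf.units) fun x => by cases f x <;> rfl

theorem natLe {f g : α → ℕ} (hf : Feasible w f) (hg : Feasible w g) :
    Feasible w fun x => decide (f x ≤ g x) :=
  congr (isZero (sub hf hg)) fun x => by simp [Nat.sub_eq_zero_iff_le]

theorem natLt {f g : α → ℕ} (hf : Feasible w f) (hg : Feasible w g) :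
    Feasible w fun x => decide (f x < g x) := natLe hf.succ hg

theorem bAnd {f g : α → Bool} (hf : Feasible w f) (hg : Feasible w g) :
    Feasible w fun x => f x && g x :=
  congr (cond hf hg falseConst) fun x => by cases f x <;> simp

theorem bOr {f g : α → Bool} (hf : Feasible w f) (hg : Feasible w g) :
    Feasible w fun x => f x || g x :=
  congr (cond hf trueConst hg) fun x => by cases f x <;> simp

theorem bNot {f : α → Bool} (hf : Feasible w f) : Feasible w fun x => !f x :=
  congr (cond hf falseConst trueConst) fun x => by cases f x <;> simp

theorem natBeq {f g : α → ℕ} (hf : Feasible w f) (hg : Feasible w g) :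
    Feasible w fun x => f x == g x :=
  congr (bAnd (natLe hf hg) (natLe hg hf)) fun x => by
    rw [Bool.eq_iff_iff]; simp; omega

theorem reverse {l : α → List β} (hl : Feasible w l) : Feasible w fun x => (l x).reverse := by
  have key : ∀ (l : List β) a, l.foldl (fun a b => b :: a) a = l.reverse ++ a := by
    intro l
    induction l with
    | nil => intro a; rfl
    | cons b l ih => intro a; simp [ih]
  have hsz : ∀ l : List β, esize l.reverse = esize l := by
    intro l; rw [esize_list, esize_list, List.map_reverse, List.sum_reverse]
  refine congr (foldl (B := fun x => esize (l x)) (step := fun _ a b => b :: a) hl nilConst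
    (cons (snd (snd (id _))) (fst (snd (id _)))) hl.size fun x l' hl' => ?_)
    fun x => by rw [key, List.append_nil]
  rw [key, List.append_nil, hsz]
  obtain ⟨l'', h⟩ := hl'
  have := esize_append l' l''
  have := one_le_esize l''
  rw [← h]; omega

theorem append {l l' : α → List β} (hl : Feasible w l) (hl' : Feasible w l') :
    Feasible w fun x => l x ++ l' x := by
  have key : ∀ (l : List β) a, l.foldl (fun a b => b :: a) a = l.reverse ++ a := by
    intro l
    induction l with
    | nil => intro a; rfl
    | cons b l ih => intro a; simp [ih]
  have hsz : ∀ l : List β, esize l.reverse = esize l := by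
    intro l; rw [esize_list, esize_list, List.map_reverse, List.sum_reverse]
  refine congr (foldl (B := fun x => esize (l x) + esize (l' x)) (step := fun _ a b => b :: a)
    hl.reverse hl' (cons (snd (snd (id _))) (fst (snd (id _)))) (bddAdd hl.size hl'.size)
    fun x m hm => ?_) fun x => by rw [key, List.reverse_reverse]
  rw [key]
  obtain ⟨m', h⟩ := hm
  have h1 := esize_append m m'
  have h2 := esize_append m.reverse (l' x)
  have := one_le_esize m'
  rw [hsz] at h2
  have h3 := hsz (l x)
  rw [← h] at h3
  omega

theorem map {l : α → List β} {f : α → β → γ} (hl : Feasible w l)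
    (hf : Feasible (fun p : α × β => w p.1) fun p => f p.1 p.2) :
    Feasible w fun x => (l x).map (f x) := by
  have key : ∀ x (l : List β) a,
      l.foldl (fun a b => f x b :: a) a = (l.map (f x)).reverse ++ a := by
    intro x l
    induction l with
    | nil => intro a; rfl
    | cons b l ih => intro a; simp [ih]
  obtain ⟨c, hc⟩ := hf.size
  have hlw : PolyBdd (weight w) fun x => weight w x + esize (l x) + 1 :=
    bddAdd (bddAdd PolyBdd.self hl.size) (bddConst w 1)
  refine congr (reverse (foldl (step := fun x a b => f x b :: a)
    (B := fun x => (l x).length * ((weight w x + esize (l x) + 1) ^ c + 1) + 1) hl nilConst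
    (cons ?_ (fst (snd (id _)))) ?_ fun x l' hl' => ?_))
    fun x => by rw [key, List.append_nil, List.reverse_reverse]
  · exact comp (f := fun p : α × List γ × β => (p.1, p.2.2)) hf
      (pair (fst (id _)) (snd (snd (id _)))) (bddWeight _)
  · refine bddAdd (hl.bddLength.mul (bddAdd ?_ (bddConst w 1))) (bddConst w 1)
    exact PolyBdd.comp (V := fun n : ℕ => n) (k := fun n => n ^ c)
      (f := fun x => weight w x + esize (l x) + 1) ⟨c, fun n => le_rfl⟩ hlw
  · rw [key, List.append_nil]
    refine esize_list_le (by simpa using hl'.length_le) fun y hy => ?_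
    obtain ⟨b, hb, rfl⟩ := List.mem_map.1 (List.mem_reverse.1 hy)
    refine (hc (x, b)).trans (Nat.pow_le_pow_left ?_ c)
    have := esize_le_of_mem (hl'.subset hb)
    simp only [weight, esize_pair]; omega

theorem length {l : α → List β} (hl : Feasible w l) : Feasible w fun x => (l x).length :=
  congr (ofUnits (map (f := fun _ _ => ()) hl unitConst)) fun x => by simp

theorem flatten {l : α → List (List β)} (hl : Feasible w l) :
    Feasible w fun x => (l x).flatten := by
  have key : ∀ (l : List (List β)) a, l.foldl (fun a b => a ++ b) a = a ++ l.flatten := by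
    intro l
    induction l with
    | nil => intro a; simp
    | cons b l ih => intro a; simp [ih]
  have hsz : ∀ l : List (List β), esize l.flatten ≤ esize l := by
    intro l
    induction l with
    | nil => exact le_rfl
    | cons b l ih =>
      have := esize_append b l.flatten
      rw [List.flatten_cons, esize_cons]; omega
  refine congr (foldl (step := fun _ a b => a ++ b) (B := fun x => esize (l x)) hl nilConst
    (append (fst (snd (id _))) (snd (snd (id _)))) hl.size fun x l' hl' => ?_)
    fun x => by rw [key, List.nil_append]
  rw [key, List.nil_append]
  obtain ⟨l'', h⟩ := hl'
  have := esize_append l' l''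
  have := one_le_esize l''
  have := hsz l'
  rw [← h]; omega

theorem flatMap {l : α → List β} {f : α → β → List γ} (hl : Feasible w l)
    (hf : Feasible (fun p : α × β => w p.1) fun p => f p.1 p.2) :
    Feasible w fun x => (l x).flatMap (f x) :=
  congr (flatten (map hl hf)) fun x => by rw [List.flatMap_def]

theorem filter {l : α → List β} {f : α → β → Bool} (hl : Feasible w l)
    (hf : Feasible (fun p : α × β => w p.1) fun p => f p.1 p.2) :
    Feasible w fun x => (l x).filter (f x) := by
  have key : ∀ (l : List β) (g : β → Bool),
      l.flatMap (fun b => if g b then [b] else []) = l.filter g := by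
    intro l g
    induction l with
    | nil => rfl
    | cons b l ih => rw [List.flatMap_cons, ih, List.filter_cons]; split <;> simp
  exact congr (flatMap (f := fun x b => if f x b then [b] else []) hl
    (cond hf (cons (snd (id _)) nilConst) nilConst)) fun x => key _ _

theorem all {l : α → List β} {f : α → β → Bool} (hl : Feasible w l)
    (hf : Feasible (fun p : α × β => w p.1) fun p => f p.1 p.2) :
    Feasible w fun x => (l x).all (f x) :=
  congr (isNil (filter (f := fun x b => !f x b) hl hf.bNot)) fun x => by
    rw [Bool.eq_iff_iff]; simp

theorem any {l : α → List β} {f : α → β → Bool} (hl : Feasible w l)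
    (hf : Feasible (fun p : α × β => w p.1) fun p => f p.1 p.2) :
    Feasible w fun x => (l x).any (f x) :=
  congr (bNot (all (f := fun x b => !f x b) hl hf.bNot)) fun x => by
    rw [Bool.eq_iff_iff]; simp

theorem drop {l : α → List β} {n : α → ℕ} (hl : Feasible w l) (hn : Feasible w n) :
    Feasible w fun x => (l x).drop (n x) := by
  have key : ∀ m (l : List β), List.tail^[m] l = l.drop m := by
    intro m
    induction m with
    | zero => intro l; rfl
    | succ m ih => intro l; rw [Function.iterate_succ_apply, ih, List.drop_tail]
  refine congr (iterate (step := fun _ l => List.tail l) (B := fun x => esize (l x)) hn hl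
    (tail (snd (id _))) hl.size fun x m _ => ?_) fun x => key _ _
  rw [key]
  have h1 := esize_append ((l x).take m) ((l x).drop m)
  rw [List.take_append_drop] at h1
  have := one_le_esize ((l x).take m)
  omega

theorem getD {l : α → List β} {n : α → ℕ} {d : β} (hd : enc d = .nil) (hl : Feasible w l)
    (hn : Feasible w n) : Feasible w fun x => (l x).getD (n x) d :=
  congr (headD hd (drop hl hn)) fun x => by
    simp [List.headD_eq_head?_getD, List.head?_drop]

theorem range {n : α → ℕ} (hn : Feasible w n) : Feasible w fun x => List.range (n x) := by
  have key : ∀ m, (fun l : List ℕ => l.length :: l)^[m] [] = (List.range m).reverse := by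
    intro m
    induction m with
    | zero => rfl
    | succ m ih => rw [Function.iterate_succ_apply', ih, List.range_succ]; simp
  refine congr (reverse (iterate (step := fun _ (l : List ℕ) => l.length :: l)
    (B := fun x => n x * (2 * n x + 1 + 1) + 1) hn nilConst
    (cons (length (snd (id _))) (snd (id _))) ?_ fun x m hm => ?_))
    fun x => by rw [key, List.reverse_reverse]
  · exact bddAdd (hn.bddNat.mul (bddAdd (bddAdd ((bddConst w 2).mul hn.bddNat) (bddConst w 1))
      (bddConst w 1))) (bddConst w 1)
  · rw [key]
    refine esize_list_le (by simpa using hm) fun y hy => ?_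
    rw [List.mem_reverse, List.mem_range] at hy
    rw [esize_nat]; omega

theorem countRange {n : α → ℕ} {f : α → ℕ → Bool} (hn : Feasible w n)
    (hf : Feasible (fun p : α × ℕ => w p.1) fun p => f p.1 p.2) :
    Feasible w fun x => (List.range (n x)).countP (f x) :=
  congr (length (filter (range hn) hf)) fun x => by rw [List.countP_eq_length_filter]

end Feasible

/-- With this, a number is computed by counting the integers below it; square roots and quotients
are obtained in this way. -/
theorem List.countP_range_lt (n c : ℕ) : (List.range n).countP (fun j => decide (j < c)) =
    min n c := by
  induction n with
  | zero => simp
  | succ n ih =>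
    rw [List.range_succ, List.countP_append, ih, List.countP_singleton]
    by_cases h : n < c <;> simp [h] <;> omega

/-! ### Square roots, quotients and remainders. -/

namespace Feasible

variable {α β γ : Type} [Enc α] [Enc β] [Enc γ] {w : α → ℕ}

theorem natSqrt {f : α → ℕ} (hf : Feasible w f) : Feasible w fun x => Nat.sqrt (f x) := by
  refine congr (countRange (f := fun x j => decide ((j + 1) * (j + 1) ≤ f x)) hf
    (natLe (mul (succ (snd (id _))) (succ (snd (id _)))) hf.weaken)) fun x => ?_
  rw [← min_eq_right (Nat.sqrt_le_self (f x)), ← List.countP_range_lt]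
  refine List.countP_congr fun j _ => ?_
  simp [← Nat.le_sqrt]

theorem natDiv {f g : α → ℕ} (hf : Feasible w f) (hg : Feasible w g) :
    Feasible w fun x => f x / g x := by
  refine congr (cond (isZero hg) zeroConst
    (countRange (f := fun x j => decide ((j + 1) * g x ≤ f x)) hf
    (natLe (mul (succ (snd (id _))) hg.weaken) hf.weaken))) fun x => ?_
  by_cases h : g x = 0
  · simp [h]
  · simp only [h, decide_false, Bool.false_eq_true, if_false]
    rw [← min_eq_right (Nat.div_le_self (f x) (g x)), ← List.countP_range_lt]
    refine List.countP_congr fun j _ => ?_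
    simp [← Nat.le_div_iff_mul_le (Nat.pos_of_ne_zero h)]

theorem natMod {f g : α → ℕ} (hf : Feasible w f) (hg : Feasible w g) :
    Feasible w fun x => f x % g x :=
  congr (sub hf (mul hg (natDiv hf hg))) fun x => by
    have := Nat.div_add_mod (f x) (g x); omega

end Feasible

/-! ### Exponent search, enumeration of labellings, binary numbers. -/

/-- Least exponent `j` with `B ≤ b ^ j` (for `2 ≤ b`). -/
def expSearch (b B : ℕ) : ℕ :=
  ((fun p : ℕ × ℕ => if decide (p.1 < B) then (p.1 * b, p.2 + 1) else p)^[B] (1, 0)).2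

/-- The state (power, exponent) freezes when the power reaches `B`. The third clause shows that `B`
is reached after enough rounds, the fourth that the exponent is least. -/
theorem expSearch_iterate (b B m : ℕ) :
    let p := (fun p : ℕ × ℕ => if decide (p.1 < B) then (p.1 * b, p.2 + 1) else p)^[m] (1, 0)
    p.1 = b ^ p.2 ∧ p.2 ≤ m ∧ (B ≤ p.1 ∨ p.2 = m) ∧ (p.2 = 0 ∨ b ^ (p.2 - 1) < B) := by
  induction m with
  | zero => simp
  | succ m ih =>
    simp only [Function.iterate_succ_apply'] at ih ⊢
    generalize (fun p : ℕ × ℕ => if decide (p.1 < B) then (p.1 * b, p.2 + 1) else p)^[m] (1, 0) = p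
      at ih ⊢
    obtain ⟨h1, h2, h3, h4⟩ := ih
    by_cases h : p.1 < B
    · simp only [h, decide_true, if_true]
      refine ⟨by rw [h1, pow_succ], by omega, Or.inr (by omega), Or.inr ?_⟩
      rw [← h1.symm.trans rfl] at *
      simpa [← h1] using h
    · simp only [h, decide_false, Bool.false_eq_true, if_false]
      exact ⟨h1, by omega, Or.inl (by omega), h4⟩

theorem le_pow_expSearch {b : ℕ} (hb : 2 ≤ b) (B : ℕ) : B ≤ b ^ expSearch b B := by
  obtain ⟨h1, -, h3, -⟩ := expSearch_iterate b B B
  rw [expSearch, ← h1]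
  rcases h3 with h | h
  · exact h
  · rw [h1, h]; exact (Nat.lt_pow_self hb).le

theorem pow_pred_expSearch_lt {b B : ℕ} (h : expSearch b B ≠ 0) : b ^ (expSearch b B - 1) < B :=
  (expSearch_iterate b B B).2.2.2.resolve_left h

namespace Feasible

variable {α β γ : Type} [Enc α] [Enc β] [Enc γ] {w : α → ℕ}

theorem expSearch {f g : α → ℕ} (hf : Feasible w f) (hg : Feasible w g) :
    Feasible w fun x => expSearch (f x) (g x) := by
  refine snd (iterate (step := fun x (p : ℕ × ℕ) =>
      if decide (p.1 < g x) then (p.1 * f x, p.2 + 1) else p) (s := fun _ => (1, 0))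
    (B := fun x => 2 * ((g x + 1) * (f x + 1)) + 2 * g x + 3) hg (pair (natConst 1) zeroConst)
    (cond (natLt (fst (snd (id _))) hg.weaken)
      (pair (mul (fst (snd (id _))) hf.weaken) (succ (snd (snd (id _))))) (snd (id _)))
    ?_ fun x m hm => ?_)
  · exact bddAdd (bddAdd ((bddConst w 2).mul ((bddAdd hg.bddNat (bddConst w 1)).mul
      (bddAdd hf.bddNat (bddConst w 1)))) ((bddConst w 2).mul hg.bddNat)) (bddConst w 3)
  · obtain ⟨h1, h2, -, h4⟩ := expSearch_iterate (f x) (g x) m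
    generalize (fun p : ℕ × ℕ =>
      if decide (p.1 < g x) then (p.1 * f x, p.2 + 1) else p)^[m] (1, 0) = p at *
    -- Before the last multiplication the power was below the target, so it overshoots by at most
    -- one factor.
    have h5 : p.1 ≤ (g x + 1) * (f x + 1) := by
      rw [h1]
      rcases h4 with h | h
      · rw [h]; nlinarith
      · rcases Nat.eq_zero_or_pos p.2 with h0 | h0
        · rw [h0]; nlinarith
        · obtain ⟨j, hj⟩ := Nat.exists_eq_add_of_lt h0
          have hj' : p.2 = j + 1 := by omega
          rw [hj'] at h ⊢
          rw [pow_succ]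
          simp only [Nat.add_sub_cancel] at h
          exact Nat.mul_le_mul (by omega) (by omega)
    have := esize_pair p.1 p.2
    rw [Prod.mk.eta] at this
    rw [this, esize_nat, esize_nat]
    omega

end Feasible

/-- All ways to attach an option to every entry of a list. The result lists the entries in
reverse order. -/
def choices {α β : Type} (l : List α) (o : List β) : List (List (α × β)) :=
  l.foldl (fun acc v => acc.flatMap fun τ => o.map fun s => (v, s) :: τ) [[]]

theorem choices_concat {α β : Type} (l : List α) (v : α) (o : List β) :
    choices (l ++ [v]) o = (choices l o).flatMap fun τ => o.map fun s => (v, s) :: τ := by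
  simp [choices]

theorem length_choices {α β : Type} (l : List α) (o : List β) :
    (choices l o).length = o.length ^ l.length := by
  induction l using List.reverseRecOn with
  | nil => rfl
  | append_singleton l v ih =>
    rw [choices_concat, List.length_flatMap]
    simp [ih, pow_succ]

theorem mem_choices {α β : Type} {l : List α} {o : List β} {τ : List (α × β)} :
    τ ∈ choices l o ↔ τ.map Prod.fst = l.reverse ∧ ∀ p ∈ τ, p.2 ∈ o := by
  induction l using List.reverseRecOn generalizing τ with
  | nil => simp +contextual [choices]
  | append_singleton l v ih =>
    rw [choices_concat]
    simp only [List.mem_flatMap, List.mem_map, ih, List.reverse_append, List.reverse_singleton,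
      List.singleton_append]
    constructor
    · rintro ⟨τ', ⟨h1, h2⟩, s, hs, rfl⟩
      refine ⟨by simp [h1], fun p hp => ?_⟩
      rcases List.mem_cons.1 hp with rfl | hp
      · exact hs
      · exact h2 p hp
    · rintro ⟨h1, h2⟩
      cases τ with
      | nil => simp at h1
      | cons p τ =>
        rw [List.map_cons, List.cons.injEq] at h1
        exact ⟨τ, ⟨h1.2, fun p hp => h2 p (List.mem_cons_of_mem _ hp)⟩, p.2,
          h2 p List.mem_cons_self, by rw [← h1.1]⟩

/-- The number whose binary digits, the highest one first, are the first `s` values of `bit`. -/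
def binary (bit : ℕ → Bool) (s : ℕ) : ℕ :=
  (List.range s).foldl (fun acc l => acc + acc + (if bit l then 1 else 0)) 0

theorem binary_succ (bit : ℕ → Bool) (s : ℕ) :
    binary bit (s + 1) = binary bit s + binary bit s + (if bit s then 1 else 0) := by
  simp [binary, List.range_succ]

theorem binary_lt (bit : ℕ → Bool) (s : ℕ) : binary bit s < 2 ^ s := by
  induction s with
  | zero => simp [binary]
  | succ s ih => rw [binary_succ, pow_succ]; split <;> omega

theorem binary_inj {bit bit' : ℕ → Bool} {s : ℕ} (h : binary bit s = binary bit' s) :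
    ∀ l < s, bit l = bit' l := by
  induction s with
  | zero => simp
  | succ s ih =>
    rw [binary_succ, binary_succ] at h
    have h1 : binary bit s = binary bit' s ∧ bit s = bit' s := by
      generalize bit s = x, bit' s = y at *
      cases x <;> cases y <;> simp at h ⊢ <;> omega
    intro l hl
    rcases Nat.lt_succ_iff_lt_or_eq.1 hl with h2 | rfl
    · exact ih h1.1 l h2
    · exact h1.2

theorem binary_congr {bit bit' : ℕ → Bool} {s : ℕ} (h : ∀ l < s, bit l = bit' l) :
    binary bit s = binary bit' s := by
  induction s with
  | zero => rfl
  | succ s ih =>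
    rw [binary_succ, binary_succ, ih fun l hl => h l (by omega), h s (by omega)]

namespace Feasible

variable {α β γ : Type} [Enc α] [Enc β] [Enc γ] {w : α → ℕ}

theorem choices {l : α → List β} {o : α → List γ} (hl : Feasible w l) (ho : Feasible w o)
    (hp : PolyBdd (weight w) fun x => (o x).length ^ (l x).length) :
    Feasible w fun x => choices (l x) (o x) := by
  refine foldl (step := fun x acc v => acc.flatMap fun τ => (o x).map fun s => (v, s) :: τ)
    (s := fun _ => [[]])
    (B := fun x => ((o x).length ^ (l x).length + 1) *
      ((l x).length * (esize (l x) + esize (o x) + 2) + 2) + 1) hl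
    (cons nilConst nilConst) ?_ ?_ fun x l' hl' => ?_
  · refine flatMap (f := fun (p : α × List (List (β × γ)) × β) τ =>
      (o p.1).map fun s => (p.2.2, s) :: τ) (fst (snd (id _))) ?_
    refine map (f := fun (p : (α × List (List (β × γ)) × β) × List (β × γ)) s =>
      (p.1.2.2, s) :: p.2) ?_ ?_
    · exact ho.weaken.weaken
    · exact cons (pair (snd (snd (fst (fst (id _))))) (snd (id _))) (snd (fst (id _)))
  · exact bddAdd ((bddAdd hp (bddConst w 1)).mul (bddAdd (hl.bddLength.mul (bddAdd
      (bddAdd hl.size ho.size) (bddConst w 2))) (bddConst w 2))) (bddConst w 1)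
  · change esize (_root_.choices l' (o x)) ≤ _
    refine esize_list_le ?_ fun τ hτ => ?_
    · rw [length_choices]
      rcases Nat.eq_zero_or_pos (o x).length with h | h
      · rw [h]
        exact (zero_pow_le_one _).trans (Nat.le_add_left _ _)
      · exact (Nat.pow_le_pow_right h hl'.length_le).trans (by omega)
    · rw [mem_choices] at hτ
      have h1 : τ.length = l'.length := by
        rw [← List.length_reverse (as := l'), ← hτ.1, List.length_map]
      refine (esize_list_le (N := (l x).length) (B := esize (l x) + esize (o x) + 1)
        (h1 ▸ hl'.length_le) fun p hp => ?_).trans (by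
          rw [show esize (l x) + esize (o x) + 1 + 1 = esize (l x) + esize (o x) + 2 from rfl])
      have h2 := esize_le_of_mem (hτ.2 p hp)
      have h3 : p.1 ∈ l' := List.mem_reverse.1 (hτ.1 ▸ List.mem_map_of_mem hp)
      have h4 := esize_le_of_mem (hl'.subset h3)
      have := esize_pair p.1 p.2
      rw [Prod.mk.eta] at this
      omega

theorem binary {bit : α → ℕ → Bool} {s : α → ℕ} (hs : Feasible w s)
    (hbit : Feasible (fun p : α × ℕ => w p.1) fun p => bit p.1 p.2)
    (hp : PolyBdd (weight w) fun x => 2 ^ s x) : Feasible w fun x => binary (bit x) (s x) := by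
  refine foldl (step := fun x acc l => acc + acc + (if bit x l then 1 else 0))
    (B := fun x => 2 * 2 ^ s x + 1) (range hs) zeroConst ?_
    (bddAdd ((bddConst w 2).mul hp) (bddConst w 1)) fun x l' hl' => ?_
  · refine add (add (fst (snd (id _))) (fst (snd (id _)))) (cond ?_ (natConst 1) zeroConst)
    exact comp (f := fun p : α × ℕ × ℕ => (p.1, p.2.2)) hbit
      (pair (fst (id _)) (snd (snd (id _)))) (bddWeight _)
  · have h1 : l' = List.range l'.length := by
      rw [List.prefix_iff_eq_take] at hl'
      rw [List.take_range, min_eq_left] at hl'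
      · exact hl'
      · by_contra h
        rw [min_eq_right (by omega)] at hl'
        rw [hl', List.length_range] at h
        omega
    have h2 : l'.length ≤ s x := by simpa using hl'.length_le
    rw [h1]
    change esize (_root_.binary (bit x) l'.length) ≤ _
    have h3 := binary_lt (bit x) l'.length
    have h4 : 2 ^ l'.length ≤ 2 ^ s x := Nat.pow_le_pow_right (by omega) h2
    rw [esize_nat]; omega

end Feasible

/-! ### The reduction -/

/-- An edge as it is given to the program: its two ends and the table of its projection. -/
abbrev RawEdge : Type := ℕ × ℕ × List ℕ × Unit

/-- The input of the program: `q`, the sizes of the sides and of the alphabet, the edges. -/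
abbrev RawInput : Type := ℕ × ℕ × ℕ × ℕ × List RawEdge × Unit

/-- A test: at most one pair of edges with a common right end. -/
abbrev EdgeTest : Type := List (RawEdge × RawEdge)

namespace RawInput

/-- Number of left vertices. -/
def left (x : RawInput) : ℕ := x.2.1

/-- Number of vertices. -/
def verts (x : RawInput) : ℕ := x.2.1 + x.2.2.1

/-- The alphabet. -/
def alphabet (x : RawInput) : List ℕ := List.range x.2.2.2.1

/-- An integer slightly above `√n / log n`: the number of parts, and the number of
test selection elements. -/
def parts (x : RawInput) : ℕ := expSearch x.verts (2 ^ (Nat.sqrt x.verts + 1))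

/-- Size of a part. -/
def partSize (x : RawInput) : ℕ := x.verts / x.parts + 1

/-- Number of edge tests that are selected by a set of test selection elements. -/
def rounds (x : RawInput) : ℕ := 64 * x.parts * (x.1 * x.1)

/-- Pairs of edges with a common right end. -/
def edgePairs (x : RawInput) : List (RawEdge × RawEdge) :=
  x.2.2.2.2.1.flatMap fun e =>
    (x.2.2.2.2.1.filter fun e' => e'.2.1 == e.2.1).map fun e' => (e, e')

/-- Number of coins which select an edge test. -/
def bits (x : RawInput) : ℕ := expSearch 2 x.edgePairs.length

/-- The vertices of a part. -/
def part (x : RawInput) (i : ℕ) : List ℕ :=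
  -- The size of a part is computed from the number of all vertices, and slots are reduced modulo
  -- the number of left vertices. A vertex may therefore fill several slots, with unrelated labels.
  (List.range x.partSize).map fun l => (i * x.partSize + l) % x.left

/-- The ground set: test selection elements `(i, [])`, and assignment elements `(i, τ)`, where `τ`
labels the vertices of a part. -/
def elements (x : RawInput) : List (ℕ × List (ℕ × ℕ)) :=
  ((List.range x.parts).map fun i => (i, [])) ++
    (List.range x.parts).flatMap fun i =>
      (choices (x.part i) x.alphabet).map fun τ => (x.parts + i, τ)

/-- All sets of test selection elements. -/
def selections (x : RawInput) : List (List (ℕ × Bool)) :=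
  choices (List.range x.parts) [false, true]

/-- All sets of parts. -/
def partSets (x : RawInput) : List (List (ℕ × Bool)) :=
  choices ((List.range x.parts).map fun i => x.parts + i) [false, true]

/-- The test in round `t` of the selection number `p`. -/
def pick (x : RawInput) (coins : List Bool) (p t : ℕ) : EdgeTest :=
  -- A position past the end of the list gives the empty test, which everything passes. If there are
  -- pairs at all, at most half of the positions are of this kind.
  (x.edgePairs.drop
    (binary (fun l => coins.getD ((p * x.rounds + t) * x.bits + l) false) x.bits)).take 1

/-- The tests of the selection number `p`. -/
def tests (x : RawInput) (coins : List Bool) (p : ℕ) : List EdgeTest :=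
  (List.range x.rounds).map fun t => x.pick coins p t

/-- The concepts: a set of test selection elements and of parts, and a label for each of the
selected tests. -/
def concepts (x : RawInput) (coins : List Bool) :
    List (List (ℕ × Bool) × List (EdgeTest × ℕ)) :=
  (List.range (2 ^ x.parts)).flatMap fun p => x.partSets.flatMap fun J =>
    (choices (x.tests coins p) x.alphabet).map fun σ => (x.selections.getD p [] ++ J, σ)

/-- Number of coins. -/
def coinCount (x : RawInput) : ℕ := 2 ^ x.parts * x.rounds * x.bits

/-- The exponential quantities in the running time. -/
def expWeight (x : RawInput) : ℕ :=
  2 ^ (Nat.sqrt x.verts + 1) + 2 ^ x.parts + x.alphabet.length ^ x.partSize +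
    x.alphabet.length ^ x.rounds

theorem two_pow_sqrt_le (x : RawInput) : 2 ^ (Nat.sqrt x.verts + 1) ≤ x.expWeight :=
  ((Nat.le_add_right _ _).trans (Nat.le_add_right _ _)).trans (Nat.le_add_right _ _)

theorem two_pow_parts_le (x : RawInput) : 2 ^ x.parts ≤ x.expWeight :=
  ((Nat.le_add_left _ _).trans (Nat.le_add_right _ _)).trans (Nat.le_add_right _ _)

theorem pow_partSize_le (x : RawInput) : x.alphabet.length ^ x.partSize ≤ x.expWeight :=
  (Nat.le_add_left _ _).trans (Nat.le_add_right _ _)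

theorem pow_rounds_le (x : RawInput) : x.alphabet.length ^ x.rounds ≤ x.expWeight :=
  Nat.le_add_left _ _

end RawInput

/-- If `v` is the left end of `e`, then its label `l` is projected to `s`. -/
def RawEdge.ok (e : RawEdge) (s v l : ℕ) : Bool := !(e.1 == v) || (e.2.2.1.getD l 0 == s)

/-- The partial assignment `τ` is consistent with the labels of the tests. -/
def consistent (σ : List (EdgeTest × ℕ)) (τ : List (ℕ × ℕ)) : Bool :=
  σ.all fun ps => ps.1.all fun ee => τ.all fun vl =>
    ee.1.ok ps.2 vl.1 vl.2 && ee.2.ok ps.2 vl.1 vl.2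

/-- Membership of a ground element in a concept. -/
def inConcept (c : List (ℕ × Bool) × List (EdgeTest × ℕ)) (el : ℕ × List (ℕ × ℕ)) : Bool :=
  (c.1.any fun ib => ib.1 == el.1 && ib.2) && consistent c.2 el.2

/-- The output of the program. -/
def RawInput.output (x : RawInput) (coins : List Bool) : ℕ × List (List Bool) :=
  (x.elements.length, (x.concepts coins).map fun c => x.elements.map fun el => inConcept c el)

theorem two_pow_expSearch_le (B : ℕ) : 2 ^ expSearch 2 B ≤ 2 * B + 1 := by
  by_cases h : expSearch 2 B = 0
  · rw [h]; omega
  · have h1 := pow_pred_expSearch_lt h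
    obtain ⟨j, hj⟩ := Nat.exists_eq_succ_of_ne_zero h
    rw [hj] at h1 ⊢
    rw [Nat.succ_sub_one] at h1
    rw [pow_succ]; omega

/-! ### Polynomial running time of the reduction. -/

namespace Feasible

variable {α β γ : Type} [Enc α] [Enc β] [Enc γ] {w : α → ℕ}

section Input

variable {X : α → RawInput} (hX : Feasible w X)
include hX

theorem left : Feasible w fun x => (X x).left := fst (snd hX)

theorem verts : Feasible w fun x => (X x).verts := add (fst (snd hX)) (fst (snd (snd hX)))

theorem alphabet : Feasible w fun x => (X x).alphabet := range (fst (snd (snd (snd hX))))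

theorem edgePairs : Feasible w fun x => (X x).edgePairs := by
  have hE : Feasible w fun x => (X x).2.2.2.2.1 := fst (snd (snd (snd (snd hX))))
  refine flatMap (f := fun x e => ((X x).2.2.2.2.1.filter fun e' => e'.2.1 == e.2.1).map
    fun e' => (e, e')) hE ?_
  refine map (f := fun (p : α × RawEdge) e' => (p.2, e'))
    (filter (f := fun (p : α × RawEdge) e' => e'.2.1 == p.2.2.1) hE.weaken ?_) ?_
  · exact natBeq (fst (snd (snd (id _)))) (fst (snd (snd (fst (id _)))))
  · exact pair (snd (fst (id _))) (snd (id _))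

theorem bits : Feasible w fun x => (X x).bits := expSearch (natConst 2) (length (edgePairs hX))

theorem bddTwoPowBits : PolyBdd (weight w) fun x => 2 ^ (X x).bits :=
  (bddAdd ((bddConst w 2).mul (edgePairs hX).bddLength) (bddConst w 1)).mono
    fun _ => two_pow_expSearch_le _

variable (hw : PolyBdd (weight w) fun x => (X x).expWeight)
include hw

theorem parts : Feasible w fun x => (X x).parts := by
  refine expSearch (verts hX) (pow (natConst 2) (succ (natSqrt (verts hX))) (hw.mono fun x => ?_))
  exact RawInput.two_pow_sqrt_le _

theorem partSize : Feasible w fun x => (X x).partSize := succ (natDiv (verts hX) (parts hX hw))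

theorem rounds : Feasible w fun x => (X x).rounds :=
  mul (mul (natConst 64) (parts hX hw)) (mul (fst hX) (fst hX))

theorem twoPowParts : Feasible w fun x => 2 ^ (X x).parts := by
  refine pow (natConst 2) (parts hX hw) (hw.mono fun x => ?_)
  exact RawInput.two_pow_parts_le _

theorem coinCount : Feasible w fun x => (X x).coinCount :=
  mul (mul (twoPowParts hX hw) (rounds hX hw)) (bits hX)

theorem part {i : α → ℕ} (hi : Feasible w i) : Feasible w fun x => (X x).part (i x) := by
  refine map (f := fun x l => (i x * (X x).partSize + l) % (X x).left)
    (range (partSize hX hw)) ?_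
  exact natMod (add (mul hi.weaken (partSize hX hw).weaken) (snd (id _))) (left hX).weaken

omit hX hw in
theorem bddWeaken {g : α → ℕ} (hg : PolyBdd (weight w) g) :
    PolyBdd (weight fun p : α × β => w p.1) fun p => g p.1 :=
  hg.comp (f := Prod.fst) (PolyBdd.self.mono fun p => by
    have := esize_pair p.1 p.2
    rw [Prod.mk.eta] at this
    unfold weight; dsimp only; omega)

theorem elements : Feasible w fun x => (X x).elements := by
  refine append (map (f := fun _ i => (i, [])) (range (parts hX hw)) (pair (snd (id _)) nilConst))
    (flatMap (f := fun x i => (_root_.choices ((X x).part i) (X x).alphabet).map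
      fun τ => ((X x).parts + i, τ)) (range (parts hX hw)) ?_)
  refine map (f := fun (p : α × ℕ) τ => ((X p.1).parts + p.2, τ))
    (choices (part (X := fun p : α × ℕ => X p.1) hX.weaken (bddWeaken hw) (snd (id _)))
      (alphabet hX).weaken ?_) ?_
  · refine (bddWeaken hw).mono fun p => ?_
    simpa [RawInput.part] using (X p.1).pow_partSize_le
  · exact pair (add (parts hX hw).weaken.weaken (snd (fst (id _)))) (snd (id _))

theorem selections : Feasible w fun x => (X x).selections := by
  refine choices (range (parts hX hw)) (cons falseConst (cons trueConst nilConst))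
    (hw.mono fun x => ?_)
  simpa using (X x).two_pow_parts_le

theorem partSets : Feasible w fun x => (X x).partSets := by
  refine choices (map (f := fun x i => (X x).parts + i) (range (parts hX hw))
    (add (parts hX hw).weaken (snd (id _)))) (cons falseConst (cons trueConst nilConst))
    (hw.mono fun x => ?_)
  simpa using (X x).two_pow_parts_le

variable {c : α → List Bool} (hc : Feasible w c)
include hc

theorem pick {p t : α → ℕ} (hp : Feasible w p) (ht : Feasible w t) :
    Feasible w fun x => (X x).pick (c x) (p x) (t x) := by
  refine takeOne (drop (edgePairs hX) (binary
    (bit := fun x l => (c x).getD ((p x * (X x).rounds + t x) * (X x).bits + l) false) (bits hX)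
    (getD rfl hc.weaken ?_) (bddTwoPowBits hX)))
  exact add (mul (add (mul hp (rounds hX hw)) ht) (bits hX)).weaken (snd (id _))

theorem tests {p : α → ℕ} (hp : Feasible w p) :
    Feasible w fun x => (X x).tests (c x) (p x) :=
  map (f := fun x t => (X x).pick (c x) (p x) t) (range (rounds hX hw))
    (pick hX.weaken (bddWeaken hw) hc.weaken hp.weaken (snd (id _)))

theorem concepts : Feasible w fun x => (X x).concepts (c x) := by
  refine flatMap (f := fun x p => (X x).partSets.flatMap fun J =>
    (_root_.choices ((X x).tests (c x) p) (X x).alphabet).map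
      fun σ => ((X x).selections.getD p [] ++ J, σ)) (range (twoPowParts hX hw)) ?_
  refine flatMap (f := fun (y : α × ℕ) J =>
    (_root_.choices ((X y.1).tests (c y.1) y.2) (X y.1).alphabet).map
      fun σ => ((X y.1).selections.getD y.2 [] ++ J, σ)) (partSets hX hw).weaken ?_
  refine map (f := fun (z : (α × ℕ) × List (ℕ × Bool)) σ =>
      ((X z.1.1).selections.getD z.1.2 [] ++ z.2, σ))
    (choices (tests (X := fun z : (α × ℕ) × List (ℕ × Bool) => X z.1.1) hX.weaken.weaken
      (bddWeaken (bddWeaken hw)) hc.weaken.weaken (snd (fst (id _))))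
      (alphabet hX).weaken.weaken ?_) ?_
  · refine (bddWeaken (bddWeaken hw)).mono fun p => ?_
    simpa [RawInput.tests] using (X p.1.1).pow_rounds_le
  · refine pair (append (getD rfl ?_ ?_) ?_) (snd (id _))
    · exact (selections hX hw).weaken.weaken.weaken
    · exact snd (fst (fst (id _)))
    · exact snd (fst (id _))

end Input

theorem edgeOk {e : α → RawEdge} {s v l : α → ℕ} (he : Feasible w e) (hs : Feasible w s)
    (hv : Feasible w v) (hl : Feasible w l) :
    Feasible w fun x => (e x).ok (s x) (v x) (l x) :=
  bOr (bNot (natBeq (fst he) hv)) (natBeq (getD rfl (fst (snd (snd he))) hl) hs)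

theorem consistent {σ : α → List (EdgeTest × ℕ)} {τ : α → List (ℕ × ℕ)} (hσ : Feasible w σ)
    (hτ : Feasible w τ) : Feasible w fun x => consistent (σ x) (τ x) := by
  refine all (f := fun x ps => ps.1.all fun ee => (τ x).all fun vl =>
    ee.1.ok ps.2 vl.1 vl.2 && ee.2.ok ps.2 vl.1 vl.2) hσ ?_
  refine all (f := fun (y : α × EdgeTest × ℕ) ee => (τ y.1).all fun vl =>
    ee.1.ok y.2.2 vl.1 vl.2 && ee.2.ok y.2.2 vl.1 vl.2) (fst (snd (id _))) ?_
  refine all (f := fun (z : (α × EdgeTest × ℕ) × RawEdge × RawEdge) vl =>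
    z.2.1.ok z.1.2.2 vl.1 vl.2 && z.2.2.ok z.1.2.2 vl.1 vl.2) hτ.weaken.weaken ?_
  exact bAnd (edgeOk (fst (snd (fst (id _)))) (snd (snd (fst (fst (id _))))) (fst (snd (id _)))
    (snd (snd (id _)))) (edgeOk (snd (snd (fst (id _)))) (snd (snd (fst (fst (id _)))))
    (fst (snd (id _))) (snd (snd (id _))))

theorem inConcept {c : α → List (ℕ × Bool) × List (EdgeTest × ℕ)} {el : α → ℕ × List (ℕ × ℕ)}
    (hc : Feasible w c) (he : Feasible w el) : Feasible w fun x => inConcept (c x) (el x) := by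
  refine bAnd (any (f := fun x ib => ib.1 == (el x).1 && ib.2) (fst hc) ?_)
    (consistent (snd hc) (snd he))
  exact bAnd (natBeq (fst (snd (id _))) (fst he).weaken) (snd (snd (id _)))

theorem output {X : α → RawInput} (hX : Feasible w X)
    (hw : PolyBdd (weight w) fun x => (X x).expWeight) {c : α → List Bool}
    (hc : Feasible w c) : Feasible w fun x => (X x).output (c x) := by
  refine pair (length (elements hX hw)) (map
    (f := fun x c => (X x).elements.map fun el => _root_.inConcept c el) (concepts hX hw hc) ?_)
  exact map (f := fun (p : α × _) el => _root_.inConcept p.2 el) (elements hX hw).weaken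
    (inConcept (snd (fst (id _))) (snd (id _)))

end Feasible

/-! ### Tossing the coins -/

/-- Replaces a number by a list of that many coin outcomes. -/
def tossProg : Prog :=
  .comp (.comp (.pair .hd (.pair .tl .nil)) (.loop (.comp .tl .hd)
    (.pair .hd (.pair (.comp .tl (.comp .hd .tl)) (.pair .coin (.comp .tl .tl))))))
    (.pair .hd (.comp .tl .tl))

/-- Each outcome is put in front of the earlier ones, so the list comes out reversed;
`exists_reduction` reverses it again before use. -/
theorem toss_loop {α : Type} [Enc α] (x : α) (ω : ℕ → Bool) (m i : ℕ) (acc : List Bool) :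
    ∃ t ≤ 30 * m + 4, Run ω (.loop (.comp .tl .hd)
      (.pair .hd (.pair (.comp .tl (.comp .hd .tl)) (.pair .coin (.comp .tl .tl)))))
      (enc (x, m, acc)) i
      (enc (x, 0, ((List.range m).map fun j => ω (i + j)).reverse ++ acc)) (i + m) t := by
  induction m generalizing i acc with
  | zero => exact ⟨4, by omega, Run.loop_stop (.comp (.tl _ _) (.hd _ _))⟩
  | succ m ih =>
    obtain ⟨t, ht, h⟩ := ih (i + 1) (ω i :: acc)
    have h1 : ((List.range (m + 1)).map fun j => ω (i + j)).reverse ++ acc =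
        ((List.range m).map fun j => ω (i + 1 + j)).reverse ++ ω i :: acc := by
      rw [List.range_succ_eq_map]
      simp only [List.map_cons, List.map_map, List.reverse_cons, List.append_assoc,
        List.cons_append, List.nil_append, Nat.add_zero, Function.comp_def]
      congr 2
      refine List.map_congr_left fun j _ => ?_
      congr 1
      omega
    rw [h1, show i + (m + 1) = i + 1 + m by omega]
    refine ⟨_, ?_, .loop_step (.comp (.tl _ _) (.hd _ _)) (.pair (.hd _ _)
      (.pair (.comp (.tl _ _) (.comp (.hd _ _) (.tl _ _)))
        (.pair (.coin _ _) (.comp (.tl _ _) (.tl _ _))))) h⟩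
    omega

theorem toss_run {α : Type} [Enc α] (x : α) (ω : ℕ → Bool) (m : ℕ) :
    ∃ t ≤ 30 * m + 20, Run ω tossProg (enc (x, m)) 0
      (enc (x, ((List.range m).map ω).reverse)) m t := by
  obtain ⟨t, ht, h⟩ := toss_loop x ω m 0 []
  simp only [List.append_nil, Nat.zero_add] at h
  refine ⟨_, ?_, .comp (.comp (.pair (.hd _ _) (.pair (.tl _ _) (.nil _ _))) h)
    (.pair (.hd _ _) (.comp (.tl _ _) (.tl _ _)))⟩
  omega

/-- The list of the first outcomes. -/
def coinList (ω : ℕ → Bool) (m : ℕ) : List Bool := (List.range m).map ω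

/-- Three programs are composed: the first computes the number of coins, the second tosses them, and
the third is a coin-free function of the input and the outcomes. The time bound therefore holds for
every coin sequence. -/
theorem exists_reduction : ∃ (R : Prog) (c : ℕ), ∀ (x : RawInput) (ω : ℕ → Bool),
    (∃ j t, Run ω R (enc x) 0 (enc (x.output (coinList ω x.coinCount))) j t ∧
      t ≤ (x.expWeight + esize x + 1) ^ c) ∧
    esize (x.output (coinList ω x.coinCount)) ≤ (x.expWeight + esize x + 1) ^ c := by
  have hW : PolyBdd (weight RawInput.expWeight) RawInput.expWeight := Feasible.bddWeight _
  obtain ⟨hs, p, T, hT, hr⟩ :=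
    Feasible.pair (Feasible.id RawInput.expWeight) (Feasible.coinCount (Feasible.id _) hW)
  obtain ⟨hs', p', T', hT', hr'⟩ := Feasible.output
    (w := fun y : RawInput × List Bool => y.1.expWeight) (X := fun y => y.1)
    (c := fun y => y.2.reverse) (Feasible.fst (Feasible.id _)) (Feasible.bddWeight _)
    (Feasible.reverse (Feasible.snd (Feasible.id _)))
  obtain ⟨c, hc⟩ := hs'
  obtain ⟨d, hd⟩ := hT'
  have hM := (Feasible.coinCount (Feasible.id RawInput.expWeight) hW).bddNat
  have hV : PolyBdd (weight RawInput.expWeight)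
      fun x => x.expWeight + (esize x + (x.coinCount * 4 + 1) + 1) + 1 :=
    Feasible.bddAdd (Feasible.bddAdd hW (Feasible.bddAdd (Feasible.bddAdd (Feasible.bddSelf _)
      (Feasible.bddAdd (hM.mul (Feasible.bddConst _ 4)) (Feasible.bddConst _ 1)))
      (Feasible.bddConst _ 1))) (Feasible.bddConst _ 1)
  have hpow : ∀ e : ℕ, PolyBdd (weight RawInput.expWeight)
      fun x => (x.expWeight + (esize x + (x.coinCount * 4 + 1) + 1) + 1) ^ e := fun e =>
    PolyBdd.comp (V := fun n : ℕ => n) (k := fun n => n ^ e)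
      (f := fun x : RawInput => x.expWeight + (esize x + (x.coinCount * 4 + 1) + 1) + 1)
      ⟨e, fun n => le_rfl⟩ hV
  obtain ⟨c', hc'⟩ := Feasible.bddAdd (hpow c) (Feasible.bddAdd (hpow d) (Feasible.bddAdd hT
    (Feasible.bddAdd ((Feasible.bddConst _ 30).mul hM) (Feasible.bddConst _ 30))))
  have hle : ∀ (x : RawInput) ω, weight (fun y : RawInput × List Bool => y.1.expWeight)
      (x, (coinList ω x.coinCount).reverse) ≤
      x.expWeight + (esize x + (x.coinCount * 4 + 1) + 1) + 1 := by
    intro x ω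
    have := esize_list_le (l := (coinList ω x.coinCount).reverse) (N := x.coinCount) (B := 3)
      (by simp [coinList]) fun b _ => esize_bool b
    simp only [weight, esize_pair]
    omega
  refine ⟨.comp p (.comp tossProg p'), c', fun x ω => ⟨?_, ?_⟩⟩
  · obtain ⟨t1, ht1, h1⟩ := hr x ω 0
    obtain ⟨t2, ht2, h2⟩ := toss_run x ω x.coinCount
    obtain ⟨t3, ht3, h3⟩ := hr' (x, (coinList ω x.coinCount).reverse) ω x.coinCount
    simp only [List.reverse_reverse] at h3
    refine ⟨_, _, .comp h1 (.comp h2 h3), le_trans ?_ (hc' x)⟩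
    have h4 := ht3.trans ((hd _).trans (Nat.pow_le_pow_left (hle x ω) d))
    dsimp only
    omega
  · have h5 := (hc (x, (coinList ω x.coinCount).reverse)).trans (Nat.pow_le_pow_left (hle x ω) c)
    simp only [List.reverse_reverse] at h5
    exact le_trans (by dsimp only; omega) (hc' x)

/-! ### Probability estimates -/

/-- One cylinder of measure `2 ^ (-M)` for each element of `S` covers the event. Only upper bounds
are needed, so measurability plays no role. -/
theorem coinMeasure_coe_mem_le {M : ℕ} (S : Finset (Fin M → Bool)) :
    coinMeasure {ω | (fun i : Fin M => ω i) ∈ S} ≤ S.card * (2⁻¹ : ℝ≥0∞) ^ M := by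
  have hsub : {ω : ℕ → Bool | (fun i : Fin M => ω i) ∈ S} ⊆ ⋃ v ∈ S,
      ((Finset.range M : Set ℕ).pi fun i => {if h : i < M then v ⟨i, h⟩ else false}) := by
    intro ω hω
    simp only [Set.mem_iUnion]
    refine ⟨_, hω, fun i hi => ?_⟩
    have : i < M := by simpa using hi
    simp [this]
  refine (measure_mono hsub).trans ((measure_biUnion_finset_le _ _).trans ?_)
  refine (Finset.sum_le_card_nsmul S _ ((2⁻¹ : ℝ≥0∞) ^ M) fun v _ => le_of_eq ?_).trans
    (by rw [nsmul_eq_mul])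
  rw [coinMeasure, Measure.infinitePi_pi _ fun i _ => MeasurableSet.singleton _]
  have hb : ∀ b : Bool, (PMF.uniformOfFintype Bool).toMeasure {b} = 2⁻¹ := by
    intro b
    rw [PMF.toMeasure_apply_singleton _ _ (MeasurableSet.singleton _)]
    simp
  rw [Finset.prod_congr rfl fun i _ => hb _, Finset.prod_const, Finset.card_range]

/-- Blocks of `s` bits are determined by their binary value, so the blocks in question inject into
the complement of `D`. -/
theorem card_binary_notMem_le (s : ℕ) (D : Finset ℕ) (hD : D ⊆ Finset.range (2 ^ s)) :
    (Finset.univ.filter fun b : Fin s → Bool =>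
      binary (fun l => if h : l < s then b ⟨l, h⟩ else false) s ∉ D).card ≤ 2 ^ s - D.card := by
  rw [← Finset.card_range (2 ^ s), ← Finset.card_sdiff_of_subset hD]
  refine Finset.card_le_card_of_injOn
    (fun b => binary (fun l => if h : l < s then b ⟨l, h⟩ else false) s) ?_ ?_
  · intro b hb
    simp only [Finset.coe_filter, Finset.mem_univ, true_and, Set.mem_ofPred_eq] at hb
    simp only [Finset.coe_sdiff, Set.mem_sdiff, Finset.mem_coe, Finset.mem_range]
    exact ⟨binary_lt _ _, hb⟩
  · intro b _ b' _ h
    funext l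
    have := binary_inj h l l.2
    simpa using this

/-- Number of coin sequences for which none of the selected blocks hits `D`. -/
theorem card_avoid_le (A Q s : ℕ) (D : Finset ℕ) (hD : D ⊆ Finset.range (2 ^ s))
    (I : Finset ℕ) (hI : I ⊆ Finset.range A) :
    (Finset.univ.filter fun v : Fin (A * Q * s) → Bool => ∀ p ∈ I, ∀ t < Q,
      binary (fun l => if h : (p * Q + t) * s + l < A * Q * s then v ⟨_, h⟩ else false) s ∉ D).card
      ≤ (2 ^ s - D.card) ^ (Q * I.card) * (2 ^ s) ^ (Q * (A - I.card)) := by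
  classical
  set good := Finset.univ.filter fun b : Fin s → Bool =>
      binary (fun l => if h : l < s then b ⟨l, h⟩ else false) s ∉ D with hgood
  have hidx : ∀ {p t l : ℕ}, p < A → t < Q → l < s → (p * Q + t) * s + l < A * Q * s := by
    intro p t l hp ht hl
    have h1 : p * Q + t + 1 ≤ A * Q := by
      have : (p + 1) * Q ≤ A * Q := Nat.mul_le_mul_right _ hp
      rw [Nat.succ_mul] at this; omega
    have h2 := Nat.mul_le_mul_right s h1
    rw [Nat.succ_mul] at h2; omega
  -- The coins are cut into `A * Q` disjoint blocks of `s` bits. Independence of the blocks becomes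
  -- the product formula for this set, and the mixed radix expansion of a position shows that no
  -- coin is lost.
  set F : Finset (Fin A → Fin Q → Fin s → Bool) := Fintype.piFinset fun p =>
    Fintype.piFinset fun _ => if (p : ℕ) ∈ I then good else Finset.univ with hF
  have hcardF : F.card ≤ (2 ^ s - D.card) ^ (Q * I.card) * (2 ^ s) ^ (Q * (A - I.card)) := by
    rw [hF, Fintype.card_piFinset]
    simp only [Fintype.card_piFinset, Finset.prod_const, Finset.card_univ, Fintype.card_fin]
    rw [Fin.prod_univ_eq_prod_range (fun p => (if p ∈ I then good else Finset.univ).card ^ Q) A,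
      ← Finset.prod_sdiff hI, mul_comm]
    refine Nat.mul_le_mul ?_ ?_
    · rw [Finset.prod_congr rfl fun p hp => by rw [if_pos hp], Finset.prod_const, pow_mul]
      gcongr
      exact card_binary_notMem_le s D hD
    · rw [Finset.prod_congr rfl fun p hp => by rw [if_neg (Finset.mem_sdiff.1 hp).2],
        Finset.prod_const, pow_mul, Finset.card_sdiff_of_subset hI]
      simp
  refine le_trans (Finset.card_le_card_of_injOn
    (fun v (p : Fin A) (t : Fin Q) (l : Fin s) => v ⟨((p : ℕ) * Q + t) * s + l, hidx p.2 t.2 l.2⟩) ?_ ?_) hcardF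
  · intro v hv
    simp only [Finset.coe_filter, Finset.mem_univ, true_and, Set.mem_ofPred_eq] at hv
    simp only [hF, Finset.mem_coe, Fintype.mem_piFinset]
    intro p t
    split_ifs with hp
    · rw [hgood, Finset.mem_filter]
      refine ⟨Finset.mem_univ _, ?_⟩
      convert hv p hp t t.2 using 2
      refine binary_congr fun l hl => ?_
      rw [dif_pos hl, dif_pos (hidx p.2 t.2 hl)]
    · exact Finset.mem_univ _
  · intro v _ v' _ h
    funext i
    rcases Nat.eq_zero_or_pos s with hs | hs
    · have := i.2; simp [hs] at this
    rcases Nat.eq_zero_or_pos Q with hQ | hQ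
    · have := i.2; simp [hQ] at this
    have h1 : (i : ℕ) / s < A * Q := (Nat.div_lt_iff_lt_mul hs).2 i.2
    have h2 : (i : ℕ) / s / Q < A := (Nat.div_lt_iff_lt_mul hQ).2 h1
    have h3 := congrFun (congrFun (congrFun h ⟨_, h2⟩) ⟨(i : ℕ) / s % Q, Nat.mod_lt _ hQ⟩)
      ⟨(i : ℕ) % s, Nat.mod_lt _ hs⟩
    have h4 : ((i : ℕ) / s / Q * Q + (i : ℕ) / s % Q) * s + (i : ℕ) % s = i := by
      rw [Nat.div_add_mod', Nat.div_add_mod']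
    simpa only [h4, Fin.eta] using h3

theorem coinMeasure_avoid_le (A Q s : ℕ) (D : Finset ℕ) (hD : D ⊆ Finset.range (2 ^ s))
    (I : Finset ℕ) (hI : I ⊆ Finset.range A) {θ : ℝ} (hθ : θ * 2 ^ s ≤ D.card) :
    coinMeasure {ω | ∀ p ∈ I, ∀ t < Q,
      binary (fun l => ω ((p * Q + t) * s + l)) s ∉ D} ≤
        ENNReal.ofReal ((1 - θ) ^ (Q * I.card)) := by
  have hidx : ∀ {p t l : ℕ}, p < A → t < Q → l < s → (p * Q + t) * s + l < A * Q * s := by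
    intro p t l hp ht hl
    have h1 : p * Q + t + 1 ≤ A * Q := by
      have : (p + 1) * Q ≤ A * Q := Nat.mul_le_mul_right _ hp
      rw [Nat.succ_mul] at this; omega
    have h2 := Nat.mul_le_mul_right s h1
    rw [Nat.succ_mul] at h2; omega
  have hset : {ω : ℕ → Bool | ∀ p ∈ I, ∀ t < Q,
      binary (fun l => ω ((p * Q + t) * s + l)) s ∉ D} ⊆
      {ω | (fun i : Fin (A * Q * s) => ω i) ∈
        Finset.univ.filter fun v : Fin (A * Q * s) → Bool => ∀ p ∈ I, ∀ t < Q,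
        binary (fun l => if h : (p * Q + t) * s + l < A * Q * s then v ⟨_, h⟩ else false) s ∉ D} := by
    intro ω hω
    simp only [Set.mem_ofPred_eq, Finset.mem_filter, Finset.mem_univ, true_and] at hω ⊢
    intro p hp t ht
    convert hω p hp t ht using 2
    refine binary_congr fun l hl => ?_
    rw [dif_pos (hidx (Finset.mem_range.1 (hI hp)) ht hl)]
  refine (measure_mono hset).trans ((coinMeasure_coe_mem_le _).trans ?_)
  have hcA : I.card ≤ A := by simpa using Finset.card_le_card hI
  have hDs : D.card ≤ 2 ^ s := by simpa using Finset.card_le_card hD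
  have h2 : (0 : ℝ) < 2 ^ s := by positivity
  have hreal : ((2 ^ s - D.card : ℕ) : ℝ) ≤ (1 - θ) * 2 ^ s := by
    rw [Nat.cast_sub hDs]; push_cast; linarith
  have hθ1 : 0 ≤ 1 - θ := by
    by_contra h
    have := mul_neg_of_neg_of_pos (not_le.1 h) h2
    have h0 : (0 : ℝ) ≤ ((2 ^ s - D.card : ℕ) : ℝ) := Nat.cast_nonneg _
    linarith
  have hR : ((Finset.univ.filter fun v : Fin (A * Q * s) → Bool => ∀ p ∈ I, ∀ t < Q,
      binary (fun l => if h : (p * Q + t) * s + l < A * Q * s then v ⟨_, h⟩ else false) s ∉ D).card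
      : ℝ) ≤ (1 - θ) ^ (Q * I.card) * 2 ^ (A * Q * s) := by
    calc _ ≤ (((2 ^ s - D.card) ^ (Q * I.card) * (2 ^ s) ^ (Q * (A - I.card)) : ℕ) : ℝ) := by
          exact_mod_cast card_avoid_le A Q s D hD I hI
      _ = ((2 ^ s - D.card : ℕ) : ℝ) ^ (Q * I.card) * (2 ^ s) ^ (Q * (A - I.card)) := by
          push_cast; ring
      _ ≤ ((1 - θ) * 2 ^ s) ^ (Q * I.card) * (2 ^ s) ^ (Q * (A - I.card)) := by gcongr
      _ = (1 - θ) ^ (Q * I.card) * 2 ^ (A * Q * s) := by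
          rw [mul_pow, mul_assoc, ← pow_add, ← Nat.mul_add, Nat.add_sub_cancel' hcA, ← pow_mul]
          congr 2; ring
  calc _ = ENNReal.ofReal ((Finset.univ.filter fun v : Fin (A * Q * s) → Bool => ∀ p ∈ I, ∀ t < Q,
      binary (fun l => if h : (p * Q + t) * s + l < A * Q * s then v ⟨_, h⟩ else false) s ∉ D).card
      * (2⁻¹ : ℝ) ^ (A * Q * s)) := by
        rw [ENNReal.ofReal_mul (Nat.cast_nonneg _), ENNReal.ofReal_natCast,
          ENNReal.ofReal_pow (by norm_num), ENNReal.ofReal_inv_of_pos (by norm_num)]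
        simp
    _ ≤ _ := by
        refine ENNReal.ofReal_le_ofReal ?_
        rw [inv_pow, ← div_eq_mul_inv, div_le_iff₀ (by positivity)]
        exact hR

/-- Union bound: with high probability no adversary passes `N` of the `A` selections. -/
theorem coinMeasure_exists_avoid_le {ι : Type} [Fintype ι] (A Q s N : ℕ) (D : ι → Finset ℕ)
    (ok : ι → Prop) (hD : ∀ f, D f ⊆ Finset.range (2 ^ s)) {θ : ℝ}
    (hθ : ∀ f, ok f → θ * 2 ^ s ≤ (D f).card) :
    coinMeasure {ω | ∃ f, ok f ∧ ∃ I ⊆ Finset.range A, I.card = N ∧ ∀ p ∈ I, ∀ t < Q,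
      binary (fun l => ω ((p * Q + t) * s + l)) s ∉ D f} ≤
        ENNReal.ofReal (Fintype.card ι * A ^ N * ((1 - θ) ^ Q) ^ N) := by
  classical
  have hsub : {ω : ℕ → Bool | ∃ f, ok f ∧ ∃ I ⊆ Finset.range A, I.card = N ∧ ∀ p ∈ I, ∀ t < Q,
      binary (fun l => ω ((p * Q + t) * s + l)) s ∉ D f} ⊆
      ⋃ x ∈ (Finset.univ.filter ok) ×ˢ (Finset.range A).powersetCard N,
        {ω | ∀ p ∈ x.2, ∀ t < Q, binary (fun l => ω ((p * Q + t) * s + l)) s ∉ D x.1} := by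
    rintro ω ⟨f, hf, I, hI, hN, h⟩
    simp only [Set.mem_iUnion]
    exact ⟨(f, I), by simp [hf, Finset.mem_powersetCard, hI, hN], h⟩
  refine (measure_mono hsub).trans ((measure_biUnion_finset_le _ _).trans ?_)
  -- Without admissible adversaries the event is empty; otherwise one of them shows `θ ≤ 1`, which
  -- makes the right-hand side monotone in its factors.
  rcases (Finset.univ.filter ok).eq_empty_or_nonempty with hemp | ⟨f₀, hf₀⟩
  · simp [hemp]
  have hθ1 : 0 ≤ 1 - θ := by
    have h1 := hθ f₀ (by simpa using hf₀)
    have h2 : ((D f₀).card : ℝ) ≤ 2 ^ s := by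
      have := Finset.card_le_card (hD f₀)
      rw [Finset.card_range] at this
      exact_mod_cast this
    have h3 : (0 : ℝ) < 2 ^ s := by positivity
    by_contra h
    nlinarith [mul_neg_of_neg_of_pos (not_le.1 h) h3]
  refine (Finset.sum_le_card_nsmul _ _ (ENNReal.ofReal (((1 - θ) ^ Q) ^ N)) fun x hx => ?_).trans ?_
  · simp only [Finset.mem_product, Finset.mem_filter, Finset.mem_univ, true_and,
      Finset.mem_powersetCard] at hx
    have := coinMeasure_avoid_le A Q s (D x.1) (hD _) x.2 hx.2.1 (hθ _ hx.1)
    rwa [hx.2.2, pow_mul] at this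
  · rw [nsmul_eq_mul, ← ENNReal.ofReal_natCast, ← ENNReal.ofReal_mul (Nat.cast_nonneg _)]
    refine ENNReal.ofReal_le_ofReal ?_
    refine mul_le_mul_of_nonneg_right ?_ (by positivity)
    rw [Finset.card_product, Finset.card_powersetCard, Finset.card_range]
    push_cast
    gcongr
    · exact Finset.card_le_univ _
    · exact_mod_cast Nat.choose_le_pow A N

/-! ### Inconsistent pairs of edges -/

namespace LabelCover

variable (L : LabelCover)

theorem valOf_le_val (φ : L.Assignment) : L.valOf φ ≤ L.val :=
  le_ciSup (f := fun φ => L.valOf φ) (Set.finite_range _).bddAbove φ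

/-- Pairs of edges with a common right end, for which the labels of the left ends, if both are in
`S`, are projected to different labels. -/
def badPairs (S : Finset (Fin L.a)) (f : Fin L.a → Fin L.k) :
    Finset ((Fin L.a × Fin L.b) × (Fin L.a × Fin L.b)) :=
  (L.E ×ˢ L.E).filter fun p => p.1.2 = p.2.2 ∧ p.1.1 ∈ S ∧ p.2.1 ∈ S ∧
    L.proj p.1 (f p.1.1) ≠ L.proj p.2 (f p.2.1)

variable {L}

theorem card_edges_left {dA : ℕ} (hA : ∀ i : Fin L.a, (L.E.filter fun e => e.1 = i).card = dA)
    (S : Finset (Fin L.a)) : (L.E.filter fun e => e.1 ∈ S).card = S.card * dA := by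
  rw [Finset.card_eq_sum_card_fiberwise (f := Prod.fst) (t := S) fun e he => by
    simpa using (Finset.mem_filter.1 he).2]
  rw [← smul_eq_mul, ← Finset.sum_const]
  refine Finset.sum_congr rfl fun i hi => ?_
  rw [← hA i, Finset.filter_filter]
  congr 1
  refine Finset.filter_congr fun e _ => ?_
  constructor
  · exact fun h => h.2
  · exact fun h => ⟨h ▸ hi, h⟩

theorem card_edges_eq_left {dA : ℕ}
    (hA : ∀ i : Fin L.a, (L.E.filter fun e => e.1 = i).card = dA) : L.E.card = L.a * dA := by
  have := card_edges_left hA Finset.univ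
  simpa using this

theorem card_edges_eq_right {dB : ℕ}
    (hB : ∀ j : Fin L.b, (L.E.filter fun e => e.2 = j).card = dB) : L.E.card = L.b * dB := by
  rw [Finset.card_eq_sum_card_fiberwise (f := Prod.snd) (t := Finset.univ) fun e _ => by simp]
  rw [Finset.sum_congr rfl fun j _ => hB j]
  simp

/-- At a right vertex `j`, sort the edges from `S` by the label to which they project `f`, and let
`φ j` be the most frequent label. Each edge agrees with at most as many edges as that frequency, so
there are at most `dB` times the frequency agreeing pairs at `j`. The frequencies add up to at most
`val * |E|`, because `f` and `φ` form an assignment. Cauchy-Schwarz over the right vertices bounds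
the number of all pairs from below. -/
theorem sq_le_badPairs {dA dB : ℕ}
    (hA : ∀ i : Fin L.a, (L.E.filter fun e => e.1 = i).card = dA)
    (hB : ∀ j : Fin L.b, (L.E.filter fun e => e.2 = j).card = dB)
    (hk : 0 < L.k) (S : Finset (Fin L.a)) (f : Fin L.a → Fin L.k) (hE : L.E.Nonempty) :
    ((S.card * dA : ℕ) : ℝ) ^ 2 ≤
      L.b * ((L.badPairs S f).card + dB * (L.val * L.E.card)) := by
  classical
  have : Nonempty (Fin L.k) := ⟨⟨0, hk⟩⟩
  set g : Fin L.a × Fin L.b → Fin L.k := fun e => L.proj e (f e.1) with hg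
  set ES := L.E.filter fun e => e.1 ∈ S with hES
  set fib : Fin L.b → Finset (Fin L.a × Fin L.b) := fun j => ES.filter fun e => e.2 = j with hfib
  have hcard : ES.card = S.card * dA := card_edges_left hA S
  have hsum : ∑ j, (fib j).card = S.card * dA := by
    rw [← hcard, Finset.card_eq_sum_card_fiberwise (f := Prod.snd) (t := Finset.univ) fun e _ => by
      simp]
  have hmax : ∀ j, ∃ s, ∀ s', ((fib j).filter fun e => g e = s').card ≤
      ((fib j).filter fun e => g e = s).card := by
    intro j
    obtain ⟨s, -, hs⟩ := Finset.exists_max_image Finset.univ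
      (fun s => ((fib j).filter fun e => g e = s).card) Finset.univ_nonempty
    exact ⟨s, fun s' => hs s' (Finset.mem_univ _)⟩
  choose φ hφ using hmax
  set agree : Fin L.b → Finset ((Fin L.a × Fin L.b) × (Fin L.a × Fin L.b)) := fun j =>
    (fib j ×ˢ fib j).filter fun p => g p.1 = g p.2 with hagree
  set dis : Fin L.b → Finset ((Fin L.a × Fin L.b) × (Fin L.a × Fin L.b)) := fun j =>
    (fib j ×ˢ fib j).filter fun p => ¬ g p.1 = g p.2 with hdis
  have hsq : ∀ j, (fib j).card ^ 2 = (agree j).card + (dis j).card := by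
    intro j
    rw [hagree, hdis, Finset.card_filter_add_card_filter_not, Finset.card_product, sq]
  have hag : ∀ j, (agree j).card ≤ dB * ((fib j).filter fun e => g e = φ j).card := by
    intro j
    rw [Finset.card_eq_sum_card_fiberwise (f := Prod.fst) (t := fib j) fun p hp => by
      simp only [hagree, Finset.coe_filter, Set.mem_ofPred_eq, Finset.mem_product] at hp
      exact hp.1.1]
    refine (Finset.sum_le_card_nsmul _ _ ((fib j).filter fun e => g e = φ j).card
      fun e he => ?_).trans ?_
    · refine le_trans ?_ (hφ j (g e))
      refine Finset.card_le_card_of_injOn Prod.snd ?_ ?_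
      · intro p hp
        simp only [hagree, Finset.coe_filter, Set.mem_ofPred_eq, Finset.mem_product,
          Finset.mem_filter] at hp ⊢
        exact ⟨hp.1.1.2, by rw [← hp.1.2, hp.2]⟩
      · intro p hp p' hp' h
        simp only [Finset.coe_filter, Set.mem_ofPred_eq] at hp hp'
        exact Prod.ext (hp.2.trans hp'.2.symm) h
    · rw [smul_eq_mul]
      refine Nat.mul_le_mul_right _ ?_
      rw [← hB j]
      refine Finset.card_le_card fun e he => ?_
      simp only [hfib, hES, Finset.mem_filter] at he ⊢
      exact ⟨he.1.1, he.2⟩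
  have hbad : ∑ j, (dis j).card ≤ (L.badPairs S f).card := by
    rw [← Finset.card_biUnion]
    · refine Finset.card_le_card fun p hp => ?_
      simp only [Finset.mem_biUnion, Finset.mem_univ, true_and, hdis, hfib, hES,
        Finset.mem_filter, Finset.mem_product] at hp
      obtain ⟨j, ⟨⟨⟨h1, h2⟩, h3⟩, ⟨⟨h4, h5⟩, h6⟩⟩, h7⟩ := hp
      simp only [badPairs, Finset.mem_filter, Finset.mem_product]
      exact ⟨⟨h1, h4⟩, h3.trans h6.symm, h2, h5, h7⟩
    · intro j _ j' _ hjj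
      rw [Function.onFun, Finset.disjoint_left]
      intro p hp hp'
      simp only [hdis, hfib, Finset.mem_filter, Finset.mem_product] at hp hp'
      exact hjj (hp.1.1.2.symm.trans hp'.1.1.2)
  have hsat : ((∑ j, ((fib j).filter fun e => g e = φ j).card : ℕ) : ℝ) ≤ L.val * L.E.card := by
    have hEpos : (0 : ℝ) < L.E.card := by exact_mod_cast hE.card_pos
    rw [← div_le_iff₀ hEpos]
    refine le_trans ?_ (L.valOf_le_val (Sum.elim f φ))
    unfold valOf
    gcongr
    rw [← Finset.card_biUnion]
    · refine Finset.card_le_card fun e he => ?_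
      simp only [Finset.mem_biUnion, Finset.mem_univ, true_and, hfib, hES,
        Finset.mem_filter] at he
      obtain ⟨j, ⟨⟨h1, h2⟩, rfl⟩, h4⟩ := he
      simp only [Finset.mem_filter]
      exact ⟨h1, h4⟩
    · intro j _ j' _ hjj
      rw [Function.onFun, Finset.disjoint_left]
      intro p hp hp'
      simp only [hfib, Finset.mem_filter] at hp hp'
      exact hjj (hp.1.2.symm.trans hp'.1.2)
  have hcs := sq_sum_le_card_mul_sum_sq (s := Finset.univ) (f := fun j => (fib j).card)
  rw [hsum, Finset.card_univ, Fintype.card_fin] at hcs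
  have hn : (S.card * dA) ^ 2 ≤ L.b * ((L.badPairs S f).card +
      dB * ∑ j, ((fib j).filter fun e => g e = φ j).card) := by
    refine hcs.trans (Nat.mul_le_mul_left _ ?_)
    rw [Finset.sum_congr rfl fun j _ => hsq j, Finset.sum_add_distrib, add_comm, Finset.mul_sum]
    exact Nat.add_le_add hbad (Finset.sum_le_sum fun j _ => hag j)
  calc ((S.card * dA : ℕ) : ℝ) ^ 2 ≤ ((L.b * ((L.badPairs S f).card +
      dB * ∑ j, ((fib j).filter fun e => g e = φ j).card) : ℕ) : ℝ) := by exact_mod_cast hn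
    _ = L.b * ((L.badPairs S f).card +
      dB * ((∑ j, ((fib j).filter fun e => g e = φ j).card : ℕ) : ℝ)) := by push_cast; ring
    _ ≤ _ := by gcongr

/-- A set `S` of left vertices of density `σ` has many inconsistent pairs. -/
theorem badPairs_density {dA dB : ℕ}
    (hA : ∀ i : Fin L.a, (L.E.filter fun e => e.1 = i).card = dA)
    (hB : ∀ j : Fin L.b, (L.E.filter fun e => e.2 = j).card = dB)
    (hk : 0 < L.k) (S : Finset (Fin L.a)) (f : Fin L.a → Fin L.k) (hE : L.E.Nonempty)
    {ρ : ℝ} (hρ : 0 ≤ ρ) (hS : ρ * L.a ≤ S.card) :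
    (ρ ^ 2 - L.val) * (L.E.card * dB) ≤ (L.badPairs S f).card := by
  have h1 := sq_le_badPairs hA hB hk S f hE
  have hb : (0 : ℝ) < L.b := by
    obtain ⟨e, -⟩ := hE
    exact_mod_cast e.2.pos
  have hEA : (L.E.card : ℝ) = L.a * dA := by exact_mod_cast card_edges_eq_left hA
  have hEB : (L.E.card : ℝ) = L.b * dB := by exact_mod_cast card_edges_eq_right hB
  have h2 : (ρ * L.E.card) ^ 2 ≤ ((S.card * dA : ℕ) : ℝ) ^ 2 := by
    push_cast
    have : ρ * (L.E.card : ℝ) ≤ S.card * dA := by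
      rw [hEA, ← mul_assoc]; gcongr
    gcongr
  have h3 : ρ ^ 2 * (L.E.card * dB) * L.b ≤
      L.b * ((L.badPairs S f).card + dB * (L.val * L.E.card)) := by
    refine le_trans (le_of_eq ?_) (h2.trans h1)
    rw [mul_pow, sq (L.E.card : ℝ)]
    nth_rewrite 3 [hEB]
    ring
  rw [mul_comm (L.b : ℝ)] at h3
  have h4 := le_of_mul_le_mul_right h3 hb
  linarith

end LabelCover

/-! ### The concept class of the reduction -/

namespace RawInput

/-- The concept class that the output describes. -/
def conceptClass (x : RawInput) (coins : List Bool) : ConceptClass where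
  u := x.elements.length
  concepts := ((x.concepts coins).map fun c =>
    Finset.univ.filter fun i : Fin x.elements.length => inConcept c x.elements[i] = true).toFinset

theorem describes_conceptClass (x : RawInput) (coins : List Bool) :
    (enc (x.output coins)).Describes (x.conceptClass coins) := by
  refine ⟨(x.concepts coins).map fun c => Finset.univ.filter
    fun i : Fin x.elements.length => inConcept c x.elements[i] = true, rfl, ?_⟩
  rw [RawInput.output, enc_pair]
  congr 1
  change Datum.ofList _ = _
  rw [List.map_map, List.map_map]
  congr 1
  refine List.map_congr_left fun c _ => ?_
  change Datum.ofList _ = Datum.ofList _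
  congr 1
  rw [List.map_map]
  refine List.ext_getElem (by simp [conceptClass]) fun i h1 h2 => ?_
  simp only [List.getElem_map, List.getElem_finRange, Function.comp_apply]
  change Datum.ofBool _ = _
  congr 1
  rw [Bool.eq_iff_iff, decide_eq_true_iff]
  exact ⟨fun h => Finset.mem_filter.2 ⟨Finset.mem_univ _, h⟩, fun h => (Finset.mem_filter.1 h).2⟩

theorem mem_conceptClass {x : RawInput} {coins : List Bool} {T : Finset (Fin x.elements.length)} :
    T ∈ (x.conceptClass coins).concepts ↔ ∃ c ∈ x.concepts coins,
      ∀ i, i ∈ T ↔ inConcept c x.elements[i] = true := by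
  change T ∈ List.toFinset _ ↔ _
  rw [List.mem_toFinset, List.mem_map]
  refine exists_congr fun c => and_congr_right fun _ => ?_
  constructor
  · rintro rfl i
    simp
  · intro h
    ext i
    simp [h i]

theorem card_concepts_le (x : RawInput) (coins : List Bool) :
    (x.conceptClass coins).concepts.card ≤ esize (x.output coins) := by
  have h1 := List.toFinset_card_le ((x.concepts coins).map fun c =>
    Finset.univ.filter fun i : Fin x.elements.length => inConcept c x.elements[i] = true)
  have h2 := length_le_esize ((x.concepts coins).map fun c =>
    x.elements.map fun el => inConcept c el)
  rw [List.length_map] at h1 h2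
  have h3 := esize_pair x.elements.length ((x.concepts coins).map fun c =>
    x.elements.map fun el => inConcept c el)
  unfold output
  exact h1.trans (by omega)

theorem u_le (x : RawInput) (coins : List Bool) :
    (x.conceptClass coins).u ≤ esize (x.output coins) := by
  have h3 := esize_pair x.elements.length ((x.concepts coins).map fun c =>
    x.elements.map fun el => inConcept c el)
  rw [esize_nat] at h3
  change x.elements.length ≤ _
  unfold output
  omega

theorem mem_elements {x : RawInput} {el : ℕ × List (ℕ × ℕ)} :
    el ∈ x.elements ↔ (el.1 < x.parts ∧ el.2 = []) ∨
      ∃ i < x.parts, el.1 = x.parts + i ∧ el.2 ∈ choices (x.part i) x.alphabet := by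
  simp only [elements, List.mem_append, List.mem_map, List.mem_range, List.mem_flatMap]
  refine or_congr ?_ ?_
  · constructor
    · rintro ⟨i, hi, rfl⟩
      exact ⟨hi, rfl⟩
    · rintro ⟨h1, h2⟩
      exact ⟨el.1, h1, Prod.ext rfl h2.symm⟩
  · refine exists_congr fun i => and_congr_right fun _ => ?_
    constructor
    · rintro ⟨τ, hτ, rfl⟩
      exact ⟨rfl, hτ⟩
    · rintro ⟨h1, h2⟩
      exact ⟨el.2, h2, Prod.ext h1.symm rfl⟩

theorem mem_concepts {x : RawInput} {coins : List Bool}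
    {c : List (ℕ × Bool) × List (EdgeTest × ℕ)} :
    c ∈ x.concepts coins ↔ ∃ p < 2 ^ x.parts, ∃ J ∈ x.partSets,
      c.2 ∈ choices (x.tests coins p) x.alphabet ∧ c.1 = x.selections.getD p [] ++ J := by
  simp only [concepts, List.mem_flatMap, List.mem_range, List.mem_map]
  refine exists_congr fun p => and_congr_right fun _ => exists_congr fun J =>
    and_congr_right fun _ => ?_
  constructor
  · rintro ⟨σ, hσ, rfl⟩
    exact ⟨hσ, rfl⟩
  · rintro ⟨h1, h2⟩
    exact ⟨c.2, h1, Prod.ext h2.symm rfl⟩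

theorem length_selections (x : RawInput) : x.selections.length = 2 ^ x.parts := by
  rw [selections, length_choices]; simp

theorem le_fst_of_mem_partSet {x : RawInput} {J : List (ℕ × Bool)} (hJ : J ∈ x.partSets)
    {ib : ℕ × Bool} (h : ib ∈ J) : x.parts ≤ ib.1 := by
  have h1 := (mem_choices.1 hJ).1
  have h2 := List.mem_map_of_mem (f := Prod.fst) h
  rw [h1] at h2
  simp only [List.mem_reverse, List.mem_map] at h2
  obtain ⟨i, -, hi⟩ := h2
  omega

end RawInput

/-! ### Consistency, and what a shattered set implies. -/

theorem RawEdge.ok_iff {e : RawEdge} {s v l : ℕ} :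
    e.ok s v l = true ↔ (e.1 = v → e.2.2.1.getD l 0 = s) := by
  simp [RawEdge.ok, imp_iff_not_or]

theorem consistent_iff {σ : List (EdgeTest × ℕ)} {τ : List (ℕ × ℕ)} :
    consistent σ τ = true ↔ ∀ ps ∈ σ, ∀ ee ∈ ps.1, ∀ vl ∈ τ,
      (ee.1.1 = vl.1 → ee.1.2.2.1.getD vl.2 0 = ps.2) ∧
      (ee.2.1 = vl.1 → ee.2.2.2.1.getD vl.2 0 = ps.2) := by
  simp only [consistent, List.all_eq_true, Bool.and_eq_true, RawEdge.ok_iff]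

theorem consistent_nil (σ : List (EdgeTest × ℕ)) : consistent σ [] = true :=
  consistent_iff.2 fun _ _ _ _ _ h => by simp at h

/-- Whether a labelling of a part is consistent depends only on the tests, if the labels of
the tests are consistent with another labelling of the part. -/
theorem consistent_of_consistent {σ σ' : List (EdgeTest × ℕ)} {τ τ' : List (ℕ × ℕ)}
    (hσ : σ.map Prod.fst = σ'.map Prod.fst) (hτ : τ.map Prod.fst = τ'.map Prod.fst)
    (h : consistent σ τ = true) (h' : consistent σ' τ = true) (h1 : consistent σ τ' = true) :
    consistent σ' τ' = true := by
  rw [consistent_iff] at *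
  intro ps hps ee hee vl hvl
  obtain ⟨ps', hps', hp⟩ := List.mem_map.1 (hσ ▸ List.mem_map_of_mem (f := Prod.fst) hps)
  obtain ⟨vl', hvl', hv⟩ := List.mem_map.1 (hτ ▸ List.mem_map_of_mem (f := Prod.fst) hvl)
  have hee' : ee ∈ ps'.1 := hp ▸ hee
  obtain ⟨a1, a2⟩ := h ps' hps' ee hee' vl' hvl'
  obtain ⟨b1, b2⟩ := h' ps hps ee hee vl' hvl'
  obtain ⟨c1, c2⟩ := h1 ps' hps' ee hee' vl hvl
  constructor
  · intro he
    rw [c1 he, ← a1 (he.trans hv.symm), b1 (he.trans hv.symm)]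
  · intro he
    rw [c2 he, ← a2 (he.trans hv.symm), b2 (he.trans hv.symm)]

namespace RawInput

theorem mem_choices_of_fst_eq {x : RawInput} {el : ℕ × List (ℕ × ℕ)} (h : el ∈ x.elements)
    {i : ℕ} (hi : el.1 = x.parts + i) : el.2 ∈ choices (x.part i) x.alphabet := by
  rcases mem_elements.1 h with ⟨h1, -⟩ | ⟨j, -, h1, h2⟩
  · omega
  · obtain rfl : i = j := by omega
    exact h2

theorem exists_of_shatters {x : RawInput} {coins : List Bool}
    {S : Finset (Fin x.elements.length)} (hS : (x.conceptClass coins).concepts.Shatters S)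
    {B : Finset (Fin x.elements.length)} (hB : B ⊆ S) :
    ∃ p < 2 ^ x.parts, ∃ J ∈ x.partSets, ∃ σ ∈ choices (x.tests coins p) x.alphabet,
      ∀ s ∈ S, inConcept (x.selections.getD p [] ++ J, σ) x.elements[s] = true ↔ s ∈ B := by
  obtain ⟨T, hT, hST⟩ := hS hB
  obtain ⟨⟨c1, c2⟩, hc, hTc⟩ := mem_conceptClass.1 hT
  obtain ⟨p, hp, J, hJ, hσ, hcc⟩ := mem_concepts.1 hc
  simp only at hσ hcc
  subst hcc
  refine ⟨p, hp, J, hJ, c2, hσ, fun s hs => ?_⟩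
  rw [← hTc, ← hST]
  exact ⟨fun h => Finset.mem_inter.2 ⟨hs, h⟩, fun h => (Finset.mem_inter.1 h).2⟩

/-- A shattered set yields a labelling of parts that passes the tests of many selections. -/
theorem exists_passed_of_shatters {x : RawInput} {coins : List Bool}
    {S : Finset (Fin x.elements.length)} (hS : (x.conceptClass coins).concepts.Shatters S) :
    ∃ (P : Finset ℕ) (lab : ℕ → List (ℕ × ℕ)) (I : Finset ℕ),
      P ⊆ Finset.range x.parts ∧ P.card ≤ S.card ∧
      (∀ i ∈ P, lab i ∈ choices (x.part i) x.alphabet) ∧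
      I ⊆ Finset.range (2 ^ x.parts) ∧ I.card = 2 ^ (S.card - P.card) ∧
      ∀ p ∈ I, ∀ pl ∈ x.tests coins p, ∀ ee ∈ pl, ∀ i ∈ P, ∀ vl ∈ lab i,
        ∀ i' ∈ P, ∀ vl' ∈ lab i', ee.1.1 = vl.1 → ee.2.1 = vl'.1 →
          ee.1.2.2.1.getD vl.2 0 = ee.2.2.2.1.getD vl'.2 0 := by
  classical
  rcases S.eq_empty_or_nonempty with rfl | ⟨s₀, hs₀⟩
  · exact ⟨∅, fun _ => [], {0}, by simp, by simp, by simp, by simp, by simp, by simp⟩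
  have : Nonempty (Fin x.elements.length) := ⟨s₀⟩
  set P : Finset ℕ := (Finset.range x.parts).filter
    fun i => ∃ s ∈ S, x.elements[s].1 = x.parts + i with hP
  have hbase : ∀ i ∈ P, ∃ s ∈ S, x.elements[s].1 = x.parts + i :=
    fun i hi => (Finset.mem_filter.1 hi).2
  -- One base element for each part that occurs in `S`; its labelling is the one that is shown to
  -- pass tests.
  choose! base hbS hb1 using hbase
  have hlab : ∀ i ∈ P, x.elements[base i].2 ∈ choices (x.part i) x.alphabet :=
    fun i hi => mem_choices_of_fst_eq (List.getElem_mem _) (hb1 i hi)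
  have hinj : Set.InjOn base P := by
    intro i hi j hj hij
    have h1 := hb1 i hi
    have h2 := hb1 j hj
    rw [hij] at h1
    omega
  have hsub : P.image base ⊆ S := Finset.image_subset_iff.2 hbS
  have hcard : (S \ P.image base).card = S.card - P.card := by
    rw [Finset.card_sdiff_of_subset hsub, Finset.card_image_of_injOn hinj]
  have hex := fun (B : Finset (Fin x.elements.length)) (hB : B ⊆ S \ P.image base) =>
    exists_of_shatters hS (Finset.union_subset hsub (hB.trans Finset.sdiff_subset))
  choose! p hp J hJ σ hσ hmem using hex
  -- Equal selection numbers mean equal tests. Membership of a selection element depends on the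
  -- number alone. For an element of part `i`, the base element lies in both concepts: hence both
  -- contain the part, and both give the same label to every test that touches it.
  have hkey : ∀ B ⊆ S \ P.image base, ∀ B' ⊆ S \ P.image base, p B = p B' → B ⊆ B' := by
    intro B hB B' hB' hpp s hs
    obtain ⟨hsS, hsb⟩ := Finset.mem_sdiff.1 (hB hs)
    suffices h : inConcept (x.selections.getD (p B') [] ++ J B', σ B') x.elements[s] = true by
      exact (Finset.mem_union.1 ((hmem B' hB' s hsS).1 h)).resolve_left hsb
    have h1 := (hmem B hB s hsS).2 (Finset.mem_union_right _ hs)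
    rw [inConcept, Bool.and_eq_true] at h1 ⊢
    rcases mem_elements.1 (List.getElem_mem s.2) with ⟨h2, h3⟩ | ⟨i, hi, h2, h3⟩
    · refine ⟨?_, by rw [show x.elements[s].2 = [] from h3]; exact consistent_nil _⟩
      obtain ⟨ib, hib, h4⟩ := List.any_eq_true.1 h1.1
      refine List.any_eq_true.2 ⟨ib, ?_, h4⟩
      rcases List.mem_append.1 hib with h5 | h5
      · exact List.mem_append_left _ (hpp ▸ h5)
      · exfalso
        have h6 := le_fst_of_mem_partSet (hJ B hB) h5
        rw [Bool.and_eq_true, beq_iff_eq] at h4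
        have h7 : x.elements[s].1 < x.parts := h2
        omega
    · have h2' : x.elements[s].1 = x.parts + i := h2
      have hiP : i ∈ P := Finset.mem_filter.2 ⟨Finset.mem_range.2 hi, s, hsS, h2⟩
      have hbi : base i ∈ P.image base := Finset.mem_image_of_mem _ hiP
      have h4 := (hmem B hB _ (hbS i hiP)).2 (Finset.mem_union_left _ hbi)
      have h5 := (hmem B' hB' _ (hbS i hiP)).2 (Finset.mem_union_left _ hbi)
      rw [inConcept, Bool.and_eq_true] at h4 h5
      refine ⟨?_, consistent_of_consistent ?_ ?_ h4.2 h5.2 h1.2⟩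
      · have h6 := h5.1
        rw [hb1 i hiP] at h6
        rw [h2']
        exact h6
      · rw [(mem_choices.1 (hσ B hB)).1, (mem_choices.1 (hσ B' hB')).1, hpp]
      · rw [(mem_choices.1 (hlab i hiP)).1]
        exact (mem_choices.1 h3).1.symm
  refine ⟨P, fun i => x.elements[base i].2, (S \ P.image base).powerset.image p,
    Finset.filter_subset _ _, ?_, hlab, ?_, ?_, ?_⟩
  · rw [← Finset.card_image_of_injOn hinj]
    exact Finset.card_le_card hsub
  · refine Finset.image_subset_iff.2 fun B hB => Finset.mem_range.2 (hp B (Finset.mem_powerset.1 hB))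
  · rw [Finset.card_image_of_injOn, Finset.card_powerset, hcard]
    intro B hB B' hB' h
    have hB := Finset.mem_powerset.1 hB
    have hB' := Finset.mem_powerset.1 hB'
    exact (hkey B hB B' hB' h).antisymm (hkey B' hB' B hB h.symm)
  · intro q hq pl hpl ee hee i hi vl hvl i' hi' vl' hvl' h1 h2
    obtain ⟨B, hB, rfl⟩ := Finset.mem_image.1 hq
    have hB := Finset.mem_powerset.1 hB
    have h3 : pl ∈ (σ B).map Prod.fst := by
      rw [(mem_choices.1 (hσ B hB)).1]; exact List.mem_reverse.2 hpl
    obtain ⟨ps, hps, rfl⟩ := List.mem_map.1 h3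
    have hcons : ∀ i ∈ P, consistent (σ B) x.elements[base i].2 = true := by
      intro i hi
      have h4 := (hmem B hB _ (hbS i hi)).2
        (Finset.mem_union_left _ (Finset.mem_image_of_mem _ hi))
      rw [inConcept, Bool.and_eq_true] at h4
      exact h4.2
    -- Both projections equal the label that the concept assigns to the test.
    rw [(consistent_iff.1 (hcons i hi) ps hps ee hee vl hvl).1 h1,
      (consistent_iff.1 (hcons i' hi') ps hps ee hee vl' hvl').2 h2]

end RawInput

namespace LabelCover

variable (L : LabelCover)

/-! ### Instances as inputs of the program -/

/-- An edge as it is given to the program. -/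
def rawEdge (e : Fin L.a × Fin L.b) : RawEdge :=
  (e.1.val, e.2.val, (List.finRange L.k).map fun s => (L.proj e s).val, ())

/-- The edges in lexicographic order. -/
def edgeList : List (Fin L.a × Fin L.b) :=
  ((List.finRange L.a).product (List.finRange L.b)).filter fun e => decide (e ∈ L.E)

/-- The input of the program. -/
def raw (q : ℕ) : RawInput := (q, L.a, L.b, L.k, L.edgeList.map L.rawEdge, ())

/-- The trailing units in `RawInput` and `RawEdge` play the role of the `nil` that ends a list, so
tuples and lists give the same tree. -/
theorem enc_raw (q : ℕ) : enc (L.raw q) = L.encode q := by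
  have h : enc (L.edgeList.map L.rawEdge) = Datum.ofList (L.edgeList.map fun e =>
          Datum.ofList [Datum.ofNat e.1.val, Datum.ofNat e.2.val,
            Datum.ofList ((List.finRange L.k).map fun s => Datum.ofNat (L.proj e s).val)]) := by
    change Datum.ofList _ = _
    rw [List.map_map]
    congr 1
    refine List.map_congr_left fun e _ => ?_
    simp only [Function.comp_apply, rawEdge, enc_pair, Datum.ofList]
    congr 3
    change Datum.ofList _ = _
    rw [List.map_map]
    rfl
  simp only [raw, enc_pair, h]
  rfl

variable {L}

theorem mem_edgeList {e : Fin L.a × Fin L.b} : e ∈ L.edgeList ↔ e ∈ L.E := by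
  rw [edgeList, List.mem_filter, decide_eq_true_iff]
  exact and_iff_right (List.mem_product.2 ⟨List.mem_finRange _, List.mem_finRange _⟩)

theorem nodup_edgeList : L.edgeList.Nodup :=
  ((List.nodup_finRange _).product (List.nodup_finRange _)).filter _

theorem length_edgeList : L.edgeList.length = L.E.card := by
  rw [← List.toFinset_card_of_nodup nodup_edgeList]
  congr 1
  ext e
  rw [List.mem_toFinset, mem_edgeList]

theorem rawEdge_table (e : Fin L.a × Fin L.b) (s : Fin L.k) :
    (L.rawEdge e).2.2.1.getD s 0 = L.proj e s := by
  simp [rawEdge]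

variable (L) in
/-- Pairs of edges with a common right end. -/
def pairList : List ((Fin L.a × Fin L.b) × (Fin L.a × Fin L.b)) :=
  L.edgeList.flatMap fun e => (L.edgeList.filter fun e' => decide (e'.2 = e.2)).map fun e' => (e, e')

theorem mem_pairList {p : (Fin L.a × Fin L.b) × (Fin L.a × Fin L.b)} :
    p ∈ L.pairList ↔ p.1 ∈ L.E ∧ p.2 ∈ L.E ∧ p.1.2 = p.2.2 := by
  simp only [pairList, List.mem_flatMap, List.mem_map, List.mem_filter, mem_edgeList,
    decide_eq_true_iff]
  constructor
  · rintro ⟨e, he, e', ⟨he', h⟩, rfl⟩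
    exact ⟨he, he', h.symm⟩
  · rintro ⟨h1, h2, h3⟩
    exact ⟨p.1, h1, p.2, ⟨h2, h3.symm⟩, rfl⟩

theorem edgePairs_raw (q : ℕ) :
    (L.raw q).edgePairs = L.pairList.map fun p => (L.rawEdge p.1, L.rawEdge p.2) := by
  simp only [RawInput.edgePairs, raw, pairList, List.flatMap_map, List.map_flatMap, List.filter_map,
    List.map_map]
  congr 1
  funext e
  have h : ((fun e' : RawEdge => e'.2.1 == (L.rawEdge e).2.1) ∘ L.rawEdge) =
      fun e' => decide (e'.2 = e.2) := by
    funext e'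
    rw [Bool.eq_iff_iff]
    simp [rawEdge, Fin.ext_iff]
  rw [h]
  rfl

theorem length_pairList {dB : ℕ}
    (hB : ∀ j : Fin L.b, (L.E.filter fun e => e.2 = j).card = dB) :
    L.pairList.length = L.E.card * dB := by
  have h : ∀ e : Fin L.a × Fin L.b,
      (L.edgeList.filter fun e' => decide (e'.2 = e.2)).length = dB := by
    intro e
    rw [← hB e.2, ← List.toFinset_card_of_nodup (nodup_edgeList.filter _)]
    congr 1
    ext e'
    simp [mem_edgeList]
  rw [pairList, List.length_flatMap]
  simp [h, length_edgeList]

theorem mem_pick {q : ℕ} {coins : List Bool} {p t : ℕ} {ee : RawEdge × RawEdge}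
    (h : ee ∈ (L.raw q).pick coins p t) : ∃ e e', e ∈ L.E ∧ e' ∈ L.E ∧ e.2 = e'.2 ∧
      ee = (L.rawEdge e, L.rawEdge e') := by
  have h1 := List.mem_of_mem_drop (List.mem_of_mem_take h)
  rw [edgePairs_raw, List.mem_map] at h1
  obtain ⟨x, hx, rfl⟩ := h1
  obtain ⟨h2, h3, h4⟩ := mem_pairList.1 hx
  exact ⟨_, _, h2, h3, h4, rfl⟩

/-! ### Completeness -/

/-- The shattered set consists of the selection elements and of the restrictions of a satisfying
assignment to the parts. Selection and set of parts can be prescribed freely, and labelling each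
test by the assigned label of its right end makes all restrictions consistent. -/
theorem two_parts_le_vcDim (hL : L.Satisfiable) (hE : L.E.Nonempty) (q : ℕ) (coins : List Bool) :
    2 * (L.raw q).parts ≤ ((L.raw q).conceptClass coins).concepts.vcDim := by
  classical
  obtain ⟨φ, hφ⟩ := hL
  obtain ⟨e₀, he₀⟩ := hE
  have ha : 0 < L.a := e₀.1.pos
  set x := L.raw q with hx
  set lab : ℕ → ℕ := fun v => if h : v < L.a then (φ (Sum.inl ⟨v, h⟩)).val else 0 with hlab
  set labB : ℕ → ℕ := fun v => if h : v < L.b then (φ (Sum.inr ⟨v, h⟩)).val else 0 with hlabB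
  have hk : 0 < L.k := (φ (Sum.inl e₀.1)).pos
  have hlabk : ∀ v, lab v ∈ x.alphabet := by
    intro v
    refine List.mem_range.2 ?_
    change lab v < L.k
    simp only [hlab]
    split
    · exact Fin.is_lt _
    · exact hk
  have hlabBk : ∀ v, labB v ∈ x.alphabet := by
    intro v
    refine List.mem_range.2 ?_
    change labB v < L.k
    simp only [hlabB]
    split
    · exact Fin.is_lt _
    · exact hk
  set el : ℕ → ℕ × List (ℕ × ℕ) := fun j => (j, if j < x.parts then [] else
    (x.part (j - x.parts)).reverse.map fun v => (v, lab v)) with hel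
  have hmemel : ∀ j < 2 * x.parts, el j ∈ x.elements := by
    intro j hj
    rw [RawInput.mem_elements]
    by_cases h : j < x.parts
    · exact Or.inl ⟨h, by simp [hel, h]⟩
    · refine Or.inr ⟨j - x.parts, by omega, by simp only [hel]; omega, ?_⟩
      simp only [hel, h, if_false]
      refine mem_choices.2 ⟨by simp [Function.comp_def], fun p hp => ?_⟩
      obtain ⟨v, -, rfl⟩ := List.mem_map.1 hp
      exact hlabk v
  have hidx : ∀ j : Fin (2 * x.parts), ∃ i : Fin x.elements.length, x.elements[i] = el j := by
    intro j
    obtain ⟨i, hi, h⟩ := List.getElem_of_mem (hmemel j j.2)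
    exact ⟨⟨i, hi⟩, h⟩
  choose idx hidx using hidx
  -- An empty test takes its label from a default pair; it imposes no condition, so any letter will
  -- do.
  have hcons : ∀ p t, ∀ j, consistent
      [((x.pick coins p t), labB (((x.pick coins p t).headD ((0, 0, [], ()), (0, 0, [], ()))).1.2.1))]
      (el j).2 = true := by
    intro p t j
    rw [consistent_iff]
    intro ps hps ee hee vl hvl
    rw [List.mem_singleton] at hps
    subst hps
    simp only at hee ⊢
    have hhead : (x.pick coins p t).headD ((0, 0, [], ()), (0, 0, [], ())) = ee := by
      have hlen : (x.pick coins p t).length ≤ 1 := by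
        simp [RawInput.pick]
      match hpk : x.pick coins p t, hee, hlen with
      | [y], hee, _ => simpa using (List.mem_singleton.1 hee).symm
      | y :: z :: l, _, h => simp at h
    rw [hhead]
    obtain ⟨e, e', he, he', hee', rfl⟩ := mem_pick hee
    have hvl2 : vl.2 = lab vl.1 := by
      by_cases h : j < x.parts
      · simp [hel, h] at hvl
      · simp only [hel, h, if_false] at hvl
        obtain ⟨v, -, rfl⟩ := List.mem_map.1 hvl
        rfl
    have hgood : ∀ e ∈ L.E, (L.rawEdge e).1 = vl.1 →
        (L.rawEdge e).2.2.1.getD vl.2 0 = labB e.2.val := by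
      intro e he h
      have h1 : lab vl.1 = (φ (Sum.inl e.1)).val := by
        rw [← h]; simp [hlab, rawEdge]
      rw [hvl2, h1, rawEdge_table, hφ e he]
      simp [hlabB]
    exact ⟨hgood e he, fun h => by
      have := hgood e' he' h
      rw [← hee'] at this
      exact this⟩
  have hconcept : ∀ A : Finset ℕ, ∃ c ∈ x.concepts coins, ∀ j < 2 * x.parts,
      inConcept c (el j) = true ↔ j ∈ A := by
    intro A
    set I : List (ℕ × Bool) := (List.range x.parts).reverse.map fun i => (i, decide (i ∈ A)) with hI
    set J : List (ℕ × Bool) := ((List.range x.parts).map fun i => x.parts + i).reverse.map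
      fun i => (i, decide (i ∈ A)) with hJ
    have hIm : I ∈ x.selections := mem_choices.2 ⟨by simp [hI, Function.comp_def], fun p _ => by
      cases p.2 <;> simp⟩
    have hJm : J ∈ x.partSets := mem_choices.2 ⟨by simp [hJ, Function.comp_def], fun p _ => by
      cases p.2 <;> simp⟩
    obtain ⟨p, hp, hpI⟩ := List.getElem_of_mem hIm
    set σ : List (EdgeTest × ℕ) := (x.tests coins p).reverse.map
      fun pl => (pl, labB ((pl.headD ((0, 0, [], ()), (0, 0, [], ()))).1.2.1)) with hσ
    have hσm : σ ∈ choices (x.tests coins p) x.alphabet :=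
      mem_choices.2 ⟨by simp [hσ, Function.comp_def], fun ps hps => by
        obtain ⟨pl, -, rfl⟩ := List.mem_map.1 hps
        exact hlabBk _⟩
    refine ⟨(I ++ J, σ), RawInput.mem_concepts.2 ⟨p, by rwa [← RawInput.length_selections], J, hJm,
      hσm, by rw [List.getD_eq_getElem _ _ hp, hpI]⟩, fun j hj => ?_⟩
    have hσc : consistent σ (el j).2 = true := by
      rw [consistent_iff]
      intro ps hps
      obtain ⟨pl, hpl, rfl⟩ := List.mem_map.1 hps
      obtain ⟨t, -, rfl⟩ := List.mem_map.1 (List.mem_reverse.1 hpl)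
      exact consistent_iff.1 (hcons p t j) _ (List.mem_singleton.2 rfl)
    rw [inConcept, hσc, Bool.and_true, List.any_eq_true]
    constructor
    · rintro ⟨ib, hib, h⟩
      rw [Bool.and_eq_true, beq_iff_eq] at h
      have hj' : ib.1 = j := h.1
      rw [← hj']
      rcases List.mem_append.1 hib with h1 | h1
      · obtain ⟨i, -, rfl⟩ := List.mem_map.1 h1
        simpa using h.2
      · obtain ⟨i, -, rfl⟩ := List.mem_map.1 h1
        simpa using h.2
    · intro hjA
      refine ⟨(j, true), ?_, by simp [hel]⟩
      by_cases h : j < x.parts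
      · exact List.mem_append_left _ (List.mem_map.2 ⟨j, by simpa using h, by simp [hjA]⟩)
      · refine List.mem_append_right _ (List.mem_map.2 ⟨j, ?_, by simp [hjA]⟩)
        rw [List.mem_reverse, List.mem_map]
        exact ⟨j - x.parts, List.mem_range.2 (by omega), by omega⟩
  -- A concept that picks out a single element keeps its position apart from the others.
  have hinj : Function.Injective idx := by
    intro j j' h
    obtain ⟨c, -, hc⟩ := hconcept {j.val}
    have h1 := (hc j j.2).2 (Finset.mem_singleton_self _)
    rw [← hidx j, h, hidx j', hc j' j'.2, Finset.mem_singleton] at h1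
    exact Fin.ext h1.symm
  have hcard : (Finset.univ.image idx).card = 2 * x.parts := by
    rw [Finset.card_image_of_injective _ hinj, Finset.card_univ, Fintype.card_fin]
  rw [← hcard]
  refine Finset.Shatters.card_le_vcDim (α := Fin x.elements.length) fun T hT => ?_
  obtain ⟨c, hc, hcA⟩ := hconcept ((Finset.univ.filter fun j => idx j ∈ T).image Fin.val)
  refine ⟨Finset.univ.filter fun i : Fin x.elements.length => inConcept c x.elements[i] = true,
    RawInput.mem_conceptClass.2 ⟨c, hc, fun i => by simp⟩, ?_⟩
  ext i
  rw [Finset.mem_inter]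
  have hmain : ∀ j, inConcept c x.elements[idx j] = true ↔ idx j ∈ T := by
    intro j
    rw [hidx, hcA j j.2]
    simp only [Finset.mem_image, Finset.mem_filter, Finset.mem_univ, true_and]
    constructor
    · rintro ⟨j', h1, h2⟩
      rwa [← Fin.ext h2]
    · exact fun h => ⟨j, h, rfl⟩
  constructor
  · rintro ⟨h1, h2⟩
    obtain ⟨j, -, rfl⟩ := Finset.mem_image.1 h1
    exact (hmain j).1 (Finset.mem_filter.1 h2).2
  · intro h
    have h1 := hT h
    obtain ⟨j, -, rfl⟩ := Finset.mem_image.1 h1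
    exact ⟨h1, Finset.mem_filter.2 ⟨Finset.mem_univ _, (hmain j).2 h⟩⟩

end LabelCover

namespace LabelCover

variable {L : LabelCover}

/-! ### Soundness -/

/-- The left vertices in a union of parts. -/
def covered (L : LabelCover) (q : ℕ) (P : Finset ℕ) : Finset (Fin L.a) :=
  Finset.univ.filter fun v => ∃ i ∈ P, v.val ∈ (L.raw q).part i

/-- Write `m` for the size of a part. The `|P| * m` slots are integers below `R * m`, and reduction
modulo `a` is at most `R * m / a + 1` to one on them. As `a ≤ R * m`, this is at most `2 * R * m /
a`, whence the factor two. -/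
theorem card_mul_le_card_covered {q : ℕ} {P : Finset ℕ} (ha : 0 < L.a)
    (hR : 0 < (L.raw q).parts) (hP : P ⊆ Finset.range (L.raw q).parts) :
    P.card * L.a ≤ 2 * (L.raw q).parts * (L.covered q P).card := by
  classical
  set R := (L.raw q).parts with hRdef
  set m := (L.raw q).partSize with hm
  have hm0 : 0 < m := Nat.succ_pos _
  have haRm : L.a ≤ R * m := by
    have h1 : (L.raw q).verts < R * ((L.raw q).verts / R + 1) := Nat.lt_mul_div_succ _ hR
    have h2 : L.a ≤ (L.raw q).verts := Nat.le_add_right _ _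
    exact h2.trans h1.le
  set U : Finset ℕ := P.biUnion fun i => (Finset.range m).image fun l => i * m + l with hU
  have hUcard : U.card = P.card * m := by
    rw [hU, Finset.card_biUnion]
    · rw [Finset.sum_congr rfl fun i _ => by
        rw [Finset.card_image_of_injective _ (add_right_injective (i * m)), Finset.card_range]]
      simp
    · intro i _ j _ hij
      rw [Function.onFun, Finset.disjoint_left]
      intro u hu hu'
      obtain ⟨l, hl, rfl⟩ := Finset.mem_image.1 hu
      obtain ⟨l', hl', h⟩ := Finset.mem_image.1 hu'
      rw [Finset.mem_range] at hl hl'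
      apply hij
      have h1 : (i * m + l) / m = i := by
        rw [mul_comm, Nat.mul_add_div hm0, Nat.div_eq_of_lt hl, add_zero]
      have h2 : (j * m + l') / m = j := by
        rw [mul_comm, Nat.mul_add_div hm0, Nat.div_eq_of_lt hl', add_zero]
      rw [← h1, ← h2, h]
  have hUlt : ∀ u ∈ U, u < R * m := by
    intro u hu
    obtain ⟨i, hi, hu⟩ := Finset.mem_biUnion.1 hu
    obtain ⟨l, hl, rfl⟩ := Finset.mem_image.1 hu
    have h1 : i + 1 ≤ R := Finset.mem_range.1 (hP hi)
    have h2 := Nat.mul_le_mul_right m h1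
    have := Finset.mem_range.1 hl
    rw [Nat.succ_mul] at h2
    omega
  have hfib : U.card ≤ (R * m / L.a + 1) * (L.covered q P).card := by
    refine Finset.card_le_mul_card_image_of_maps_to
      (f := fun u => (⟨u % L.a, Nat.mod_lt _ ha⟩ : Fin L.a)) ?_ _ ?_
    · intro u hu
      obtain ⟨i, hi, hu⟩ := Finset.mem_biUnion.1 hu
      obtain ⟨l, hl, rfl⟩ := Finset.mem_image.1 hu
      refine Finset.mem_filter.2 ⟨Finset.mem_univ _, i, hi, ?_⟩
      exact List.mem_map.2 ⟨l, List.mem_range.2 (Finset.mem_range.1 hl), rfl⟩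
    · intro v _
      rw [← Finset.card_range (R * m / L.a + 1)]
      refine Finset.card_le_card_of_injOn (fun u => u / L.a) ?_ ?_
      · intro u hu
        have h1 := hUlt u (Finset.mem_filter.1 hu).1
        simp only [Finset.coe_range, Set.mem_Iio]
        exact Nat.lt_succ_of_le (Nat.div_le_div_right h1.le)
      · intro u hu u' hu' h
        have h1 := congrArg Fin.val (Finset.mem_filter.1 hu).2
        have h2 := congrArg Fin.val (Finset.mem_filter.1 hu').2
        simp only at h h1 h2
        rw [← Nat.div_add_mod u L.a, ← Nat.div_add_mod u' L.a, h, h1, h2]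
  have h1 : P.card * m * L.a ≤ (R * m / L.a + 1) * L.a * (L.covered q P).card := by
    rw [← hUcard, mul_right_comm]
    exact Nat.mul_le_mul_right _ hfib
  have h2 : (R * m / L.a + 1) * L.a ≤ 2 * (R * m) := by
    have := Nat.div_mul_le_self (R * m) L.a
    rw [Nat.succ_mul]
    omega
  refine Nat.le_of_mul_le_mul_right (c := m) ?_ hm0
  calc P.card * L.a * m = P.card * m * L.a := by ring
    _ ≤ _ := h1
    _ ≤ 2 * (R * m) * (L.covered q P).card := Nat.mul_le_mul_right _ h2
    _ = _ := by ring

/-- The positions of inconsistent pairs in the list of pairs. -/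
noncomputable def badPositions (L : LabelCover) (q : ℕ) (f : Finset (Fin L.a) × (Fin L.a → Fin L.k)) :
    Finset ℕ :=
  open Classical in
  (Finset.range (2 ^ (L.raw q).bits)).filter fun i => ∃ p ∈ L.badPairs f.1 f.2, L.pairList[i]? = some p

theorem length_pairList_le (q : ℕ) : L.pairList.length ≤ 2 ^ (L.raw q).bits := by
  have := le_pow_expSearch le_rfl (L.raw q).edgePairs.length
  rw [RawInput.bits]
  refine le_trans (le_of_eq ?_) this
  rw [edgePairs_raw, List.length_map]

theorem card_badPairs_le (q : ℕ) (f : Finset (Fin L.a) × (Fin L.a → Fin L.k)) :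
    (L.badPairs f.1 f.2).card ≤ (L.badPositions q f).card := by
  classical
  have h : ∀ p ∈ L.badPairs f.1 f.2, ∃ i < L.pairList.length, L.pairList[i]? = some p := by
    intro p hp
    obtain ⟨h1, h2, -⟩ := Finset.mem_filter.1 hp
    obtain ⟨h3, h4⟩ := Finset.mem_product.1 h1
    obtain ⟨i, hi, h⟩ := List.getElem_of_mem (mem_pairList.2 ⟨h3, h4, h2⟩)
    exact ⟨i, hi, by rw [List.getElem?_eq_getElem hi, h]⟩
  choose! pos hlt hpos using h
  refine Finset.card_le_card_of_injOn pos ?_ ?_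
  · intro p hp
    exact Finset.mem_filter.2 ⟨Finset.mem_range.2 ((hlt p hp).trans_le (length_pairList_le q)),
      p, hp, hpos p hp⟩
  · intro p hp p' hp' h
    have h1 := hpos p hp
    rw [h, hpos p' hp'] at h1
    exact (Option.some.inj h1).symm

/-- Minimality of `bits`: padding the list of pairs to a power of two at most doubles it, which
costs a factor two in the density of violated tests. -/
theorem two_pow_bits_le (q : ℕ) (h : 0 < L.pairList.length) :
    2 ^ (L.raw q).bits ≤ 2 * L.pairList.length := by
  have hl : (L.raw q).edgePairs.length = L.pairList.length := by
    rw [edgePairs_raw, List.length_map]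
  rw [RawInput.bits, hl]
  by_cases h0 : expSearch 2 L.pairList.length = 0
  · rw [h0]; omega
  · have h1 := pow_pred_expSearch_lt h0
    obtain ⟨j, hj⟩ := Nat.exists_eq_succ_of_ne_zero h0
    rw [hj] at h1 ⊢
    rw [Nat.succ_sub_one] at h1
    rw [pow_succ]; omega

theorem coinList_getD (ω : ℕ → Bool) (M i : ℕ) (h : i < M) : (coinList ω M).getD i false = ω i := by
  simp [coinList, h]

theorem pick_coinList {q : ℕ} (ω : ℕ → Bool) {p t : ℕ} (hp : p < 2 ^ (L.raw q).parts)
    (ht : t < (L.raw q).rounds) :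
    (L.raw q).pick (coinList ω (L.raw q).coinCount) p t = (((L.raw q).edgePairs).drop
      (binary (fun l => ω ((p * (L.raw q).rounds + t) * (L.raw q).bits + l)) (L.raw q).bits)).take
        1 := by
  rw [RawInput.pick]
  congr 2
  refine binary_congr fun l hl => coinList_getD _ _ _ ?_
  rw [RawInput.coinCount]
  have h1 : p * (L.raw q).rounds + t + 1 ≤ 2 ^ (L.raw q).parts * (L.raw q).rounds := by
    have := Nat.mul_le_mul_right (L.raw q).rounds (Nat.succ_le_of_lt hp)
    rw [Nat.succ_mul] at this; omega
  have h2 := Nat.mul_le_mul_right (L.raw q).bits h1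
  rw [Nat.succ_mul] at h2; omega

/-- The event that a labelling of a large set of left vertices passes the tests of many
selections. -/
def PassEvent (L : LabelCover) (q : ℕ) (ρ : ℝ) (N : ℕ) (ω : ℕ → Bool) : Prop :=
  ∃ f : Finset (Fin L.a) × (Fin L.a → Fin L.k), ρ * L.a ≤ f.1.card ∧
    ∃ I ⊆ Finset.range (2 ^ (L.raw q).parts), I.card = N ∧ ∀ p ∈ I, ∀ t < (L.raw q).rounds,
      binary (fun l => ω ((p * (L.raw q).rounds + t) * (L.raw q).bits + l)) (L.raw q).bits ∉
        L.badPositions q f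

/-- A shattered set with at least `R + T` elements yields `2 ^ (|S| - |P|)` passed selections. There
are only `2 ^ R` selections, hence `T ≤ |P|` and the covered set is large; and `|P| ≤ R` leaves at
least `2 ^ T` of them. -/
theorem passEvent_of_shatters {q : ℕ} {ρ : ℝ} {T : ℕ} (ha : 0 < L.a) (hk : 0 < L.k)
    (hR : 0 < (L.raw q).parts) (hρ : ρ * (2 * (L.raw q).parts) ≤ T) {ω : ℕ → Bool}
    (h : (L.raw q).parts + T ≤
      ((L.raw q).conceptClass (coinList ω (L.raw q).coinCount)).concepts.vcDim) :
    L.PassEvent q ρ (2 ^ T) ω := by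
  classical
  set x := L.raw q with hx
  set coins := coinList ω x.coinCount with hcoins
  obtain ⟨S, hS, hST⟩ : ∃ S : Finset (Fin x.elements.length),
      (x.conceptClass coins).concepts.Shatters S ∧ x.parts + T ≤ S.card := by
    rw [Finset.vcDim] at h
    have hne : (x.conceptClass coins).concepts.shatterer.Nonempty := by
      by_contra hemp
      rw [Finset.not_nonempty_iff_eq_empty] at hemp
      rw [hemp, Finset.sup_empty] at h
      simp only [Nat.bot_eq_zero] at h
      omega
    obtain ⟨S, hS, hsup⟩ := Finset.exists_mem_eq_sup _ hne Finset.card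
    exact ⟨S, Finset.mem_shatterer.1 hS, h.trans hsup.le⟩
  obtain ⟨P, lab, I, hP, hPS, hlab, hI, hIcard, hpass⟩ := RawInput.exists_passed_of_shatters hS
  have hPR : P.card ≤ x.parts := by simpa using Finset.card_le_card hP
  have hIR : S.card - P.card ≤ x.parts := by
    have := Finset.card_le_card hI
    rw [hIcard, Finset.card_range] at this
    exact (Nat.pow_le_pow_iff_right (by norm_num)).1 this
  have hTP : T ≤ P.card := by omega
  obtain ⟨I', hI', hI'card⟩ := Finset.exists_subset_card_eq (s := I) (n := 2 ^ T) (by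
    rw [hIcard]; exact Nat.pow_le_pow_right (by norm_num) (by omega))
  have hcov := card_mul_le_card_covered ha hR hP
  -- A vertex that fills several slots may carry several labels. Any of them can be chosen, because
  -- the tests are passed for every pair of occurrences.
  have hf : ∀ v : Fin L.a, ∃ l : Fin L.k, v ∈ L.covered q P → ∃ i ∈ P, (v.val, l.val) ∈ lab i := by
    intro v
    by_cases hv : v ∈ L.covered q P
    · obtain ⟨-, i, hi, hvi⟩ := Finset.mem_filter.1 hv
      obtain ⟨h1, h2⟩ := mem_choices.1 (hlab i hi)
      have h3 : v.val ∈ (lab i).map Prod.fst := by rw [h1]; exact List.mem_reverse.2 hvi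
      obtain ⟨vl, hvl, h4⟩ := List.mem_map.1 h3
      have h5 : vl.2 < L.k := List.mem_range.1 (h2 vl hvl)
      exact ⟨⟨vl.2, h5⟩, fun _ => ⟨i, hi, by rw [← h4]; exact hvl⟩⟩
    · exact ⟨⟨0, hk⟩, fun h => absurd h hv⟩
  choose f hf using hf
  refine ⟨(L.covered q P, f), ?_, I', hI'.trans hI, hI'card, fun p hp t ht hbad => ?_⟩
  · have hRpos : (0 : ℝ) < 2 * x.parts := by positivity
    have h1 : (P.card : ℝ) * L.a ≤ 2 * x.parts * (L.covered q P).card := by exact_mod_cast hcov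
    have h2 : (T : ℝ) ≤ P.card := by exact_mod_cast hTP
    have h3 : ρ * (2 * x.parts) * L.a ≤ P.card * L.a := by
      have : ρ * (2 * x.parts) ≤ P.card := hρ.trans h2
      gcongr
    refine le_of_mul_le_mul_left (a := 2 * (x.parts : ℝ)) ?_ hRpos
    calc 2 * (x.parts : ℝ) * (ρ * L.a) = ρ * (2 * x.parts) * L.a := by ring
      _ ≤ _ := h3.trans h1
  · obtain ⟨-, b, hb, hbi⟩ := Finset.mem_filter.1 hbad
    obtain ⟨-, h2, h3, h4, h5⟩ := Finset.mem_filter.1 hb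
    have hpR : p < 2 ^ x.parts := Finset.mem_range.1 (hI (hI' hp))
    have hpick : (L.rawEdge b.1, L.rawEdge b.2) ∈ x.pick coins p t := by
      rw [pick_coinList ω hpR ht, edgePairs_raw]
      refine List.mem_of_mem_head? ?_
      rw [List.head?_take, List.head?_drop]
      simp [List.getElem?_map, hbi]
    obtain ⟨i, hi, hil⟩ := hf b.1.1 h3
    obtain ⟨i', hi', hil'⟩ := hf b.2.1 h4
    have := hpass p (hI' hp) _ (List.mem_map.2 ⟨t, List.mem_range.2 ht, rfl⟩) _ hpick i hi _ hil
      i' hi' _ hil' rfl rfl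
    rw [rawEdge_table, rawEdge_table] at this
    exact h5 (Fin.ext this)

/-- The adversaries are the pairs of a set and a labelling. A share `ρ ^ 2 - val` of the pairs is
violated, hence at least half of this share among the padded positions. -/
theorem coinMeasure_passEvent_le {dA dB : ℕ}
    (hA : ∀ i : Fin L.a, (L.E.filter fun e => e.1 = i).card = dA)
    (hB : ∀ j : Fin L.b, (L.E.filter fun e => e.2 = j).card = dB)
    (hk : 0 < L.k) (hE : L.E.Nonempty) (q N : ℕ) {ρ : ℝ} (hρ : 0 ≤ ρ) (hval : L.val ≤ ρ ^ 2) :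
    coinMeasure {ω | L.PassEvent q ρ N ω} ≤ ENNReal.ofReal
      ((2 ^ L.a * L.k ^ L.a : ℕ) * (2 ^ (L.raw q).parts) ^ N *
        ((1 - (ρ ^ 2 - L.val) / 2) ^ (L.raw q).rounds) ^ N) := by
  classical
  have hcard : Fintype.card (Finset (Fin L.a) × (Fin L.a → Fin L.k)) = 2 ^ L.a * L.k ^ L.a := by
    simp
  have hdB : 0 < dB := by
    obtain ⟨e, he⟩ := hE
    rw [← hB e.2]
    exact Finset.card_pos.2 ⟨e, Finset.mem_filter.2 ⟨he, rfl⟩⟩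
  have hlen := length_pairList hB
  have hpos : 0 < L.pairList.length := by rw [hlen]; exact Nat.mul_pos hE.card_pos hdB
  have h := coinMeasure_exists_avoid_le (ι := Finset (Fin L.a) × (Fin L.a → Fin L.k))
    (2 ^ (L.raw q).parts) (L.raw q).rounds (L.raw q).bits N (L.badPositions q)
    (fun f => ρ * L.a ≤ f.1.card) (fun f => Finset.filter_subset _ _)
    (θ := (ρ ^ 2 - L.val) / 2) (fun f hf => ?_)
  · rw [hcard] at h
    push_cast at h ⊢
    exact h
  · have h1 := badPairs_density hA hB hk f.1 f.2 hE hρ hf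
    have h2 : ((L.badPairs f.1 f.2).card : ℝ) ≤ (L.badPositions q f).card := by
      exact_mod_cast card_badPairs_le q f
    have h3 : (2 : ℝ) ^ (L.raw q).bits ≤ 2 * (L.E.card * dB) := by
      have := two_pow_bits_le q hpos
      rw [hlen] at this
      exact_mod_cast this
    have h4 : 0 ≤ (ρ ^ 2 - L.val) / 2 := by linarith
    have h5 := mul_le_mul_of_nonneg_left h3 h4
    linarith

end LabelCover

namespace LabelCover

variable {L : LabelCover}

/-! ### Parameters -/

/-- The number of vertices is large. -/
structure Large (L : LabelCover) : Prop where
  log_ge : 20 ≤ Real.logb 2 L.n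
  log_le : 50 * Real.logb 2 L.n ≤ √(L.n : ℝ)

namespace Large

variable (h : L.Large)
include h

theorem fifty_le_r : 50 ≤ L.r := by
  have h1 := h.log_ge
  rw [r, le_div_iff₀ (by linarith)]
  exact h.log_le

theorem n_pos : 0 < L.n := by
  rcases Nat.eq_zero_or_pos L.n with h0 | h0
  · have := h.log_ge
    rw [h0] at this
    norm_num at this
  · exact h0

theorem two_le_n : 2 ≤ L.n := by
  by_contra h1
  have h2 := h.n_pos
  have h3 : L.n = 1 := by omega
  have := h.log_ge
  rw [h3] at this
  norm_num at this

theorem r_mul_log : L.r * Real.logb 2 L.n = √(L.n : ℝ) := by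
  have h1 := h.log_ge
  rw [r, div_mul_cancel₀]
  linarith

theorem r_le_parts (q : ℕ) : L.r ≤ (L.raw q).parts := by
  have h1 := h.log_ge
  have h2 := le_pow_expSearch h.two_le_n (2 ^ (Nat.sqrt L.n + 1))
  have h3 : √(L.n : ℝ) ≤ (Nat.sqrt L.n + 1 : ℕ) := by
    rw [Real.sqrt_le_left (by positivity)]
    exact_mod_cast (Nat.lt_succ_sqrt' L.n).le
  have h4 : ((Nat.sqrt L.n + 1 : ℕ) : ℝ) ≤ (L.raw q).parts * Real.logb 2 L.n := by
    have h5 : ((2 : ℝ) ^ (Nat.sqrt L.n + 1)) ≤ (L.n : ℝ) ^ (L.raw q).parts := by exact_mod_cast h2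
    have h6 := Real.logb_le_logb_of_le (b := 2) (by norm_num) (by positivity) h5
    rw [Real.logb_pow, Real.logb_pow, Real.logb_self_eq_one (by norm_num), mul_one] at h6
    exact h6
  rw [r, div_le_iff₀ (by linarith)]
  exact h3.trans h4

theorem parts_pos (q : ℕ) : 0 < (L.raw q).parts := by
  have h1 := h.fifty_le_r
  have h2 := h.r_le_parts q
  have : (0 : ℝ) < (L.raw q).parts := by linarith
  exact_mod_cast this

/-- By minimality `(R - 1) log n < √n + 1 = r log n + 1`, and `log n ≥ 1`. -/
theorem parts_lt (q : ℕ) : ((L.raw q).parts : ℝ) < L.r + 2 := by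
  have h1 := h.log_ge
  have h0 : (L.raw q).parts ≠ 0 := (h.parts_pos q).ne'
  have h2 : L.n ^ ((L.raw q).parts - 1) < 2 ^ (Nat.sqrt L.n + 1) := pow_pred_expSearch_lt h0
  have h3 : ((Nat.sqrt L.n + 1 : ℕ) : ℝ) ≤ √(L.n : ℝ) + 1 := by
    push_cast
    have := Real.nat_sqrt_le_real_sqrt (a := L.n)
    linarith
  have h4 : (((L.raw q).parts - 1 : ℕ) : ℝ) * Real.logb 2 L.n < (Nat.sqrt L.n + 1 : ℕ) := by
    have h5 : (L.n : ℝ) ^ ((L.raw q).parts - 1) < (2 : ℝ) ^ (Nat.sqrt L.n + 1) := by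
      exact_mod_cast h2
    have hn : (0 : ℝ) < L.n := by exact_mod_cast h.n_pos
    have h6 := Real.logb_lt_logb (b := 2) (by norm_num) (by positivity) h5
    rw [Real.logb_pow, Real.logb_pow, Real.logb_self_eq_one (by norm_num), mul_one] at h6
    exact h6
  have h5 := h.r_mul_log
  rw [Nat.cast_sub (h.parts_pos q), Nat.cast_one] at h4
  by_contra h6
  rw [not_lt] at h6
  have h7 : (L.r + 1) * Real.logb 2 L.n ≤ ((L.raw q).parts - 1) * Real.logb 2 L.n :=
    mul_le_mul_of_nonneg_right (by linarith) (by linarith)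
  linarith

end Large

theorem val_nonneg (hk : 0 < L.k) : 0 ≤ L.val := by
  refine le_trans ?_ (L.valOf_le_val fun _ => ⟨0, hk⟩)
  unfold valOf
  positivity

/-- Each of the `N` selections contributes a factor 2 for its share of `A`, a factor `2 ^ R` for its
choice and at most `2 ^ (-4R)` for being passed. The product is at most one half. -/
theorem union_bound_le {A p : ℝ} {R N n : ℕ} (hA : A ≤ 2 ^ N) (hp0 : 0 ≤ p)
    (hp : p ≤ (2⁻¹ : ℝ) ^ (4 * R)) (hR : 0 < R) (hn : 0 < n) (hnN : n ≤ N) :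
    A * (2 ^ R) ^ N * p ^ N ≤ 1 / n := by
  have hnR : (0 : ℝ) < n := by exact_mod_cast hn
  have hbase : 2 * (2 : ℝ) ^ R * 2⁻¹ ^ (4 * R) ≤ 2⁻¹ := by
    have h1 : (2 : ℝ) ^ R * 2⁻¹ ^ R = 1 := by rw [← mul_pow]; norm_num
    have h2 : (2⁻¹ : ℝ) ^ R ≤ 2⁻¹ := by
      calc (2⁻¹ : ℝ) ^ R ≤ 2⁻¹ ^ 1 := pow_le_pow_of_le_one (by norm_num) (by norm_num) hR
        _ = 2⁻¹ := pow_one _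
    have h3 : (0 : ℝ) < 2⁻¹ ^ R := by positivity
    calc 2 * (2 : ℝ) ^ R * 2⁻¹ ^ (4 * R)
        = 2 * ((2 : ℝ) ^ R * 2⁻¹ ^ R) * (2⁻¹ ^ R) ^ 3 := by ring
      _ = 2 * (2⁻¹ ^ R) ^ 3 := by rw [h1, mul_one]
      _ ≤ 2 * 2⁻¹ ^ 3 := by gcongr
      _ ≤ 2⁻¹ := by norm_num
  have hlt : (n : ℝ) ≤ 2 ^ n := by exact_mod_cast (Nat.lt_two_pow_self (n := n)).le
  calc A * (2 ^ R) ^ N * p ^ N ≤ 2 ^ N * (2 ^ R) ^ N * ((2⁻¹ : ℝ) ^ (4 * R)) ^ N := by gcongr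
    _ = (2 * (2 ^ R) * (2⁻¹ : ℝ) ^ (4 * R)) ^ N := by rw [mul_pow, mul_pow]
    _ ≤ (2⁻¹ : ℝ) ^ N := pow_le_pow_left₀ (by positivity) hbase _
    _ ≤ (2⁻¹ : ℝ) ^ n := pow_le_pow_of_le_one (by norm_num) (by norm_num) hnN
    _ ≤ 1 / n := by
        rw [inv_pow, ← one_div]
        exact one_div_le_one_div_of_le hnR hlt

/-- A larger dimension would require `2 ^ (R + 1)` passed selections out of `2 ^ R`. The bound holds
for all coins and settles the soundness for `δ ≥ 2`. -/
theorem vcDim_le_two_parts {q : ℕ} (ha : 0 < L.a) (hk : 0 < L.k) (hR : 0 < (L.raw q).parts)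
    (ω : ℕ → Bool) : ((L.raw q).conceptClass (coinList ω
      (L.raw q).coinCount)).concepts.vcDim ≤ 2 * (L.raw q).parts := by
  by_contra h
  obtain ⟨f, -, I, hI, hIc, -⟩ := passEvent_of_shatters (ρ := 0) (T := (L.raw q).parts + 1) (ω := ω)
    ha hk hR (by rw [zero_mul]; positivity) (by omega)
  have h4 := Finset.card_le_card hI
  rw [hIc, Finset.card_range] at h4
  have h5 := (Nat.pow_le_pow_iff_right (a := 2) (by norm_num)).1 h4
  omega

/-- The exponent on the left is `a (1 + log k) ≤ 2 n log k`, because `log k ≥ 1`. -/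
theorem two_pow_mul_pow_le (hk : 2 ≤ L.k) (hlogk : 1 ≤ Real.logb 2 (L.k : ℝ)) {N : ℕ}
    (hN : 250 * (L.n : ℝ) * Real.logb 2 (L.k : ℝ) ≤ N) :
    ((2 ^ L.a * L.k ^ L.a : ℕ) : ℝ) ≤ 2 ^ N := by
  have hk0 : (0 : ℝ) < L.k := by exact_mod_cast (by omega : 0 < L.k)
  have han : (L.a : ℝ) ≤ L.n := by exact_mod_cast (Nat.le_add_right _ _ : L.a ≤ L.n)
  have h1 : (L.k : ℝ) = (2 : ℝ) ^ Real.logb 2 (L.k : ℝ) :=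
    (Real.rpow_logb (by norm_num) (by norm_num) hk0).symm
  have h2 : ((2 ^ L.a * L.k ^ L.a : ℕ) : ℝ) = (2 : ℝ) ^ (L.a + Real.logb 2 (L.k : ℝ) * L.a) := by
    rw [Real.rpow_add (by norm_num), Real.rpow_natCast, Real.rpow_mul (by norm_num), ← h1,
      Real.rpow_natCast]
    push_cast; rfl
  rw [h2, ← Real.rpow_natCast 2 N]
  refine Real.rpow_le_rpow_of_exponent_le (by norm_num) (le_trans ?_ hN)
  have h3 : Real.logb 2 (L.k : ℝ) * L.a ≤ Real.logb 2 (L.k : ℝ) * L.n := by gcongr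
  have h4 : (L.a : ℝ) ≤ Real.logb 2 (L.k : ℝ) * L.n :=
    han.trans (le_mul_of_one_le_left (Nat.cast_nonneg _) hlogk)
  have h5 : 0 ≤ Real.logb 2 (L.k : ℝ) * L.n := by positivity
  linarith

set_option maxHeartbeats 400000 in
theorem coinMeasure_vcDim_gt_le (hL : L.Large) (hreg : L.BiRegular) (hE : L.E.Nonempty)
    (hk : 2 ≤ L.k) {δ : ℝ} (hδ : 0 < δ)
    (hcond : Real.logb 2 (1000 * (L.n : ℝ) * Real.logb 2 (L.k : ℝ)) / L.r ≤ δ)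
    (hval : L.val ≤ δ ^ 2 / 100) :
    coinMeasure {ω | ¬ ((((L.raw ⌈1 / δ⌉₊).conceptClass (coinList ω
      (L.raw ⌈1 / δ⌉₊).coinCount)).concepts.vcDim : ℝ) ≤ (1 + δ) * L.r)} ≤ 1 / (L.n : ℝ≥0∞) := by
  obtain ⟨dA, dB, hA, hB⟩ := hreg
  set q := ⌈1 / δ⌉₊ with hq
  set R := (L.raw q).parts with hRdef
  have hr := hL.fifty_le_r
  have hR1 := hL.r_le_parts q
  have hR2 := hL.parts_lt q
  have hRpos := hL.parts_pos q
  have ha : 0 < L.a := by obtain ⟨e, -⟩ := hE; exact e.1.pos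
  have hk0 : 0 < L.k := by omega
  have hn := hL.n_pos
  have hnR : (0 : ℝ) < L.n := by exact_mod_cast hn
  have hlogk : 1 ≤ Real.logb 2 (L.k : ℝ) := by
    rw [Real.le_logb_iff_rpow_le (by norm_num) (by positivity), Real.rpow_one]
    exact_mod_cast hk
  rw [div_le_iff₀ (by linarith)] at hcond
  have hδr : 20 ≤ δ * L.r := by
    refine le_trans ?_ hcond
    refine hL.log_ge.trans (Real.logb_le_logb_of_le (by norm_num) hnR ?_)
    nlinarith
  -- For `δ ≥ 2` the claim is certain, since `2R < 2r + 4 ≤ 3r`.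
  rcases le_or_gt 2 δ with hδ2 | hδ2
  · refine le_of_eq_of_le ?_ zero_le
    convert measure_empty (μ := coinMeasure)
    refine Set.eq_empty_of_forall_notMem fun ω hω => hω ?_
    have h1 := vcDim_le_two_parts (q := q) ha hk0 hRpos ω
    have h3 : ((((L.raw q).conceptClass (coinList ω
      (L.raw q).coinCount)).concepts.vcDim : ℕ) : ℝ) ≤ 2 * R := by exact_mod_cast h1
    have h4 : 3 * L.r ≤ (1 + δ) * L.r := mul_le_mul_of_nonneg_right (by linarith) (by linarith)
    linarith
  set D := ⌊(1 + δ) * L.r⌋₊ with hD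
  have hD1 : (1 + δ) * L.r < D + 1 := Nat.lt_floor_add_one _
  have hRD : R ≤ D + 1 := by
    have : (R : ℝ) ≤ (D + 1 : ℕ) := by push_cast; linarith
    exact_mod_cast this
  -- The excess over `R` of the least forbidden dimension.
  set T := D + 1 - R with hT
  have hTr : δ * L.r - 2 ≤ T := by
    rw [hT, Nat.cast_sub hRD]; push_cast; linarith
  -- The covered share is about `δ / 2`; the difference absorbs the roundings `R < r + 2` and `T ≥ δ
  -- r - 2`.
  set ρ := 2 * δ / 5 with hρ
  have hsub : {ω | ¬ ((((L.raw q).conceptClass (coinList ω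
      (L.raw q).coinCount)).concepts.vcDim : ℝ) ≤ (1 + δ) * L.r)} ⊆
      {ω | L.PassEvent q ρ (2 ^ T) ω} := by
    intro ω hω
    refine passEvent_of_shatters ha hk0 hRpos ?_ ?_
    · refine le_trans ?_ hTr
      rw [hρ]
      nlinarith
    · have h1 : D < ((L.raw q).conceptClass (coinList ω
        (L.raw q).coinCount)).concepts.vcDim := by
        have h0 := not_le.1 hω
        exact (Nat.floor_lt (by positivity)).2 h0
      change R + T ≤ _
      omega
  refine (measure_mono hsub).trans ((coinMeasure_passEvent_le hA hB hk0 hE q (2 ^ T)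
    (by positivity) (by rw [hρ]; nlinarith)).trans ?_)
  have hv0 := val_nonneg hk0
  set θ := (ρ ^ 2 - L.val) / 2 with hθ
  -- The density is at least `4 δ² / 25 - δ² / 100 = 3 δ² / 20`, and half of it exceeds `δ² / 16`.
  have hθ1 : δ ^ 2 / 16 ≤ θ := by rw [hθ, hρ]; nlinarith
  have hθ2 : θ ≤ 1 := by
    rw [hθ, hρ]; nlinarith
  have hqδ : 1 ≤ δ * q := by
    have := Nat.le_ceil (1 / δ)
    rw [div_le_iff₀ hδ] at this
    linarith
  -- The factor 64 in `rounds` is made for this: `64 / 16 = 4`, and `q ^ 2` compensates `δ ^ 2`.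
  have hQ : 4 * (R : ℝ) ≤ θ * (L.raw q).rounds := by
    have h1 : ((L.raw q).rounds : ℝ) = 64 * R * (q * q) := by
      change ((64 * R * (q * q) : ℕ) : ℝ) = _
      push_cast; ring
    have h2 : 1 ≤ (δ * q) ^ 2 := one_le_pow₀ hqδ
    have h3 : δ ^ 2 / 16 * (64 * R * (q * q)) ≤ θ * (64 * R * (q * q)) :=
      mul_le_mul_of_nonneg_right hθ1 (by positivity)
    rw [h1]
    refine le_trans ?_ h3
    have h4 : δ ^ 2 / 16 * (64 * (R : ℝ) * (q * q)) = 4 * R * (δ * q) ^ 2 := by ring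
    rw [h4]
    exact le_mul_of_one_le_right (by positivity) h2
  have hpass : (1 - θ) ^ (L.raw q).rounds ≤ (2⁻¹ : ℝ) ^ (4 * R) := by
    calc (1 - θ) ^ (L.raw q).rounds ≤ (Real.exp (-θ)) ^ (L.raw q).rounds := by
          refine pow_le_pow_left₀ (by linarith) ?_ _
          have := Real.add_one_le_exp (-θ)
          linarith
      _ = Real.exp (-(θ * (L.raw q).rounds)) := by rw [← Real.exp_nat_mul]; ring_nf
      _ ≤ Real.exp (-(4 * R)) := Real.exp_le_exp.2 (by linarith)
      _ = (Real.exp (-1)) ^ (4 * R) := by rw [← Real.exp_nat_mul]; push_cast; ring_nf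
      _ ≤ _ := by
          refine pow_le_pow_left₀ (Real.exp_pos _).le ?_ _
          rw [Real.exp_neg]
          refine inv_anti₀ (by norm_num) ?_
          have := Real.add_one_le_exp (1 : ℝ)
          linarith
  -- The lower bound on `δ r` enters here, and the loss of 2 in `T ≥ δ r - 2` turns 1000 into 250.
  have hN : 250 * (L.n : ℝ) * Real.logb 2 (L.k : ℝ) ≤ ((2 ^ T : ℕ) : ℝ) := by
    have h1 : (2 : ℝ) ^ (δ * L.r - 2) ≤ (2 : ℝ) ^ (T : ℝ) :=
      Real.rpow_le_rpow_of_exponent_le (by norm_num) hTr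
    have h2 : (2 : ℝ) ^ (Real.logb 2 (1000 * (L.n : ℝ) * Real.logb 2 (L.k : ℝ)) - 2) ≤
        (2 : ℝ) ^ (δ * L.r - 2) :=
      Real.rpow_le_rpow_of_exponent_le (by norm_num) (by linarith)
    rw [Real.rpow_sub (by norm_num), Real.rpow_logb (by norm_num) (by norm_num) (by positivity)]
      at h2
    rw [Real.rpow_natCast] at h1
    push_cast
    norm_num at h2
    linarith
  set N := 2 ^ T with hNdef
  have hka := two_pow_mul_pow_le hk hlogk hN
  have hnN : L.n ≤ N := by
    have : (L.n : ℝ) ≤ (N : ℕ) := by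
      refine le_trans ?_ hN
      rw [mul_assoc]
      have := le_mul_of_one_le_right hnR.le hlogk
      linarith
    exact_mod_cast this
  have hfinal := union_bound_le hka (pow_nonneg (by linarith) _) hpass hRpos hn hnN
  refine (ENNReal.ofReal_le_ofReal hfinal).trans (le_of_eq ?_)
  rw [ENNReal.ofReal_div_of_pos hnR, ENNReal.ofReal_one, ENNReal.ofReal_natCast]

end LabelCover

namespace LabelCover

variable {L : LabelCover}

/-! ### Size -/

/-- One edge makes both degrees positive, so each side has at most `|E|` vertices. -/
theorem n_le_two_mul_card (hreg : L.BiRegular) (hE : L.E.Nonempty) : L.n ≤ 2 * L.E.card := by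
  obtain ⟨dA, dB, hA, hB⟩ := hreg
  obtain ⟨e, he⟩ := hE
  have h1 : 0 < dA := by
    rw [← hA e.1]; exact Finset.card_pos.2 ⟨e, Finset.mem_filter.2 ⟨he, rfl⟩⟩
  have h2 : 0 < dB := by
    rw [← hB e.2]; exact Finset.card_pos.2 ⟨e, Finset.mem_filter.2 ⟨he, rfl⟩⟩
  have h3 := card_edges_eq_left hA
  have h4 := card_edges_eq_right hB
  have h5 : L.a ≤ L.E.card := h3 ▸ Nat.le_mul_of_pos_right _ h1
  have h6 : L.b ≤ L.E.card := h4 ▸ Nat.le_mul_of_pos_right _ h2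
  unfold n; omega

theorem esize_raw_le (hn : 1 ≤ L.n) (hk : 1 ≤ L.k) {q : ℕ} (hq : 1 ≤ q) :
    esize (L.raw q) ≤ 30 * L.n ^ 3 * L.k ^ 2 * q := by
  have hedge : ∀ e ∈ L.edgeList.map L.rawEdge, esize e ≤ 2 * L.n + L.k * (2 * L.k + 2) + 6 := by
    intro e he
    obtain ⟨e, -, rfl⟩ := List.mem_map.1 he
    have h1 : esize ((List.finRange L.k).map fun s => (L.proj e s).val) ≤
        L.k * (2 * L.k + 1 + 1) + 1 := by
      refine esize_list_le (by simp) fun v hv => ?_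
      obtain ⟨s, -, rfl⟩ := List.mem_map.1 hv
      rw [esize_nat]
      have := (L.proj e s).is_lt
      omega
    have h2 : esize (L.rawEdge e) = esize e.1.val + (esize e.2.val +
      (esize ((List.finRange L.k).map fun s => (L.proj e s).val) + 1 + 1) + 1) + 1 := rfl
    have h3 := e.1.is_lt
    have h4 := e.2.is_lt
    rw [h2, esize_nat, esize_nat]
    simp only [n]
    have h5 : L.k * (2 * L.k + 1 + 1) = L.k * (2 * L.k + 2) := rfl
    omega
  have hlen : L.edgeList.length ≤ L.n * L.n := by
    rw [length_edgeList]
    have h1 := Finset.card_le_univ L.E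
    rw [Fintype.card_prod, Fintype.card_fin, Fintype.card_fin] at h1
    exact h1.trans (Nat.mul_le_mul (Nat.le_add_right _ _) (Nat.le_add_left _ _))
  have h1 := esize_list_le (N := L.n * L.n) (by simpa using hlen) hedge
  have h2 : esize (L.raw q) = esize q + (esize L.a + (esize L.b + (esize L.k +
    (esize (L.edgeList.map L.rawEdge) + 1 + 1) + 1) + 1) + 1) + 1 := rfl
  rw [h2, esize_nat, esize_nat, esize_nat, esize_nat]
  have h3 : L.a + L.b = L.n := rfl
  have h4 : 2 * q + 2 * L.n + 2 * L.k +
      (L.n * L.n * (2 * L.n + L.k * (2 * L.k + 2) + 6 + 1) + 1) + 10 ≤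
      30 * L.n ^ 3 * L.k ^ 2 * q := by
    have hM : ∀ i ≤ 3, ∀ j ≤ 2, L.n ^ i * L.k ^ j ≤ L.n ^ 3 * L.k ^ 2 * q := by
      intro i hi j hj
      calc L.n ^ i * L.k ^ j ≤ L.n ^ 3 * L.k ^ 2 :=
            Nat.mul_le_mul (Nat.pow_le_pow_right hn hi) (Nat.pow_le_pow_right hk hj)
        _ ≤ _ := Nat.le_mul_of_pos_right _ hq
    have hq' : q ≤ L.n ^ 3 * L.k ^ 2 * q := by
      refine Nat.le_mul_of_pos_left _ ?_
      positivity
    have e1 := hM 1 (by omega) 0 (by omega)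
    have e2 := hM 0 (by omega) 1 (by omega)
    have e3 := hM 3 (by omega) 0 (by omega)
    have e4 := hM 2 (by omega) 2 (by omega)
    have e5 := hM 2 (by omega) 1 (by omega)
    have e6 := hM 2 (by omega) 0 (by omega)
    have e7 := hM 0 (by omega) 0 (by omega)
    simp only [pow_zero, pow_one, mul_one, one_mul] at e1 e2 e3 e4 e5 e6 e7
    calc _ = 2 * q + 2 * L.n + 2 * L.k + 2 * L.n ^ 3 + 2 * (L.n ^ 2 * L.k ^ 2) +
          2 * (L.n ^ 2 * L.k) + 7 * L.n ^ 2 + 11 := by ring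
      _ ≤ 30 * (L.n ^ 3 * L.k ^ 2 * q) := by omega
      _ = _ := by ring
  omega

/-- The growth unit `|Σ| ^ (|E| (1 / δ + 1)² / r)`. -/
noncomputable def unit (L : LabelCover) (δ : ℝ) : ℝ :=
  (L.k : ℝ) ^ ((L.E.card : ℝ) * (1 / δ + 1) ^ 2 / L.r)

theorem pow_le_unit_pow (hk : 2 ≤ L.k) {δ : ℝ} {s j : ℕ}
    (h : (s : ℝ) ≤ j * ((L.E.card : ℝ) * (1 / δ + 1) ^ 2 / L.r)) :
    (L.k : ℝ) ^ s ≤ L.unit δ ^ j := by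
  have hk1 : (1 : ℝ) ≤ L.k := by exact_mod_cast (by omega : 1 ≤ L.k)
  rw [unit, ← Real.rpow_natCast, ← Real.rpow_natCast, ← Real.rpow_mul (by positivity)]
  refine Real.rpow_le_rpow_of_exponent_le hk1 ?_
  linarith

theorem natCast_le_two_pow (q : ℕ) : (q : ℝ) ≤ 2 ^ q := by
  exact_mod_cast q.lt_two_pow_self.le

theorem monomial_le_pow {G n k q : ℝ} (hG : 2 ≤ G) (hn : 0 ≤ n) (hk : 0 ≤ k) (hq : 0 ≤ q)
    (hnG : n ≤ G) (hkG : k ≤ G) (hqG : q ≤ G) : 30 * n ^ 3 * k ^ 2 * q ≤ G ^ 14 := by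
  have h30 : (30 : ℝ) ≤ G ^ 5 := by
    have := pow_le_pow_left₀ (by norm_num) hG 5
    norm_num at this
    linarith
  calc _ ≤ G ^ 5 * G ^ 3 * G ^ 2 * G := by gcongr
    _ = G ^ 11 := by ring
    _ ≤ G ^ 14 := pow_le_pow_right₀ (by linarith) (by norm_num)

-- From `(r log n)² = n ≤ 2|E|` it follows that `|E| / r ≥ r (log n)² / 2`, which dominates `√n = r
-- log n` as well as `r`. Moreover `partSize ≤ 2|E| / r + 1`, and `R ≤ 2|E| / r` with `q ≤ 1 / δ +
-- 1` bounds `rounds` by 128 times the exponent of `unit`. This is the largest term; the sum of all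
-- six is at most 8 times the 128th power, and `8 ≤ unit ^ 3` gives 131.
set_option maxHeartbeats 1000000 in
theorem expWeight_add_esize_le (hL : L.Large) (hreg : L.BiRegular) (hE : L.E.Nonempty)
    (hk : 2 ≤ L.k) {δ : ℝ} (hδ : 0 < δ) :
    (((L.raw ⌈1 / δ⌉₊).expWeight + esize (L.raw ⌈1 / δ⌉₊) + 1 : ℕ) : ℝ) ≤ L.unit δ ^ 131 := by
  set q := ⌈1 / δ⌉₊ with hq
  set Y := (L.E.card : ℝ) * (1 / δ + 1) ^ 2 / L.r with hY
  set ℓ := Real.logb 2 L.n with hℓ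
  have hr := hL.fifty_le_r
  have hl := hL.log_ge
  have hrl := hL.r_mul_log
  have hn1 : 1 ≤ L.n := hL.n_pos
  have hnR : (1 : ℝ) ≤ L.n := by exact_mod_cast hn1
  have hR1 := hL.r_le_parts q
  have hR2 := hL.parts_lt q
  have hnE : (L.n : ℝ) ≤ 2 * L.E.card := by exact_mod_cast n_le_two_mul_card hreg hE
  have hδ1 : 0 < 1 / δ := by positivity
  have hd1 : 1 ≤ (1 / δ + 1) ^ 2 := by nlinarith
  have hq0 : 1 ≤ q := Nat.ceil_pos.2 hδ1
  have hqd : (q : ℝ) ≤ 1 / δ + 1 := (Nat.ceil_lt_add_one hδ1.le).le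
  have hqd2 : (q : ℝ) * q ≤ (1 / δ + 1) ^ 2 := by
    rw [sq]; exact mul_self_le_mul_self (Nat.cast_nonneg _) hqd
  have hsq : √(L.n : ℝ) * √(L.n : ℝ) = L.n := Real.mul_self_sqrt (by positivity)
  have hrpos : 0 < L.r := by linarith
  have hEr : L.r * ℓ ^ 2 / 2 ≤ (L.E.card : ℝ) / L.r := by
    rw [le_div_iff₀ hrpos]
    have : L.r * ℓ ^ 2 / 2 * L.r = (L.r * ℓ) * (L.r * ℓ) / 2 := by ring
    rw [this, hrl, hsq]
    linarith
  have hYE : (L.E.card : ℝ) / L.r * (1 / δ + 1) ^ 2 = Y := by rw [hY]; ring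
  have hE0 : 0 ≤ (L.E.card : ℝ) / L.r := by positivity
  have hYE1 : (L.E.card : ℝ) / L.r ≤ Y := by
    rw [← hYE]; exact le_mul_of_one_le_right hE0 hd1
  have hrE : L.r ≤ (L.E.card : ℝ) / L.r := by
    refine le_trans ?_ hEr
    have h20 : 20 ≤ ℓ := hl
    rw [mul_div_assoc]
    exact le_mul_of_one_le_right hrpos.le (by nlinarith)
  have hrl' : L.r * ℓ ≤ (L.E.card : ℝ) / L.r := by
    refine le_trans ?_ hEr
    have : L.r * ℓ ^ 2 / 2 = L.r * ℓ * (ℓ / 2) := by ring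
    rw [this]
    exact le_mul_of_one_le_right (by positivity) (by linarith)
  have hY1 : 1 ≤ Y := by linarith
  have hk1 : (1 : ℝ) ≤ L.k := by exact_mod_cast (by omega : 1 ≤ L.k)
  have hk2 : (2 : ℝ) ≤ L.k := by exact_mod_cast hk
  have hG2 : 2 ≤ L.unit δ := by
    have := pow_le_unit_pow (L := L) hk (δ := δ) (s := 1) (j := 1)
      (by rw [Nat.cast_one, one_mul]; exact hY1)
    simp only [pow_one] at this
    linarith
  have hG1 : 1 ≤ L.unit δ := by linarith
  have e1 : ((2 ^ (Nat.sqrt (L.raw q).verts + 1) : ℕ) : ℝ) ≤ L.unit δ ^ 2 := by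
    push_cast
    refine (pow_le_pow_left₀ (by norm_num) hk2 _).trans (pow_le_unit_pow hk ?_)
    have h1 : ((Nat.sqrt L.n : ℕ) : ℝ) ≤ √(L.n : ℝ) := Real.nat_sqrt_le_real_sqrt
    change ((Nat.sqrt L.n + 1 : ℕ) : ℝ) ≤ (2 : ℕ) * Y
    push_cast
    linarith
  have e2 : ((2 ^ (L.raw q).parts : ℕ) : ℝ) ≤ L.unit δ ^ 2 := by
    push_cast
    refine (pow_le_pow_left₀ (by norm_num) hk2 _).trans (pow_le_unit_pow hk ?_)
    push_cast
    linarith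
  have halph : (L.raw q).alphabet.length = L.k := List.length_range
  have e3 : (((L.raw q).alphabet.length ^ (L.raw q).partSize : ℕ) : ℝ) ≤ L.unit δ ^ 3 := by
    rw [halph]
    push_cast
    refine pow_le_unit_pow hk ?_
    have h1 : (((L.n / (L.raw q).parts : ℕ)) : ℝ) ≤ (L.n : ℝ) / (L.raw q).parts := Nat.cast_div_le
    have h2 : (L.n : ℝ) / (L.raw q).parts ≤ 2 * L.E.card / L.r := by gcongr
    have h3 : 2 * (L.E.card : ℝ) / L.r = 2 * (L.E.card / L.r) := by ring
    change ((L.n / (L.raw q).parts + 1 : ℕ) : ℝ) ≤ (3 : ℕ) * Y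
    push_cast
    linarith
  have e4 : (((L.raw q).alphabet.length ^ (L.raw q).rounds : ℕ) : ℝ) ≤ L.unit δ ^ 128 := by
    rw [halph]
    push_cast
    refine pow_le_unit_pow hk ?_
    change ((64 * (L.raw q).parts * (q * q) : ℕ) : ℝ) ≤ (128 : ℕ) * Y
    push_cast
    have h1 : ((L.raw q).parts : ℝ) ≤ 2 * (L.E.card / L.r) := by linarith
    calc 64 * ((L.raw q).parts : ℝ) * (q * q) ≤ 64 * (2 * (L.E.card / L.r)) * (1 / δ + 1) ^ 2 := by
          gcongr
      _ = 128 * (L.E.card / L.r * (1 / δ + 1) ^ 2) := by ring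
      _ = _ := by rw [hYE]
  have e5 : (esize (L.raw q) : ℝ) ≤ L.unit δ ^ 14 := by
    have h1 : (esize (L.raw q) : ℝ) ≤ 30 * (L.n : ℝ) ^ 3 * (L.k : ℝ) ^ 2 * q := by
      exact_mod_cast esize_raw_le hn1 (by omega) hq0
    have h2 : (L.n : ℝ) ≤ L.unit δ ^ 1 := by
      have : (L.n : ℝ) = (2 : ℝ) ^ ℓ := (Real.rpow_logb (by norm_num) (by norm_num) (by linarith)).symm
      rw [this, pow_one, unit]
      calc (2 : ℝ) ^ ℓ ≤ (L.k : ℝ) ^ ℓ := Real.rpow_le_rpow (by norm_num) hk2 (by linarith)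
        _ ≤ _ := Real.rpow_le_rpow_of_exponent_le hk1 (by
          change ℓ ≤ Y
          nlinarith)
    have h3 : (L.k : ℝ) ^ 1 ≤ L.unit δ ^ 1 := pow_le_unit_pow hk
      (by rw [Nat.cast_one, one_mul]; exact hY1)
    have h4 : (q : ℝ) ≤ L.unit δ ^ 1 := by
      have : (q : ℝ) ≤ (L.k : ℝ) ^ q := by
        exact (natCast_le_two_pow q).trans (pow_le_pow_left₀ (by norm_num) hk2 _)
      refine this.trans (pow_le_unit_pow hk ?_)
      have h6 : (q : ℝ) ≤ q * q := by
        have : (1 : ℝ) ≤ q := by exact_mod_cast hq0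
        nlinarith
      have h7 : (1 / δ + 1) ^ 2 ≤ Y := by
        rw [← hYE]; exact le_mul_of_one_le_left (by positivity) (by linarith)
      change (q : ℝ) ≤ (1 : ℕ) * Y
      rw [Nat.cast_one, one_mul]
      exact h6.trans (hqd2.trans h7)
    rw [pow_one] at h2 h3 h4
    rw [pow_one] at h3
    exact h1.trans (monomial_le_pow hG2 (Nat.cast_nonneg _) (Nat.cast_nonneg _) (Nat.cast_nonneg _)
      h2 h3 h4)
  have hmono : ∀ i ≤ 128, L.unit δ ^ i ≤ L.unit δ ^ 128 := fun i hi => pow_le_pow_right₀ hG1 hi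
  have m1 := hmono 2 (by norm_num)
  have m2 := hmono 3 (by norm_num)
  have m3 := hmono 14 (by norm_num)
  have m4 := hmono 0 (by norm_num)
  rw [pow_zero] at m4
  have h8 : (8 : ℝ) ≤ L.unit δ ^ 3 := by
    have := pow_le_pow_left₀ (by norm_num) hG2 3
    norm_num at this
    exact this
  have hG128 : 0 ≤ L.unit δ ^ 128 := by positivity
  rw [RawInput.expWeight, Nat.cast_add, Nat.cast_add, Nat.cast_add, Nat.cast_add, Nat.cast_add,
    Nat.cast_one]
  calc _ ≤ 8 * L.unit δ ^ 128 := by linarith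
    _ ≤ L.unit δ ^ 3 * L.unit δ ^ 128 := mul_le_mul_of_nonneg_right h8 hG128
    _ = _ := by rw [← pow_add]

/-- The polynomial in the exponent of the size bound. -/
noncomputable def sizePoly (c : ℕ) : Polynomial ℝ := Polynomial.C (131 * c : ℝ) * (Polynomial.X + 1) ^ 2

theorem unit_pow_eq_sizeBound (hk : 2 ≤ L.k) (δ : ℝ) (c : ℕ) :
    (L.unit δ ^ 131) ^ c = sizeBound (sizePoly c) δ L := by
  have hk1 : (0 : ℝ) ≤ L.k := by positivity
  rw [← pow_mul, unit, sizeBound, sizePoly, ← Real.rpow_natCast, ← Real.rpow_mul hk1]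
  congr 1
  simp only [Polynomial.eval_mul, Polynomial.eval_C, Polynomial.eval_pow, Polynomial.eval_add,
    Polynomial.eval_X, Polynomial.eval_one]
  push_cast
  ring

/-! ### The growth conditions -/

theorem eventually_sq_logb_le {ε : ℝ} (hε : 0 < ε) :
    ∀ᶠ n : ℕ in Filter.atTop, Real.logb 2 n ^ 2 ≤ ε * √(n : ℝ) := by
  have h := (isLittleO_log_rpow_rpow_atTop (s := 1 / 2) (2 : ℝ) (by norm_num)).comp_tendsto
    tendsto_natCast_atTop_atTop
  have hl : (0 : ℝ) < Real.log 2 ^ 2 := by have := Real.log_pos (x := 2) (by norm_num); positivity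
  filter_upwards [h.bound (mul_pos hε hl)] with n hn
  simp only [Function.comp_apply] at hn
  rw [Real.norm_of_nonneg (by positivity), Real.norm_of_nonneg (by positivity), ← Real.sqrt_eq_rpow,
    Real.rpow_two] at hn
  rw [Real.logb, div_pow, div_le_iff₀ hl]
  linarith

theorem eventually_le_logb (C : ℝ) : ∀ᶠ n : ℕ in Filter.atTop, C ≤ Real.logb 2 n :=
  ((Real.tendsto_logb_atTop (by norm_num)).comp tendsto_natCast_atTop_atTop).eventually_ge_atTop C

theorem exists_large : ∃ n₀ : ℕ, ∀ L : LabelCover, n₀ ≤ L.n → L.Large := by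
  obtain ⟨n₀, h⟩ := Filter.eventually_atTop.1
    ((eventually_le_logb 50).and (eventually_sq_logb_le one_pos))
  refine ⟨n₀, fun L hL => ?_⟩
  obtain ⟨h1, h2⟩ := h L.n hL
  refine ⟨by linarith, ?_⟩
  rw [one_mul] at h2
  nlinarith

/-- For a bounded alphabet `1000 log k ≤ n` eventually, so the left side is at most `2 (log n)² /
√n`, which tends to zero. -/
theorem exists_cond {δ : ℝ} (hδ : 0 < δ) (k₀ : ℕ) : ∃ n₀ : ℕ, ∀ L : LabelCover, n₀ ≤ L.n →
    2 ≤ L.k → L.k ≤ k₀ →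
      Real.logb 2 (1000 * (L.n : ℝ) * Real.logb 2 (L.k : ℝ)) / L.r ≤ δ := by
  obtain ⟨n₀, h⟩ := Filter.eventually_atTop.1
    ((eventually_le_logb (max 1 (Real.logb 2 (1000 * Real.logb 2 k₀)))).and
      (eventually_sq_logb_le (half_pos hδ)))
  refine ⟨max n₀ 1, fun L hL hk hk₀ => ?_⟩
  obtain ⟨h1, h2⟩ := h L.n ((le_max_left _ _).trans hL)
  have hn : 1 ≤ L.n := (le_max_right _ _).trans hL
  have hnR : (0 : ℝ) < L.n := by exact_mod_cast hn
  have hkR : (0 : ℝ) < L.k := by exact_mod_cast (by omega : 0 < L.k)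
  have hk₀R : (L.k : ℝ) ≤ k₀ := by exact_mod_cast hk₀
  have hlogk : 0 < Real.logb 2 (L.k : ℝ) :=
    Real.logb_pos (by norm_num) (by exact_mod_cast (by omega : 1 < L.k))
  have hlogk₀ : Real.logb 2 (L.k : ℝ) ≤ Real.logb 2 (k₀ : ℝ) :=
    Real.logb_le_logb_of_le (by norm_num) hkR hk₀R
  have hl1 := (le_max_left _ _).trans h1
  have hl2 := (le_max_right _ _).trans h1
  have h3 : Real.logb 2 (1000 * (L.n : ℝ) * Real.logb 2 (L.k : ℝ)) ≤ 2 * Real.logb 2 (L.n : ℝ) := by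
    calc _ = Real.logb 2 ((1000 * Real.logb 2 (L.k : ℝ)) * L.n) := by ring_nf
      _ = Real.logb 2 (1000 * Real.logb 2 (L.k : ℝ)) + Real.logb 2 L.n :=
          Real.logb_mul (by positivity) (by positivity)
      _ ≤ Real.logb 2 (1000 * Real.logb 2 (k₀ : ℝ)) + Real.logb 2 L.n := by
          gcongr
          norm_num
      _ ≤ _ := by linarith
  have hs : 0 < √(L.n : ℝ) := Real.sqrt_pos.2 hnR
  rw [r, div_div_eq_mul_div, div_le_iff₀ hs]
  nlinarith

/-! ### Assembly of size, completeness and soundness. -/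

theorem reductionGuarantee_of_large {R : Prog} {c : ℕ}
    (hR : ∀ (x : RawInput) (ω : ℕ → Bool),
      (∃ j t, Run ω R (enc x) 0 (enc (x.output (coinList ω x.coinCount))) j t ∧
        t ≤ (x.expWeight + esize x + 1) ^ c) ∧
      esize (x.output (coinList ω x.coinCount)) ≤ (x.expWeight + esize x + 1) ^ c)
    (hL : L.Large) (hreg : L.BiRegular) (hE : L.E.Nonempty) (hk : 2 ≤ L.k) {δ : ℝ} (hδ : 0 < δ)
    (hcond : Real.logb 2 (1000 * (L.n : ℝ) * Real.logb 2 (L.k : ℝ)) / L.r ≤ δ) :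
    ReductionGuarantee (sizePoly c) R δ L := by
  have hsize : (((L.raw ⌈1 / δ⌉₊).expWeight + esize (L.raw ⌈1 / δ⌉₊) + 1) ^ c : ℕ) ≤
      sizeBound (sizePoly c) δ L := by
    rw [← unit_pow_eq_sizeBound hk, Nat.cast_pow]
    exact pow_le_pow_left₀ (Nat.cast_nonneg _) (expWeight_add_esize_le hL hreg hE hk hδ) c
  refine ⟨fun ω => (L.raw ⌈1 / δ⌉₊).conceptClass (coinList ω (L.raw ⌈1 / δ⌉₊).coinCount),
    fun ω => ?_, fun hsat ω => ?_, coinMeasure_vcDim_gt_le hL hreg hE hk hδ hcond⟩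
  · obtain ⟨⟨j, t, hrun, ht⟩, hout⟩ := hR (L.raw ⌈1 / δ⌉₊) ω
    rw [enc_raw] at hrun
    refine ⟨⟨_, j, t, hrun, RawInput.describes_conceptClass _ _, le_trans ?_ hsize⟩,
      le_trans ?_ hsize, le_trans ?_ hsize⟩
    · exact_mod_cast ht
    · exact_mod_cast (RawInput.card_concepts_le _ _).trans hout
    · exact_mod_cast (RawInput.u_le _ _).trans hout
  · have h1 := hL.r_le_parts ⌈1 / δ⌉₊
    have h2 := two_parts_le_vcDim hsat hE ⌈1 / δ⌉₊ (coinList ω (L.raw ⌈1 / δ⌉₊).coinCount)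
    refine le_trans ?_ (Nat.cast_le.2 h2)
    push_cast
    linarith

end LabelCover

theorem theorem3 :
    ∃ (P : Polynomial ℝ) (R : Prog),
      -- constant `δ`, bounded alphabet
      (∀ δ : ℝ, 0 < δ → ∀ k₀ : ℕ, ∃ n₀ : ℕ, ∀ L : LabelCover,
        L.BiRegular → L.E.Nonempty → 2 ≤ L.k → L.k ≤ k₀ → n₀ ≤ L.n →
          ReductionGuarantee P R δ L) ∧
      -- arbitrary `δ` and alphabet, subject to `δ ≥ log(1000 n log|Σ|) / r`
      (∃ n₀ : ℕ, ∀ (δ : ℝ) (L : LabelCover), 0 < δ →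
        L.BiRegular → L.E.Nonempty → 2 ≤ L.k → n₀ ≤ L.n →
        Real.logb 2 (1000 * (L.n : ℝ) * Real.logb 2 (L.k : ℝ)) / L.r ≤ δ →
          ReductionGuarantee P R δ L) := by
  obtain ⟨R, c, hR⟩ := exists_reduction
  obtain ⟨n₁, hn₁⟩ := LabelCover.exists_large
  refine ⟨LabelCover.sizePoly c, R, fun δ hδ k₀ => ?_, n₁, fun δ L hδ hreg hE hk hn hcond =>
    LabelCover.reductionGuarantee_of_large hR (hn₁ L hn) hreg hE hk hδ hcond⟩
  obtain ⟨n₂, hn₂⟩ := LabelCover.exists_cond hδ k₀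
  exact ⟨max n₁ n₂, fun L hreg hE hk hk₀ hn => LabelCover.reductionGuarantee_of_large hR
    (hn₁ L ((le_max_left _ _).trans hn)) hreg hE hk hδ
    (hn₂ L ((le_max_right _ _).trans hn) hk hk₀)⟩
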